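/- Let $q$ be a prime power. For a finite poset $P$ let $\widetilde\chi(P)=\sum_{s}(-1)^{|s|-1}$, the sum over all chains $s$ of $P$ including the empty one, and for a finite group $G$ acting on $P$ by poset automorphisms let $$\widetilde\chi_r(P,G)=\frac1{|G|}\sum_{X\in\mathrm{Hom}(\mathbf Z^r,G)}\widetilde\chi\bigl(C_P(X(\mathbf Z^r))\bigr),$$ where $C_P(A)$ is the subposet of elements of $P$ fixed by $A$. Let $\mathrm{GU}_n(q)$ be the group of linear automorphisms of $\mathbf F_{q^2}^n$ that preserve the nondegenerate Hermitian form $\langle u,v\rangle=c\sum_{i=1}^n(-1)^{i+1}u_iv_{n+1-i}^q$, where $c\in\mathbf F_{q^2}^\times$ satisfies $c^{q-1}=(-1)^{n+1}$. Let $L_n^-(q)^*$ be the poset of nonzero totally isotropic subspaces of $\mathbf F_{q^2}^n$, and put $\widetilde\chi_r(\mathrm{GU}_n(q))=\widetilde\chi_r(L_n^-(q)^*,\mathrm{GU}_n(q))$. Let $\widetilde\chi_r(\mathrm{GL}_n(q))$ be the $r$th equivariant reduced Euler characteristic of $\mathrm{GL}_n(q)$ acting on the poset of nonzero proper subspaces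 of $\mathbf F_q^n$. For a polynomial $f=a_0\prod_i(x-\alpha_i)\in\mathbf F_{q^2}[x]$ with $f(0)\neq0$ (the $\alpha_i$ in a splitting field), the dual polynomial is $\bar f=a_0\prod_i(x-\alpha_i^{-q})\in\mathbf F_{q^2}[x]$, and $f$ is self-dual if $f=\bar f$. Let $n>1$ and $r\ge1$. Then $$\widetilde\chi_{r+1}(\mathrm{GU}_n(q))=\sum_{[g]}\widetilde\chi_r\bigl(C_{L_n^-(q)^*}(g),\,C_{\mathrm{GU}_n(q)}(g)\bigr),$$ where the sum runs over the conjugacy classes $[g]$ of $\mathrm{GU}_n(q)$ of elements of order prime to $q$. Moreover, for every $g\in\mathrm{GU}_n(q)$ of order prime to $q$, the characteristic polynomial of $g$ has the form $$\prod_i r_i^{m_i^-}\cdot\prod_j(s_j\bar s_j)^{m_j^+}$$ with positive exponents, where the $r_i$ are distinct self-dual monic irreducible polynomials, the $s_j$ are monic irreducible polynomials that are not self-dual, all with nonzero constant term, and the pairs $\{s_j,\bar s_j\}$ are distinct; and for every such factorization, with $d_i^-=\deg r_i$ and $d_j^+=\deg s_j$, one has $\sum_i m_i^-d_i^-+\sum_j2m_j^+d_j^+=n$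 and $$-\widetilde\chi_r\bigl(C_{L_n^-(q)^*}(g),\,C_{\mathrm{GU}_n(q)}(g)\bigr)=\prod_i\bigl(-\widetilde\chi_r(\mathrm{GU}_{m_i^-}(q^{d_i^-}))\bigr)\cdot\prod_j\widetilde\chi_r(\mathrm{GL}_{m_j^+}(q^{2d_j^+})).$$ -/

import Mathlib

open Polynomial
open scoped Pointwise

noncomputable section

namespace UnitaryEuler

/-- The reduced Euler characteristic of a finite subposet `P` of `Q`: the sum of `(-1)^(|s|-1)`
over all chains `s` in `P`, the empty chain included (so `∅` has reduced Euler
characteristic `-1`). -/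
def redEuler {Q : Type*} [PartialOrder Q] (P : Set Q) : ℤ :=
  ∑ᶠ (s : Finset Q) (_ : (s : Set Q) ⊆ P ∧ IsChain (· ≤ ·) (s : Set Q)), (-1) ^ (s.card + 1)

/-- The `r`th equivariant reduced Euler characteristic of the `H`-poset `P`, where `P` is a finite
subposet of the `Γ`-poset `Q` that is stable under the finite subgroup `H` of `Γ`. -/
def eqEuler {Γ Q : Type*} [Group Γ] [PartialOrder Q] [MulAction Γ Q]
    (r : ℕ) (H : Subgroup Γ) (P : Set Q) : ℚ :=
  (1 / (Nat.card H : ℚ)) *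
    ∑ᶠ X : Multiplicative (Fin r → ℤ) →* H,
      (redEuler {x : Q | x ∈ P ∧ ∀ h ∈ X.range, (h : Γ) • x = x} : ℚ)

/-- The sum in `eqEuler` is over a finite set if the group is finite. -/
instance finite_hom (r : ℕ) (G : Type*) [Group G] [Finite G] :
    Finite (Multiplicative (Fin r → ℤ) →* G) := by
  refine Finite.of_injective
    (fun X (i : Fin r) => X (Multiplicative.ofAdd (Pi.single i 1))) ?_
  intro X Y h
  refine MonoidHom.ext fun v => ?_
  refine Pi.single_induction (M := fun _ : Fin r => ℤ)
    (fun w => X (Multiplicative.ofAdd w) = Y (Multiplicative.ofAdd w)) (Multiplicative.toAdd v)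
    ?_ ?_ ?_
  · rw [ofAdd_zero, map_one, map_one]
  · intro f g hf hg
    rw [ofAdd_add, map_mul, map_mul, hf, hg]
  · intro i m
    have hm : (Pi.single i m : Fin r → ℤ) = m • Pi.single i 1 := by
      rw [← Pi.single_smul, smul_eq_mul, mul_one]
    rw [hm, ofAdd_zsmul, map_zpow, map_zpow]
    exact congrArg (· ^ m) (congrFun h i)

section Form

variable (K : Type*) [Field K] (q n : ℕ)

/-- A scalar `c ≠ 0` with `c ^ (q - 1) = (-1) ^ (n + 1)`; it exists in a field with `q ^ 2`
elements. -/
def hermConst : K := Classical.epsilon fun c : K => c ≠ 0 ∧ c ^ (q - 1) = (-1) ^ (n + 1)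

theorem hermConst_spec [Finite K] {p k : ℕ} [CharP K p] (hp : p.Prime) (hk : 0 < k)
    (hq : q = p ^ k) (hK : Nat.card K = q ^ 2) :
    hermConst K q n ≠ 0 ∧ hermConst K q n ^ (q - 1) = (-1) ^ (n + 1) := by
  apply Classical.epsilon_spec (p := fun c : K => c ≠ 0 ∧ c ^ (q - 1) = (-1) ^ (n + 1))
  have hq1 : 1 < q := hq ▸ Nat.one_lt_pow hk.ne' hp.one_lt
  rcases Nat.even_or_odd n with hn | hn
  · have : Fintype K := Fintype.ofFinite K
    have : Fact p.Prime := ⟨hp⟩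
    have hcard : Fintype.card K = q ^ 2 := by rw [← Nat.card_eq_fintype_card, hK]
    obtain ⟨a, ha⟩ : ∃ a : K, a ^ q ≠ a := by
      by_contra! hall
      have hne : (X ^ q - X : K[X]) ≠ 0 := FiniteField.X_pow_card_sub_X_ne_zero K hq1
      have h1 : Fintype.card K ≤ (X ^ q - X : K[X]).natDegree :=
        Polynomial.card_le_degree_of_subset_roots (p := X ^ q - X) (Z := Finset.univ) (by
          intro x _
          rw [Polynomial.mem_roots hne]
          simp [hall x])
      rw [FiniteField.X_pow_card_sub_X_natDegree_eq K hq1, hcard] at h1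
      nlinarith
    have hc : a ^ q - a ≠ 0 := sub_ne_zero.mpr ha
    refine ⟨a ^ q - a, hc, ?_⟩
    have h2 : (a ^ q - a) ^ q = -(a ^ q - a) := by
      have h3 : (a ^ q - a) ^ q = (a ^ q) ^ q - a ^ q := by
        rw [hq]; exact sub_pow_char_pow ..
      rw [h3, ← pow_mul, ← pow_two, ← hcard, FiniteField.pow_card]; ring
    have h4 : (a ^ q - a) ^ (q - 1) * (a ^ q - a) = -1 * (a ^ q - a) := by
      rw [← pow_succ, Nat.sub_add_cancel hq1.le, h2]; ring
    rw [mul_right_cancel₀ hc h4, hn.add_one.neg_one_pow]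
  · exact ⟨1, one_ne_zero, by rw [one_pow, hn.add_one.neg_one_pow]⟩

/-- The Hermitian form `⟨u, v⟩ = c ∑ i, (-1)^(i+1) u_i v_{n+1-i}^q` (`i = 1, …, n`) on `K ^ n`,
where `K` has `q ^ 2` elements; the indices in the code start at `0`. -/
def hermForm (u v : Fin n → K) : K :=
  hermConst K q n * ∑ i : Fin n, (-1) ^ (i : ℕ) * u i * v (Fin.rev i) ^ q

/-- The group of all linear automorphisms of `K ^ n` that preserve the Hermitian form. -/
def unitaryGroup : Subgroup ((Fin n → K) ≃ₗ[K] (Fin n → K)) where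
  carrier := {g | ∀ u v, hermForm K q n (g u) (g v) = hermForm K q n u v}
  mul_mem' {g h} hg hh u v := by
    rw [LinearEquiv.mul_apply, LinearEquiv.mul_apply, hg, hh]
  one_mem' _ _ := rfl
  inv_mem' {g} hg u v := by
    rw [← hg]
    exact congrArg₂ _ (g.apply_symm_apply u) (g.apply_symm_apply v)

/-- The poset of nonzero totally isotropic subspaces of `K ^ n`, ordered by inclusion. -/
def isotropicPoset : Set (Submodule K (Fin n → K)) :=
  {U | U ≠ ⊥ ∧ ∀ u ∈ U, ∀ v ∈ U, hermForm K q n u v = 0}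

/-- The poset of nonzero proper subspaces of `K ^ n`, ordered by inclusion. -/
def properPoset : Set (Submodule K (Fin n → K)) := {U | U ≠ ⊥ ∧ U ≠ ⊤}

end Form

section Galois

variable (p : ℕ) [Fact p.Prime] (k : ℕ)

/-- `GU n (p ^ k)`, acting on `𝔽 ^ n` with `𝔽` the field with `(p ^ k) ^ 2` elements. -/
abbrev GU (n : ℕ) :
    Subgroup ((Fin n → GaloisField p (2 * k)) ≃ₗ[GaloisField p (2 * k)]
      (Fin n → GaloisField p (2 * k))) :=
  unitaryGroup (GaloisField p (2 * k)) (p ^ k) n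

/-- The `r`th equivariant reduced Euler characteristic of `GU n (p ^ k)` acting on the nonzero
totally isotropic subspaces. -/
def chiGU (n r : ℕ) : ℚ :=
  eqEuler r (GU p k n) (isotropicPoset (GaloisField p (2 * k)) (p ^ k) n)

/-- The `r`th equivariant reduced Euler characteristic of `GL n (p ^ k)` acting on the nonzero
proper subspaces. -/
def chiGL (n r : ℕ) : ℚ :=
  eqEuler r
    (⊤ : Subgroup ((Fin n → GaloisField p k) ≃ₗ[GaloisField p k] (Fin n → GaloisField p k)))
    (properPoset (GaloisField p k) n)

/-- The `r`th equivariant reduced Euler characteristic of the centralizer of `g` in `GU n (p ^ k)`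
acting on the `g`-invariant nonzero totally isotropic subspaces. -/
def chiCentralizer (n r : ℕ) (g : GU p k n) : ℚ :=
  eqEuler r (GU p k n ⊓ Subgroup.centralizer {g.1})
    {U | U ∈ isotropicPoset (GaloisField p (2 * k)) (p ^ k) n ∧ g.1 • U = U}

end Galois

section Dual

variable {K : Type*} [Field K] (q : ℕ)

/-- `f'` is the dual of `f`: if `f = a₀ ∏ (X - αᵢ)` over the splitting field of `f`,
then `f' = a₀ ∏ (X - αᵢ ^ (-q))`. -/
def IsDual (f f' : K[X]) : Prop :=
  f'.map (algebraMap K f.SplittingField) =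
    C (algebraMap K f.SplittingField f.leadingCoeff) *
      ((f.aroots f.SplittingField).map fun α => X - C (α⁻¹ ^ q)).prod

/-- `f = ∏ i, ρ i ^ a i * ∏ j, (s j * s' j) ^ b j` is the factorization of `f` into irreducibles,
with the `ρ i` the distinct self-dual monic irreducible factors and the `{s j, s' j}` the distinct
pairs of a monic irreducible factor that is not self-dual and its dual. -/
structure IsDualFactorization (f : K[X]) {I J : ℕ} (ρ : Fin I → K[X]) (a : Fin I → ℕ)
    (s s' : Fin J → K[X]) (b : Fin J → ℕ) : Prop where
  monic_self : ∀ i, (ρ i).Monic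
  irreducible_self : ∀ i, Irreducible (ρ i)
  coeff_zero_self : ∀ i, (ρ i).coeff 0 ≠ 0
  dual_self : ∀ i, IsDual q (ρ i) (ρ i)
  injective_self : Function.Injective ρ
  pos_self : ∀ i, 0 < a i
  monic_pair : ∀ j, (s j).Monic
  irreducible_pair : ∀ j, Irreducible (s j)
  coeff_zero_pair : ∀ j, (s j).coeff 0 ≠ 0
  dual_pair : ∀ j, IsDual q (s j) (s' j)
  ne_pair : ∀ j, s j ≠ s' j
  distinct_pair : ∀ j j', j ≠ j' → s j ≠ s j' ∧ s j ≠ s' j'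
  pos_pair : ∀ j, 0 < b j
  eq_prod : f = (∏ i, ρ i ^ a i) * ∏ j, (s j * s' j) ^ b j

end Dual

end UnitaryEuler

end

open Polynomial
open scoped Pointwise

noncomputable section

namespace UnitaryEuler

/-! Write `K` for the field with `q ^ 2` elements, `V` for the Hermitian space and `h` for its form.

Recursion: a homomorphism from `ℤ ^ (r + 1)` to `G` is an element `g` together with a homomorphism
from `ℤ ^ r` to the centralizer of `g`. Collecting conjugate `g` gives a sum over all classes
(`eqEuler_succ_eq_finsum_conjClasses`). If `p` divides the order of `g`, some power `u` of `g` has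
order `p`. It is unipotent and commutes with the whole centralizer. With `W = ker (u - 1)` and `R =
W ⊓ im (u - 1)`, the comparisons `U ≥ U ⊓ W ≤ (U ⊓ W) ⊔ R ≥ R` contract every fixed-point poset that
occurs, so the class contributes `0` (`redEuler_invariant_eq_zero`, `chiCentralizer_eq_zero`).

Product formula: let `g` be semisimple. Up to an invertible factor, the adjoint of `f(g)` is
`f̄(g)`. Hence `V` is the orthogonal sum of the kernels of the `ρ i (g)` and the `(s j * s' j)(g)`.
The centralizer is a product of groups and the poset of invariant isotropic subspaces, zero
included, is a product of posets. Möbius functions multiply, so the negated Euler characteristics do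
too (`isoEuler_eq_prod`).

On a self-dual summand the field `F = K[X]/(ρ i)` acts, and `h` is the trace of a Hermitian form
over `F`. Such forms are classified by their dimension, which gives `GU` over the larger field
(`isoEuler_selfDual`). A summand of a pair is `W ⊕ W'` with both parts totally isotropic and in
duality. The centralizer restricts isomorphically to `W`, and invariant isotropic subspaces
correspond to intervals of invariant subspaces of `W`. Passing from intervals to proper subspaces
changes the sign, which yields `GL` (`isoEuler_hyperbolic`, `isoEuler_pair`). -/

open scoped Classical in
/-- The sum of `(-1) ^ |s|` over the chains `s` of a finite subposet. -/
def chainSum {Q : Type*} [PartialOrder Q] (S : Finset Q) : ℤ :=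
  ∑ s ∈ S.powerset, if IsChain (· ≤ ·) (s : Set Q) then (-1) ^ s.card else 0

/-! ### Euler characteristics and Möbius functions of finite posets. -/

section Poset

variable {Q : Type*} [PartialOrder Q]

theorem redEuler_coe (S : Finset Q) : redEuler (S : Set Q) = -chainSum S := by
  classical
  unfold redEuler chainSum
  rw [← Finset.sum_filter, ← Finset.sum_neg_distrib]
  refine (finsum_cond_eq_sum_of_cond_iff (fun s : Finset Q => (-1 : ℤ) ^ (s.card + 1))
    (t := S.powerset.filter fun s => IsChain (· ≤ ·) (s : Set Q)) ?_).trans ?_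
  · intro s _
    simp
  · exact Finset.sum_congr rfl fun s _ => by ring

theorem redEuler_eq_of_mem_iff {P : Set Q} (S : Finset Q) (h : ∀ x, x ∈ P ↔ x ∈ S) :
    redEuler P = -chainSum S := by
  rw [← redEuler_coe]
  congr 1
  ext x
  simp [h]

-- A chain either avoids the maximal element `m`, or is `m` added to a chain of elements strictly
-- below `m`; adding `m` flips the sign.
open scoped Classical in
theorem chainSum_eq_erase_sub {S : Finset Q} {m : Q} (hm : m ∈ S) (hmax : ∀ x ∈ S, ¬ m < x) :
    chainSum S = chainSum (S.erase m) - chainSum (S.filter (· < m)) := by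
  have hchain : ∀ t ∈ (S.erase m).powerset, (IsChain (· ≤ ·) ((insert m t : Finset Q) : Set Q) ↔
      t ∈ (S.filter (· < m)).powerset ∧ IsChain (· ≤ ·) (t : Set Q)) := by
    intro t ht
    rw [Finset.mem_powerset] at ht
    constructor
    · intro h
      refine ⟨?_, h.mono (by simp)⟩
      rw [Finset.mem_powerset]
      intro x hx
      have hxS := ht hx
      rw [Finset.mem_erase] at hxS
      rw [Finset.mem_filter]
      refine ⟨hxS.2, lt_of_le_of_ne ?_ hxS.1⟩
      rcases h (x := x) (y := m) (by simp [hx]) (by simp) hxS.1 with h1 | h1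
      · exact h1
      · exact absurd (lt_of_le_of_ne h1 hxS.1.symm) (hmax x hxS.2)
    · rintro ⟨h1, h2⟩
      rw [Finset.mem_powerset] at h1
      rw [Finset.coe_insert]
      refine h2.insert fun b hb _ => Or.inr ?_
      exact (Finset.mem_filter.mp (h1 hb)).2.le
  have hsub : (S.filter (· < m)).powerset ⊆ (S.erase m).powerset := by
    apply Finset.powerset_mono.mpr
    intro x hx
    rw [Finset.mem_filter] at hx
    exact Finset.mem_erase.mpr ⟨hx.2.ne, hx.1⟩
  conv_lhs => rw [← Finset.insert_erase hm]
  unfold chainSum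
  rw [Finset.sum_powerset_insert (Finset.notMem_erase m S), sub_eq_add_neg]
  congr 1
  rw [← Finset.sum_neg_distrib, ← Finset.sum_subset hsub]
  · refine Finset.sum_congr rfl fun t ht => ?_
    have hm' : m ∉ t := fun h => Finset.notMem_erase m S (Finset.mem_powerset.mp (hsub ht) h)
    rw [Finset.card_insert_of_notMem hm']
    by_cases hc : IsChain (· ≤ ·) (t : Set Q)
    · rw [if_pos hc, if_pos ((hchain t (hsub ht)).mpr ⟨ht, hc⟩)]; ring
    · rw [if_neg hc, if_neg fun h => hc ((hchain t (hsub ht)).mp h).2]; ring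
  · intro t ht ht'
    rw [if_neg fun h => ht' ((hchain t ht).mp h).1]

open scoped Classical in
/-- `f` is the Möbius function `μ(a, ·)` of the finite poset `S` with least element `a`. -/
def IsMobius (S : Finset Q) (a : Q) (f : Q → ℤ) : Prop :=
  ∀ x ∈ S, ∑ y ∈ S with y ≤ x, f y = if x = a then 1 else 0

-- Philip Hall's theorem, summed over all of `S`. Deleting a maximal element `m` changes the left
-- side by the chain sum below `m`, which by induction is the sum of `f` over `y < m`, and this
-- equals `-f m` by the defining equation of the Möbius function.
open scoped Classical in
theorem IsMobius.chainSum_erase {S : Finset Q} {a : Q} {f : Q → ℤ}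
    (hf : IsMobius S a f) (ha : a ∈ S) (hle : ∀ x ∈ S, a ≤ x) :
    chainSum (S.erase a) = ∑ x ∈ S, f x := by
  induction hn : S.card using Nat.strong_induction_on generalizing S with
  | _ n ih =>
    subst hn
    have hsub : ∀ T ⊆ S, a ∈ T → (∀ x ∈ T, ∀ y ∈ S, y ≤ x → y ∈ T) → IsMobius T a f := by
      intro T hT _ hdown x hx
      rw [← hf x (hT hx)]
      refine Finset.sum_congr ?_ fun _ _ => rfl
      ext y
      simp only [Finset.mem_filter]
      exact ⟨fun h => ⟨hT h.1, h.2⟩, fun h => ⟨hdown x hx y h.1 h.2, h.2⟩⟩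
    by_cases hS : S = {a}
    · subst hS
      have h1 := hf a (Finset.mem_singleton_self a)
      rw [if_pos rfl, Finset.filter_singleton, if_pos le_rfl] at h1
      rw [h1, Finset.erase_singleton]
      simp [chainSum]
    · obtain ⟨b, hb, hba⟩ : ∃ b ∈ S, b ≠ a := by
        by_contra! h
        exact hS (Finset.eq_singleton_iff_unique_mem.mpr ⟨ha, h⟩)
      obtain ⟨m, hbm, hm⟩ := S.exists_le_maximal hb
      have hmS : m ∈ S := hm.1
      have hmax : ∀ x ∈ S, ¬ m < x := fun x hx hlt => hlt.not_ge (hm.2 hx hlt.le)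
      have hma : m ≠ a := by
        rintro rfl
        exact hba (le_antisymm hbm (hle b hb))
      have ham : a < m := lt_of_le_of_ne (hle m hmS) hma.symm
      have e1 : (S.erase a).erase m = (S.erase m).erase a := Finset.erase_right_comm
      have e2 : (S.erase a).filter (· < m) = (S.filter (· < m)).erase a := by
        ext x; simp [and_assoc]
      rw [chainSum_eq_erase_sub (Finset.mem_erase.mpr ⟨hma, hmS⟩)
        (fun x hx => hmax x (Finset.mem_of_mem_erase hx)), e1, e2,
        ih _ (Finset.card_erase_lt_of_mem hmS)
          (hsub _ (Finset.erase_subset _ _) (Finset.mem_erase.mpr ⟨hma.symm, ha⟩) ?_)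
          (Finset.mem_erase.mpr ⟨hma.symm, ha⟩) (fun x hx => hle x (Finset.mem_of_mem_erase hx)) rfl,
        ih _ (Finset.card_lt_card ?_)
          (hsub _ (Finset.filter_subset _ _) (Finset.mem_filter.mpr ⟨ha, ham⟩) ?_)
          (Finset.mem_filter.mpr ⟨ha, ham⟩) (fun x hx => hle x (Finset.mem_of_mem_filter x hx)) rfl]
      · have h1 := hf m hmS
        rw [if_neg hma] at h1
        have h2 : S.filter (· ≤ m) = insert m (S.filter (· < m)) := by
          ext x
          simp only [Finset.mem_filter, Finset.mem_insert, le_iff_lt_or_eq]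
          constructor
          · rintro ⟨h, h' | h'⟩
            · exact Or.inr ⟨h, h'⟩
            · exact Or.inl h'
          · rintro (rfl | h)
            · exact ⟨hmS, Or.inr rfl⟩
            · exact ⟨h.1, Or.inl h.2⟩
        rw [h2, Finset.sum_insert (by simp)] at h1
        rw [← Finset.add_sum_erase S f hmS]
        linarith
      · refine (Finset.filter_subset _ _).ssubset_of_ne fun h => ?_
        rw [← h] at hmS
        exact lt_irrefl m (Finset.mem_filter.mp hmS).2
      · intro x hx y hy hyx
        exact Finset.mem_filter.mpr ⟨hy, hyx.trans_lt (Finset.mem_filter.mp hx).2⟩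
      · intro x hx y hy hyx
        refine Finset.mem_erase.mpr ⟨?_, hy⟩
        rintro rfl
        rw [Finset.mem_erase] at hx
        exact hmax x hx.2 (lt_of_le_of_ne hyx hx.1.symm)

/-- The reduced Euler characteristic as a sum of values of the Möbius function. -/
theorem IsMobius.redEuler_eq {S : Finset Q} {a : Q} {f : Q → ℤ} (hf : IsMobius S a f) (ha : a ∈ S)
    (hle : ∀ x ∈ S, a ≤ x) {P : Set Q} (hP : ∀ x, x ∈ P ↔ x ∈ S ∧ x ≠ a) :
    redEuler P = -∑ x ∈ S, f x := by
  classical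
  rw [redEuler_eq_of_mem_iff (S.erase a), hf.chainSum_erase ha hle]
  intro x
  rw [hP, Finset.mem_erase, and_comm]

/-- The value at a maximal element enters only the equation at that element, so the function can be
built by adding maximal elements one at a time. -/
theorem exists_isMobius (S : Finset Q) (a : Q) : ∃ f : Q → ℤ, IsMobius S a f := by
  classical
  induction hn : S.card using Nat.strong_induction_on generalizing S with
  | _ n ih =>
    subst hn
    rcases S.eq_empty_or_nonempty with rfl | ⟨b, hb⟩
    · exact ⟨0, fun x hx => absurd hx (Finset.notMem_empty x)⟩
    obtain ⟨m, -, hm⟩ := S.exists_le_maximal hb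
    have hmS : m ∈ S := hm.1
    have hmax : ∀ x ∈ S, ¬ m < x := fun x hx hlt => hlt.not_ge (hm.2 hx hlt.le)
    obtain ⟨f, hf⟩ := ih _ (Finset.card_erase_lt_of_mem hmS) (S.erase m) rfl
    refine ⟨Function.update f m ((if m = a then 1 else 0) - ∑ y ∈ S with y < m, f y), ?_⟩
    intro x hx
    by_cases hxm : x = m
    · subst hxm
      have h2 : S.filter (· ≤ x) = insert x (S.filter (· < x)) := by
        ext y
        simp only [Finset.mem_filter, Finset.mem_insert, le_iff_lt_or_eq]
        constructor
        · rintro ⟨h, h' | h'⟩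
          · exact Or.inr ⟨h, h'⟩
          · exact Or.inl h'
        · rintro (rfl | h)
          · exact ⟨hmS, Or.inr rfl⟩
          · exact ⟨h.1, Or.inl h.2⟩
      have h3 : ∀ b, ∑ y ∈ S with y < x, Function.update f x b y = ∑ y ∈ S with y < x, f y :=
        fun b => Finset.sum_congr rfl fun y hy =>
          Function.update_of_ne (Finset.mem_filter.mp hy).2.ne _ _
      rw [h2, Finset.sum_insert (by simp), Function.update_self, h3]
      ring
    · rw [← hf x (Finset.mem_erase.mpr ⟨hxm, hx⟩)]
      have h3 : S.filter (· ≤ x) = (S.erase m).filter (· ≤ x) := by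
        ext y
        simp only [Finset.mem_filter, Finset.mem_erase]
        refine ⟨fun h => ⟨⟨?_, h.1⟩, h.2⟩, fun h => ⟨h.1.2, h.2⟩⟩
        rintro rfl
        exact hmax x hx (lt_of_le_of_ne h.2 (Ne.symm hxm))
      rw [h3]
      refine Finset.sum_congr rfl fun y hy => Function.update_of_ne ?_ _ _
      exact Finset.ne_of_mem_erase (Finset.mem_of_mem_filter y hy)

/-- Isomorphic posets have the same reduced Euler characteristic. -/
theorem redEuler_image {Q' : Type*} [PartialOrder Q'] {P : Set Q} (f : Q → Q')
    (hf : ∀ x ∈ P, ∀ y ∈ P, f x ≤ f y ↔ x ≤ y) : redEuler (f '' P) = redEuler P := by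
  classical
  have hinj : Set.InjOn f P := fun x hx y hy h =>
    le_antisymm ((hf x hx y hy).mp h.le) ((hf y hy x hx).mp h.ge)
  unfold redEuler
  symm
  refine finsum_mem_eq_of_bijOn (s := {s : Finset Q | (s : Set Q) ⊆ P ∧ IsChain (· ≤ ·) (s : Set Q)})
    (t := {s : Finset Q' | (s : Set Q') ⊆ f '' P ∧ IsChain (· ≤ ·) (s : Set Q')})
    (fun s => s.image f) ⟨?_, ?_, ?_⟩ ?_
  · rintro s ⟨h1, h2⟩
    simp only [Set.mem_ofPred_eq, Finset.coe_image]
    refine ⟨Set.image_mono h1, ?_⟩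
    rintro _ ⟨x, hx, rfl⟩ _ ⟨y, hy, rfl⟩ hne
    rcases h2 hx hy (fun h => hne (congrArg f h)) with h | h
    · exact Or.inl ((hf x (h1 hx) y (h1 hy)).mpr h)
    · exact Or.inr ((hf y (h1 hy) x (h1 hx)).mpr h)
  · rintro s ⟨h1, -⟩ t ⟨h2, -⟩ h
    have := congrArg (fun u : Finset Q' => (u : Set Q')) h
    simp only [Finset.coe_image] at this
    exact Finset.coe_injective ((hinj.image_eq_image_iff h1 h2).mp this)
  · rintro s ⟨h1, h2⟩
    obtain ⟨t, ht, rfl⟩ := Finset.subset_set_image_iff.mp h1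
    refine ⟨t, ⟨ht, ?_⟩, rfl⟩
    intro x hx y hy hne
    rw [Finset.coe_image] at h2
    rcases h2 (Set.mem_image_of_mem f hx) (Set.mem_image_of_mem f hy)
      (fun h => hne (hinj (ht hx) (ht hy) h)) with h | h
    · exact Or.inl ((hf x (ht hx) y (ht hy)).mp h)
    · exact Or.inr ((hf y (ht hy) x (ht hx)).mp h)
  · rintro s ⟨h1, -⟩
    rw [Finset.card_image_of_injOn (hinj.mono h1)]

/-- Vanishing of the reduced Euler characteristic of a conically contractible poset
`x ≥ f x ≤ g (f x) ≥ c`, where `f` is a coclosure operator with image `{x | D x}` and `g` sends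
an element of this image to its join with `c`. -/
theorem redEuler_eq_zero {S : Finset Q} {a c : Q} (ha : a ∈ S) (hle : ∀ x ∈ S, a ≤ x)
    (D : Q → Prop) (f g : Q → Q) (hc : c ∈ S) (hca : c ≠ a) (hDa : D a)
    (hfS : ∀ x ∈ S, f x ∈ S ∧ D (f x) ∧ f x ≤ x) (hf : ∀ x ∈ S, ∀ y ∈ S, D y → y ≤ x → y ≤ f x)
    (hfa : ∀ x ∈ S, f x = a → x = a)
    (hgS : ∀ x ∈ S, D x → g x ∈ S ∧ D (g x) ∧ x ≤ g x ∧ c ≤ g x)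
    (hg : ∀ x ∈ S, D x → ∀ y ∈ S, D y → x ≤ y → c ≤ y → g x ≤ y)
    {P : Set Q} (hP : ∀ x, x ∈ P ↔ x ∈ S ∧ x ≠ a) : redEuler P = 0 := by
  classical
  set T := S.filter D with hT
  obtain ⟨μ, hμ⟩ := exists_isMobius T a
  -- The elements of `T` below `x` are exactly those below `f x`, so the Möbius function of `T`,
  -- extended by zero, satisfies the Möbius equations on `S`.
  have hν : IsMobius S a (fun x => if D x then μ x else 0) := by
    intro x hx
    obtain ⟨h1, h2, h3⟩ := hfS x hx
    have h4 := hμ (f x) (Finset.mem_filter.mpr ⟨h1, h2⟩)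
    have h5 : (if x = a then (1 : ℤ) else 0) = if f x = a then 1 else 0 := by
      have : x = a ↔ f x = a := by
        refine ⟨?_, hfa x hx⟩
        rintro rfl
        exact le_antisymm h3 (hle _ h1)
      simp only [this]
    rw [h5, ← h4, ← Finset.sum_filter, Finset.filter_filter]
    refine Finset.sum_congr ?_ fun _ _ => rfl
    ext y
    simp only [hT, Finset.mem_filter]
    exact ⟨fun ⟨i, j, k⟩ => ⟨⟨i, k⟩, hf x hx y i k j⟩, fun ⟨⟨i, k⟩, j⟩ => ⟨i, j.trans h3, k⟩⟩
  rw [hν.redEuler_eq ha hle hP, ← Finset.sum_filter, ← hT, neg_eq_zero]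
  -- Weisner's theorem: the values of `μ` over the elements below `t` sum to zero and split into the
  -- fibres of `g` over the elements of `T` between `c` and `t`; by induction all fibres but the one
  -- over `t` vanish.
  have hfib : ∀ t ∈ T, c ≤ t → ∑ x ∈ T with g x = t, μ x = 0 := by
    intro t ht hct
    induction hn : (T.filter (· < t)).card using Nat.strong_induction_on generalizing t with
    | _ n ih =>
      subst hn
      have h1 := hμ t ht
      have hta : t ≠ a := by
        rintro rfl
        exact hca (le_antisymm hct (hle c hc))
      rw [if_neg hta] at h1
      have h2 : ∀ x ∈ T.filter (· ≤ t), g x ∈ T.filter (fun y => y ≤ t ∧ c ≤ y) := by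
        intro x hx
        simp only [hT, Finset.mem_filter] at hx ht ⊢
        obtain ⟨i, j, k, l⟩ := hgS x hx.1.1 hx.1.2
        exact ⟨⟨i, j⟩, hg x hx.1.1 hx.1.2 t ht.1 ht.2 hx.2 hct, l⟩
      rw [← Finset.sum_fiberwise_of_maps_to h2] at h1
      rw [Finset.sum_eq_single_of_mem t (Finset.mem_filter.mpr ⟨ht, le_rfl, hct⟩)] at h1
      · rw [← h1]
        refine Finset.sum_congr ?_ fun _ _ => rfl
        ext x
        simp only [hT, Finset.mem_filter]
        refine ⟨fun ⟨⟨i, j⟩, k⟩ => ⟨⟨⟨i, j⟩, (k ▸ (hgS x i j).2.2.1 : x ≤ t)⟩, k⟩, fun ⟨i, k⟩ => ⟨i.1, k⟩⟩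
      · intro y hy hyt
        rw [Finset.mem_filter] at hy
        have hlt : y < t := lt_of_le_of_ne hy.2.1 hyt
        have h3 := ih _ (Finset.card_lt_card (?_ : T.filter (· < y) ⊂ T.filter (· < t))) y hy.1
          hy.2.2 rfl
        · rw [← h3]
          refine Finset.sum_congr ?_ fun _ _ => rfl
          ext x
          simp only [hT, Finset.mem_filter]
          refine ⟨fun ⟨i, k⟩ => ⟨i.1, k⟩,
            fun ⟨⟨i, j⟩, k⟩ => ⟨⟨⟨i, j⟩, (k ▸ (hgS x i j).2.2.1 : x ≤ y).trans hlt.le⟩, k⟩⟩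
        · refine Finset.ssubset_iff_subset_ne.mpr ⟨fun x hx => ?_, fun h => ?_⟩
          · rw [Finset.mem_filter] at hx ⊢
            exact ⟨hx.1, hx.2.trans hlt⟩
          · have : y ∈ T.filter (· < t) := Finset.mem_filter.mpr ⟨hy.1, hlt⟩
            rw [← h] at this
            exact lt_irrefl y (Finset.mem_filter.mp this).2
  have h2 : ∀ x ∈ T, g x ∈ T.filter (fun y => c ≤ y) := by
    intro x hx
    simp only [hT, Finset.mem_filter] at hx ⊢
    obtain ⟨i, j, k, l⟩ := hgS x hx.1 hx.2
    exact ⟨⟨i, j⟩, l⟩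
  rw [← Finset.sum_fiberwise_of_maps_to h2]
  refine Finset.sum_eq_zero fun t ht => ?_
  rw [Finset.mem_filter] at ht
  exact hfib t ht.1 ht.2

/-- The poset of intervals of a finite bounded poset, ordered by reverse inclusion. -/
theorem neg_redEuler_intervals {S : Finset Q} {a b : Q} (ha : a ∈ S) (hb : b ∈ S)
    (hale : ∀ x ∈ S, a ≤ x) (hble : ∀ x ∈ S, x ≤ b) (hab : a ≠ b) :
    -redEuler {z : Q × Qᵒᵈ | z.1 ∈ S ∧ OrderDual.ofDual z.2 ∈ S ∧ z.1 ≤ OrderDual.ofDual z.2 ∧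
      z ≠ (a, OrderDual.toDual b)} = redEuler {x | x ∈ S ∧ x ≠ a ∧ x ≠ b} := by
  classical
  obtain ⟨μ, hμ⟩ := exists_isMobius S a
  let S' : Finset Qᵒᵈ := S.map OrderDual.toDual.toEmbedding
  obtain ⟨ν, hν⟩ := exists_isMobius S' (OrderDual.toDual b)
  have hν' : ∀ x ∈ S, ∑ y ∈ S with x ≤ y, ν (OrderDual.toDual y) = if x = b then 1 else 0 := by
    intro x hx
    have := hν (OrderDual.toDual x) (by simpa [S'] using hx)
    rw [Finset.filter_map, Finset.sum_map] at this
    simpa using this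
  let I : Finset (Q × Qᵒᵈ) := (S ×ˢ S').filter fun z => z.1 ≤ OrderDual.ofDual z.2
  -- If `u ≤ x ≤ y ≤ v`, then `u ≤ v` is automatic. The elements below an interval therefore form a
  -- full product, and the Möbius function factors.
  have hI : IsMobius I (a, OrderDual.toDual b) (fun z => μ z.1 * ν z.2) := by
    rintro ⟨x, y⟩ hz
    simp only [I, S', Finset.mem_filter, Finset.mem_product, Finset.mem_map,
      Equiv.coe_toEmbedding] at hz
    obtain ⟨⟨hx, y, hy, rfl⟩, hxy⟩ := hz
    refine (Finset.sum_congr (s₂ := (S.filter (· ≤ x)) ×ˢ (S'.filter (· ≤ OrderDual.toDual y))) ?_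
      fun _ _ => rfl).trans ?_
    · ext ⟨u, v⟩
      simp only [I, S', Finset.mem_filter, Finset.mem_product, Prod.mk_le_mk]
      refine ⟨fun ⟨⟨⟨i, j⟩, k⟩, l, m⟩ => ⟨⟨i, l⟩, j, m⟩, fun ⟨⟨i, l⟩, j, m⟩ => ⟨⟨⟨i, j⟩, ?_⟩, l, m⟩⟩
      exact l.trans (hxy.trans m)
    rw [Finset.sum_product, ← Finset.sum_mul_sum, hμ x hx,
      hν (OrderDual.toDual y) (Finset.mem_map_of_mem _ hy)]
    simp only [Prod.mk.injEq]
    split_ifs <;> simp_all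
  rw [hI.redEuler_eq, neg_neg]
  rotate_left
  · simp only [I, S', Finset.mem_filter, Finset.mem_product, Finset.mem_map, Equiv.coe_toEmbedding]
    exact ⟨⟨ha, b, hb, rfl⟩, hale b hb⟩
  · rintro ⟨x, y⟩ hz
    simp only [I, S', Finset.mem_filter, Finset.mem_product, Finset.mem_map,
      Equiv.coe_toEmbedding] at hz
    obtain ⟨⟨hx, y, hy, rfl⟩, hxy⟩ := hz
    exact ⟨hale x hx, hble y hy⟩
  · rintro ⟨x, y⟩
    simp only [I, S', Finset.mem_filter, Finset.mem_product, Finset.mem_map,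
      Equiv.coe_toEmbedding, Set.mem_ofPred_eq]
    constructor
    · rintro ⟨h1, h2, h3, h4⟩
      exact ⟨⟨⟨h1, _, h2, rfl⟩, h3⟩, h4⟩
    · rintro ⟨⟨⟨h1, y, h2, rfl⟩, h3⟩, h4⟩
      exact ⟨h1, h2, h3, h4⟩
  -- Summing first over the lower ends `x ≤ y` leaves only `y = a`.
  have h2 : ∑ z ∈ I, μ z.1 * ν z.2 = ν (OrderDual.toDual a) := by
    have h : ∑ z ∈ I, μ z.1 * ν z.2 =
        ∑ y ∈ S, (∑ x ∈ S with x ≤ y, μ x) * ν (OrderDual.toDual y) := by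
      rw [Finset.sum_filter, Finset.sum_product_right, Finset.sum_map]
      refine Finset.sum_congr rfl fun y _ => ?_
      rw [Finset.sum_mul, Finset.sum_filter]
      exact Finset.sum_congr rfl fun x _ => rfl
    rw [h, Finset.sum_eq_single_of_mem a ha, hμ a ha, if_pos rfl, one_mul]
    intro y hy hya
    rw [hμ y hy, if_neg hya, zero_mul]
  rw [h2]
  -- In the opposite order `a` is the greatest element, so deleting it affects no other Möbius
  -- equation. As `ν` sums to zero over `S'`, its sum over the rest is `-ν a`.
  have hT : IsMobius (S'.erase (OrderDual.toDual a)) (OrderDual.toDual b) ν := by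
    intro x hx
    rw [Finset.mem_erase] at hx
    rw [← hν x hx.2]
    refine Finset.sum_congr ?_ fun _ _ => rfl
    ext y
    simp only [Finset.mem_filter, Finset.mem_erase]
    refine ⟨fun h => ⟨h.1.2, h.2⟩, fun h => ⟨⟨?_, h.1⟩, h.2⟩⟩
    rintro rfl
    refine hx.1 (le_antisymm ?_ h.2)
    obtain ⟨z, hz, rfl⟩ := Finset.mem_map.mp hx.2
    exact hale z hz
  have hdual : redEuler {x | x ∈ S ∧ x ≠ a ∧ x ≠ b} =
      redEuler (OrderDual.toDual '' {x | x ∈ S ∧ x ≠ a ∧ x ≠ b}) := by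
    unfold redEuler
    refine finsum_mem_eq_of_bijOn
      (s := {s : Finset Q | (s : Set Q) ⊆ _ ∧ IsChain (· ≤ ·) (s : Set Q)})
      (t := {s : Finset Qᵒᵈ | (s : Set Qᵒᵈ) ⊆ _ ∧ IsChain (· ≤ ·) (s : Set Qᵒᵈ)})
      id ⟨?_, Set.injOn_id _, ?_⟩ ?_
    · rintro s ⟨h1, h2⟩
      exact ⟨fun x hx => ⟨x, h1 hx, rfl⟩, fun x hx y hy hne => (h2 hx hy hne).symm⟩
    · rintro s ⟨h1, h2⟩
      refine ⟨s, ⟨fun x hx => ?_, fun x hx y hy hne => (h2 hx hy hne).symm⟩, rfl⟩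
      obtain ⟨y, hy, rfl⟩ := h1 hx
      exact hy
    · intro s _
      rfl
  rw [hdual, hT.redEuler_eq]
  · have h3 := hν' a ha
    rw [if_neg hab, Finset.filter_true_of_mem hale] at h3
    have h4 : ∑ x ∈ S', ν x = 0 := by rw [Finset.sum_map]; exact h3
    have h5 := Finset.add_sum_erase S' ν (a := OrderDual.toDual a) (Finset.mem_map_of_mem _ ha)
    linarith
  · refine Finset.mem_erase.mpr ⟨?_, Finset.mem_map_of_mem _ hb⟩
    exact fun h => hab (OrderDual.toDual_inj.mp h).symm
  · intro x hx
    obtain ⟨z, hz, rfl⟩ := Finset.mem_map.mp (Finset.mem_of_mem_erase hx)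
    exact hble z hz
  · intro x
    simp only [S', Set.mem_image, Set.mem_ofPred_eq, Finset.mem_erase, Finset.mem_map,
      Equiv.coe_toEmbedding]
    constructor
    · rintro ⟨x, ⟨h1, h2, h3⟩, rfl⟩
      exact ⟨⟨fun h => h2 (OrderDual.toDual_inj.mp h), x, h1, rfl⟩,
        fun h => h3 (OrderDual.toDual_inj.mp h)⟩
    · rintro ⟨⟨h1, x, h2, rfl⟩, h3⟩
      exact ⟨x, ⟨h2, fun h => h1 (congrArg _ h), fun h => h3 (congrArg _ h)⟩, rfl⟩

end Poset

/-! ### Products of posets with a least element, and their equivariant Euler characteristics. -/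

/-- Multiplicativity of the reduced Euler characteristic for joins, in terms of products of posets
with a least element. -/
theorem neg_redEuler_pi {ι : Type*} [Fintype ι] {L : ι → Type*} [∀ i, PartialOrder (L i)]
    [∀ i, OrderBot (L i)] [∀ i, Finite (L i)] (P : ∀ i, Set (L i)) (hP : ∀ i, ⊥ ∈ P i) :
    -redEuler {x : ∀ i, L i | x ≠ ⊥ ∧ ∀ i, x i ∈ P i} =
      ∏ i, -redEuler {x : L i | x ≠ ⊥ ∧ x ∈ P i} := by
  classical
  let S : ∀ i, Finset (L i) := fun i => (P i).toFinite.toFinset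
  have hS : ∀ i x, x ∈ S i ↔ x ∈ P i := fun i x => by simp [S]
  choose f hf using fun i => exists_isMobius (S i) (⊥ : L i)
  have h : IsMobius (Fintype.piFinset S) ⊥ (fun x => ∏ i, f i (x i)) := by
    intro x hx
    rw [Fintype.mem_piFinset] at hx
    -- Down-sets in a product are products of down-sets, so the product of the Möbius functions is
    -- the Möbius function of the product.
    have h1 : (Fintype.piFinset S).filter (· ≤ x) =
        Fintype.piFinset fun i => (S i).filter (· ≤ x i) := by
      ext y
      simp only [Finset.mem_filter, Fintype.mem_piFinset, Pi.le_def]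
      exact forall_and.symm
    rw [h1, ← Finset.prod_univ_sum, Finset.prod_congr rfl fun i _ => hf i (x i) (hx i)]
    by_cases hx0 : x = ⊥
    · subst hx0; simp
    · rw [if_neg hx0]
      obtain ⟨i, hi⟩ : ∃ i, x i ≠ ⊥ := by
        by_contra! hc
        exact hx0 (funext hc)
      exact Finset.prod_eq_zero (Finset.mem_univ i) (if_neg hi)
  rw [h.redEuler_eq, neg_neg, ← Finset.prod_univ_sum]
  · refine Finset.prod_congr rfl fun i _ => ?_
    rw [(hf i).redEuler_eq, neg_neg]
    · exact (hS _ _).mpr (hP i)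
    · exact fun _ _ => bot_le
    · intro x
      rw [hS, Set.mem_ofPred_eq, and_comm]
  · exact Fintype.mem_piFinset.mpr fun i => (hS _ _).mpr (hP i)
  · exact fun _ _ => bot_le
  · intro x
    simp only [Fintype.mem_piFinset, hS, Set.mem_ofPred_eq, and_comm]

/-- The equivariant reduced Euler characteristic, with the sign changed, of the poset of the
elements `≠ ⊥` of `L`; the action of `G` on `L` enters only through the relation
`fix g x` that `x` is fixed by `g`. -/
def botEuler (r : ℕ) (G : Type*) [Group G] (L : Type*) [PartialOrder L] [OrderBot L]
    (fix : G → L → Prop) : ℚ :=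
  (1 / (Nat.card G : ℚ)) * ∑ᶠ X : Multiplicative (Fin r → ℤ) →* G,
    ((-redEuler {x : L | x ≠ ⊥ ∧ ∀ z, fix (X z) x} : ℤ) : ℚ)

theorem botEuler_congr {G G' L L' : Type*} [Group G] [Group G'] [PartialOrder L] [OrderBot L]
    [PartialOrder L'] [OrderBot L'] (r : ℕ) {fix : G → L → Prop} {fix' : G' → L' → Prop}
    (e : G ≃* G') (f : L ≃o L') (h : ∀ g x, fix g x ↔ fix' (e g) (f x)) :
    botEuler r G L fix = botEuler r G' L' fix' := by
  unfold botEuler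
  rw [Nat.card_congr e.toEquiv]
  congr 1
  refine finsum_eq_of_bijective (fun X => e.toMonoidHom.comp X) ⟨?_, ?_⟩ ?_
  · intro X Y hXY
    ext z
    exact e.injective (DFunLike.congr_fun hXY z)
  · intro Y
    refine ⟨e.symm.toMonoidHom.comp Y, ?_⟩
    ext z
    simp
  · intro X
    rw [← redEuler_image f fun x _ y _ => f.le_iff_le]
    congr 3
    ext y
    simp only [Set.mem_image, Set.mem_ofPred_eq]
    constructor
    · rintro ⟨x, ⟨h1, h2⟩, rfl⟩
      exact ⟨fun h3 => h1 (f.injective (by rw [h3, map_bot])), fun z => (h _ _).mp (h2 z)⟩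
    · rintro ⟨h1, h2⟩
      obtain ⟨x, rfl⟩ := f.surjective y
      exact ⟨x, ⟨fun h3 => h1 (by rw [h3, map_bot]), fun z => (h _ _).mpr (h2 z)⟩, rfl⟩

/-- A homomorphism into a product group is a family of homomorphisms, and its fixed-point poset is
the product of theirs. Hence `neg_redEuler_pi` applies to each summand. -/
theorem botEuler_pi {ι : Type*} [Fintype ι] {G L : ι → Type*} [∀ i, Group (G i)]
    [∀ i, Finite (G i)] [∀ i, PartialOrder (L i)] [∀ i, OrderBot (L i)] [∀ i, Finite (L i)]
    (r : ℕ) (fix : ∀ i, G i → L i → Prop) (hfix : ∀ i g, fix i g ⊥) :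
    botEuler r (∀ i, G i) (∀ i, L i) (fun g x => ∀ i, fix i (g i) (x i)) =
      ∏ i, botEuler r (G i) (L i) (fix i) := by
  classical
  unfold botEuler
  rw [Nat.card_pi, Finset.prod_mul_distrib, Finset.prod_div_distrib, Finset.prod_const_one,
    Nat.cast_prod]
  congr 1
  have hF := fun i => Fintype.ofFinite (Multiplicative (Fin r → ℤ) →* G i)
  simp only [finsum_eq_sum_of_fintype]
  rw [Finset.prod_univ_sum, ← Finset.sum_coe_sort, ← finsum_eq_sum_of_fintype]
  refine finsum_eq_of_bijective
    (fun X => ⟨fun i => (Pi.evalMonoidHom G i).comp X, by simp⟩) ⟨?_, ?_⟩ ?_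
  · intro X Y hXY
    ext z i
    exact DFunLike.congr_fun (congrFun (congrArg Subtype.val hXY) i) z
  · rintro ⟨Y, hY⟩
    exact ⟨MonoidHom.mk' (fun z i => Y i z) (fun a b => by ext i; simp), rfl⟩
  · intro X
    simp only [← Int.cast_prod]
    congr 1
    have := neg_redEuler_pi (L := L) (fun i => {x | ∀ z, fix i (X z i) x}) (fun i z => hfix i _)
    refine Eq.trans ?_ this
    congr 2
    ext x
    simp only [Set.mem_ofPred_eq]
    rw [forall_comm]

/-! ### Equivariant Euler characteristics: invariance and the recursion in `r`. -/

section EqEuler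

variable {Γ Q : Type*} [Group Γ] [PartialOrder Q] [MulAction Γ Q]

/-- Adjoining a least element turns joins of posets into products; this passes from `eqEuler` to the
form to which `botEuler_pi` applies. -/
theorem neg_eqEuler_eq_botEuler (r : ℕ) (H : Subgroup Γ) (P P' : Set Q) [OrderBot P']
    (hP : ∀ x, x ∈ P ↔ ∃ hx : x ∈ P', (⟨x, hx⟩ : P') ≠ ⊥) :
    -eqEuler r H P = botEuler r H P' (fun h x => (h : Γ) • (x : Q) = x) := by
  unfold eqEuler botEuler
  rw [← mul_neg, ← finsum_neg_distrib]
  congr 1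
  refine finsum_congr fun X => ?_
  rw [Int.cast_neg, ← redEuler_image (Subtype.val : P' → Q) fun x _ y _ => Iff.rfl]
  congr 3
  ext x
  simp only [Set.mem_image, Set.mem_ofPred_eq]
  constructor
  · rintro ⟨h1, h2⟩
    obtain ⟨hx, hne⟩ := (hP x).mp h1
    exact ⟨⟨x, hx⟩, ⟨hne, fun z => h2 _ ⟨z, rfl⟩⟩, rfl⟩
  · rintro ⟨x, ⟨h1, h2⟩, rfl⟩
    refine ⟨(hP _).mpr ⟨x.2, h1⟩, ?_⟩
    rintro _ ⟨z, rfl⟩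
    exact h2 z

theorem eqEuler_congr {Γ' Q' : Type*} [Group Γ'] [PartialOrder Q'] [MulAction Γ' Q'] (r : ℕ)
    {H : Subgroup Γ} {P : Set Q} {H' : Subgroup Γ'} {P' : Set Q'} (e : H ≃* H') (f : Q → Q')
    (hf : ∀ x ∈ P, ∀ y ∈ P, f x ≤ f y ↔ x ≤ y) (hP : f '' P = P')
    (h : ∀ (g : H), ∀ x ∈ P, (g : Γ) • x = x ↔ (e g : Γ') • f x = f x) :
    eqEuler r H P = eqEuler r H' P' := by
  unfold eqEuler
  rw [Nat.card_congr e.toEquiv]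
  congr 1
  refine finsum_eq_of_bijective (fun X => e.toMonoidHom.comp X) ⟨?_, ?_⟩ ?_
  · intro X Y hXY
    ext z
    exact congrArg Subtype.val (e.injective (DFunLike.congr_fun hXY z))
  · intro Y
    refine ⟨e.symm.toMonoidHom.comp Y, ?_⟩
    ext z
    simp
  · intro X
    rw [← redEuler_image f fun x hx y hy => hf x hx.1 y hy.1]
    congr 2
    ext y
    simp only [Set.mem_image, Set.mem_ofPred_eq, ← hP]
    constructor
    · rintro ⟨x, ⟨h1, h2⟩, rfl⟩
      refine ⟨⟨x, h1, rfl⟩, ?_⟩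
      rintro _ ⟨z, rfl⟩
      exact (h _ x h1).mp (h2 _ ⟨z, rfl⟩)
    · rintro ⟨⟨x, h1, rfl⟩, h2⟩
      refine ⟨x, ⟨h1, ?_⟩, rfl⟩
      rintro _ ⟨z, rfl⟩
      exact (h _ x h1).mpr (h2 _ ⟨z, rfl⟩)

/-- The homomorphism `ℤ ^ (r + 1) → H` given by the image `g` of the first basis vector and a
homomorphism from `ℤ ^ r` to the centralizer of `g`. -/
def consHom {r : ℕ} {H : Subgroup Γ} (g : H)
    (Y : Multiplicative (Fin r → ℤ) →* ↥(H ⊓ Subgroup.centralizer {(g : Γ)})) :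
    Multiplicative (Fin (r + 1) → ℤ) →* H :=
  MonoidHom.mk' (fun z => g ^ (z.toAdd 0) *
      Subgroup.inclusion inf_le_left (Y (Multiplicative.ofAdd (Fin.tail z.toAdd)))) (by
    intro a b
    have hc : Commute (g : H) (Subgroup.inclusion inf_le_left
        (Y (Multiplicative.ofAdd (Fin.tail a.toAdd)))) := by
      have := (Subgroup.mem_inf.mp (Y (Multiplicative.ofAdd (Fin.tail a.toAdd))).2).2
      rw [Subgroup.mem_centralizer_singleton_iff] at this
      exact Subtype.ext this.symm
    have h1 : Multiplicative.ofAdd (Fin.tail (a * b).toAdd) =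
      Multiplicative.ofAdd (Fin.tail a.toAdd) * Multiplicative.ofAdd (Fin.tail b.toAdd) := rfl
    have h2 : (a * b).toAdd 0 = a.toAdd 0 + b.toAdd 0 := rfl
    rw [h1, h2, map_mul, map_mul, zpow_add, mul_assoc, mul_assoc, ← mul_assoc (g ^ _) _ (Subgroup.inclusion _ _),
      (hc.zpow_left _).eq, mul_assoc])

theorem consHom_apply {r : ℕ} {H : Subgroup Γ} (g : H)
    (Y : Multiplicative (Fin r → ℤ) →* ↥(H ⊓ Subgroup.centralizer {(g : Γ)}))
    (m : ℤ) (v : Fin r → ℤ) :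
    (consHom g Y (Multiplicative.ofAdd (Fin.cons m v)) : Γ) =
      (g : Γ) ^ m * (Y (Multiplicative.ofAdd v) : Γ) := by
  simp [consHom]

/-- `ℤ ^ (r + 1)` is `ℤ × ℤ ^ r` and is commutative, so the image of the second factor has to
centralize the image `g` of the first basis vector, and no other condition arises. -/
theorem consHom_bijective (r : ℕ) (H : Subgroup Γ) :
    Function.Bijective (fun z : Σ g : H,
      Multiplicative (Fin r → ℤ) →* ↥(H ⊓ Subgroup.centralizer {(g : Γ)}) => consHom z.1 z.2) := by
  constructor
  · rintro ⟨g, Y⟩ ⟨g', Y'⟩ h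
    have h1 : ∀ (m : ℤ) (v : Fin r → ℤ), (g : Γ) ^ m * (Y (Multiplicative.ofAdd v) : Γ) =
        (g' : Γ) ^ m * (Y' (Multiplicative.ofAdd v) : Γ) := by
      intro m v
      rw [← consHom_apply, ← consHom_apply]
      exact congrArg Subtype.val (DFunLike.congr_fun h _)
    obtain rfl : g = g' := by
      have := h1 1 0
      simp only [zpow_one, ofAdd_zero, map_one, OneMemClass.coe_one, mul_one] at this
      exact Subtype.ext this
    congr 1
    refine MonoidHom.ext fun v => Subtype.ext ?_
    simpa using h1 0 v.toAdd
  · intro X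
    let g : H := X (Multiplicative.ofAdd (Fin.cons 1 0))
    let Y : Multiplicative (Fin r → ℤ) →* ↥(H ⊓ Subgroup.centralizer {(g : Γ)}) :=
      MonoidHom.mk' (fun v => ⟨X (Multiplicative.ofAdd (Fin.cons 0 v.toAdd)), by
          refine Subgroup.mem_inf.mpr ⟨(X _).2, ?_⟩
          rw [Subgroup.mem_centralizer_singleton_iff]
          simp only [g]
          rw [← Subgroup.coe_mul, ← Subgroup.coe_mul, ← map_mul X, ← map_mul X, mul_comm]⟩) (by
        intro a b
        refine Subtype.ext ?_
        simp only [Subgroup.coe_mul]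
        rw [← Subgroup.coe_mul, ← map_mul, ← ofAdd_add]
        congr 3
        ext i
        refine Fin.cases ?_ (fun i => ?_) i <;> simp)
    refine ⟨⟨g, Y⟩, MonoidHom.ext fun z => Subtype.ext ?_⟩
    obtain ⟨m, v, hz⟩ : ∃ m v, z = Multiplicative.ofAdd (Fin.cons m v) :=
      ⟨z.toAdd 0, Fin.tail z.toAdd, by rw [Fin.cons_self_tail]; rfl⟩
    subst hz
    simp only
    rw [consHom_apply]
    simp only [g, Y, MonoidHom.mk'_apply, toAdd_ofAdd]
    rw [← Subgroup.coe_zpow, ← Subgroup.coe_mul, ← map_zpow, ← map_mul, ← ofAdd_zsmul, ← ofAdd_add]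
    congr 3
    ext i
    refine Fin.cases ?_ (fun i => ?_) i <;> simp

/-- Fixed points of `consHom g Y` are the fixed points of `Y` in the poset fixed by `g`. The order
of the centralizer cancels the normalization inside `eqEuler r`. -/
theorem eqEuler_succ (r : ℕ) (H : Subgroup Γ) [Finite H] (P : Set Q) :
    eqEuler (r + 1) H P = (1 / (Nat.card H : ℚ)) * ∑ᶠ g : H,
      (Nat.card ↥(H ⊓ Subgroup.centralizer {(g : Γ)}) : ℚ) *
        eqEuler r (H ⊓ Subgroup.centralizer {(g : Γ)}) {x | x ∈ P ∧ (g : Γ) • x = x} := by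
  classical
  have hfin : ∀ g : H, Finite ↥(H ⊓ Subgroup.centralizer {(g : Γ)}) := fun g =>
    Finite.of_injective _ (Subgroup.inclusion_injective (inf_le_left : _ ≤ H))
  have := Fintype.ofFinite H
  have := fun g : H => Fintype.ofFinite
    (Multiplicative (Fin r → ℤ) →* ↥(H ⊓ Subgroup.centralizer {(g : Γ)}))
  conv_lhs => unfold eqEuler
  congr 1
  rw [← finsum_eq_of_bijective (e := fun z : Σ g : H,
      Multiplicative (Fin r → ℤ) →* ↥(H ⊓ Subgroup.centralizer {(g : Γ)}) => consHom z.1 z.2)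
      (consHom_bijective r H) (fun _ => rfl), finsum_eq_sum_of_fintype, finsum_eq_sum_of_fintype,
      Fintype.sum_sigma]
  refine Finset.sum_congr rfl fun g _ => ?_
  unfold eqEuler
  have hc : (Nat.card ↥(H ⊓ Subgroup.centralizer {(g : Γ)}) : ℚ) ≠ 0 :=
    Nat.cast_ne_zero.mpr Nat.card_pos.ne'
  rw [← mul_assoc, mul_one_div_cancel hc, one_mul, finsum_eq_sum_of_fintype]
  refine Finset.sum_congr rfl fun Y _ => ?_
  congr 2
  ext x
  simp only [Set.mem_ofPred_eq]
  constructor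
  · rintro ⟨h1, h2⟩
    refine ⟨⟨h1, ?_⟩, ?_⟩
    · have := h2 _ ⟨Multiplicative.ofAdd (Fin.cons 1 0), rfl⟩
      rw [consHom_apply] at this
      simpa using this
    · rintro _ ⟨v, rfl⟩
      have := h2 _ ⟨Multiplicative.ofAdd (Fin.cons 0 v.toAdd), rfl⟩
      rw [consHom_apply] at this
      simpa using this
  · rintro ⟨⟨h1, h2⟩, h3⟩
    refine ⟨h1, ?_⟩
    rintro _ ⟨z, rfl⟩
    obtain ⟨m, v, hz⟩ : ∃ m v, z = Multiplicative.ofAdd (Fin.cons m v) :=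
      ⟨z.toAdd 0, Fin.tail z.toAdd, by rw [Fin.cons_self_tail]; rfl⟩
    subst hz
    rw [consHom_apply, mul_smul, h3 _ ⟨_, rfl⟩]
    have : (g : Γ) ∈ MulAction.stabilizer Γ x := h2
    exact Subgroup.zpow_mem _ this m

theorem eqEuler_conj (r : ℕ) (K : Subgroup Γ) (P : Set Q) (h : Γ)
    (hmono : ∀ x y : Q, h • x ≤ h • y ↔ x ≤ y) :
    eqEuler r (K.map (MulAut.conj h).toMonoidHom) (h • P) = eqEuler r K P := by
  symm
  refine eqEuler_congr r (K.equivMapOfInjective _ (MulAut.conj h).injective) (h • ·)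
    (fun x _ y _ => hmono x y) rfl ?_
  intro g x _
  have h1 : (K.equivMapOfInjective (MulAut.conj h).toMonoidHom (MulAut.conj h).injective g : Γ) =
    h * g * h⁻¹ := rfl
  rw [h1, smul_smul, inv_mul_cancel_right, mul_smul, smul_left_cancel_iff]

theorem inf_centralizer_conj (H : Subgroup Γ) (g h : Γ) (hh : h ∈ H) :
    (H ⊓ Subgroup.centralizer {g}).map (MulAut.conj h).toMonoidHom =
      H ⊓ Subgroup.centralizer {h * g * h⁻¹} := by
  ext x
  simp only [Subgroup.mem_map, Subgroup.mem_inf, Subgroup.mem_centralizer_singleton_iff,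
    MulEquiv.coe_toMonoidHom, MulAut.conj_apply]
  constructor
  · rintro ⟨y, ⟨h1, h2⟩, rfl⟩
    refine ⟨H.mul_mem (H.mul_mem hh h1) (H.inv_mem hh), ?_⟩
    calc h * y * h⁻¹ * (h * g * h⁻¹) = h * (y * g) * h⁻¹ := by group
      _ = h * g * h⁻¹ * (h * y * h⁻¹) := by rw [h2]; group
  · rintro ⟨h1, h2⟩
    refine ⟨h⁻¹ * x * h, ⟨H.mul_mem (H.mul_mem (H.inv_mem hh) h1) hh, ?_⟩, by group⟩
    calc h⁻¹ * x * h * g = h⁻¹ * (x * (h * g * h⁻¹)) * h := by group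
      _ = g * (h⁻¹ * x * h) := by rw [h2]; group

/-- The recursion for equivariant reduced Euler characteristics as a sum over conjugacy classes. -/
theorem eqEuler_succ_eq_finsum_conjClasses (r : ℕ) (H : Subgroup Γ) [Finite H] (P : Set Q)
    (hP : ∀ h ∈ H, ∀ x ∈ P, h • x ∈ P) (hmono : ∀ h ∈ H, ∀ x y : Q, h • x ≤ h • y ↔ x ≤ y)
    (rep : ConjClasses H → H) (hrep : ∀ c, ConjClasses.mk (rep c) = c) :
    eqEuler (r + 1) H P = ∑ᶠ c : ConjClasses H,
      eqEuler r (H ⊓ Subgroup.centralizer {(rep c : Γ)}) {x | x ∈ P ∧ (rep c : Γ) • x = x} := by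
  classical
  have := Fintype.ofFinite H
  have := Fintype.ofFinite (ConjClasses H)
  set F : H → ℚ := fun g =>
    eqEuler r (H ⊓ Subgroup.centralizer {(g : Γ)}) {x | x ∈ P ∧ (g : Γ) • x = x} with hF
  set N : H → ℕ := fun g => Nat.card ↥(H ⊓ Subgroup.centralizer {(g : Γ)}) with hN
  have hconj : ∀ g h : H, F (h * g * h⁻¹) = F g ∧ N (h * g * h⁻¹) = N g := by
    intro g h
    have h1 := inf_centralizer_conj H (g : Γ) h h.2
    constructor
    · simp only [hF]
      rw [← eqEuler_conj r _ {x | x ∈ P ∧ (g : Γ) • x = x} (h : Γ) (hmono h h.2), h1]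
      congr 1
      ext x
      rw [Set.mem_smul_set_iff_inv_smul_mem]
      simp only [Set.mem_ofPred_eq, Subgroup.coe_mul, InvMemClass.coe_inv, mul_smul]
      constructor
      · rintro ⟨i, j⟩
        refine ⟨hP _ (H.inv_mem h.2) _ i, ?_⟩
        rw [← smul_left_cancel_iff (h : Γ), j, smul_inv_smul]
      · rintro ⟨i, j⟩
        refine ⟨?_, ?_⟩
        · have := hP _ h.2 _ i
          rwa [smul_inv_smul] at this
        · rw [j, smul_inv_smul]
    · simp only [hN, Subgroup.coe_mul, InvMemClass.coe_inv]
      rw [← h1]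
      exact (Nat.card_congr ((H ⊓ Subgroup.centralizer {(g : Γ)}).equivMapOfInjective _
        (MulAut.conj (h : Γ)).injective).toEquiv).symm
  have hmk : ∀ g c, ConjClasses.mk g = c → F g = F (rep c) ∧ N g = N (rep c) := by
    rintro g c rfl
    obtain ⟨h, hh⟩ := isConj_iff.mp (ConjClasses.mk_eq_mk_iff_isConj.mp (hrep (ConjClasses.mk g)))
    obtain ⟨h1, h2⟩ := hconj (rep (ConjClasses.mk g)) h
    rw [hh] at h1 h2
    exact ⟨h1, h2⟩
  -- Orbit-stabilizer for the conjugation action: the class size times the order of the centralizer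
  -- is the group order, so the weights cancel within each class.
  have hcard : ∀ c, (Finset.univ.filter fun g : H => ConjClasses.mk g = c).card * N (rep c) =
      Nat.card H := by
    intro c
    have h1 := MulAction.card_orbit_mul_card_stabilizer_eq_card_group (ConjAct H) (rep c)
    have h2 : Fintype.card (ConjAct H) = Nat.card H := by rw [Nat.card_eq_fintype_card]; rfl
    rw [← h2, ← h1, ← Nat.card_eq_fintype_card (α := MulAction.stabilizer _ _)]
    congr 1
    · rw [← Set.toFinset_card]
      congr 1
      ext g
      rw [Set.mem_toFinset, ConjAct.orbit_eq_carrier_conjClasses, ConjClasses.mem_carrier_iff_mk_eq,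
        hrep]
      simp
    · refine Nat.card_congr ⟨fun x => ⟨ConjAct.toConjAct ⟨x.1, x.2.1⟩, ?_⟩,
        fun y => ⟨(ConjAct.ofConjAct y.1 : H), ?_⟩, fun _ => rfl, fun _ => rfl⟩
      · rw [MulAction.mem_stabilizer_iff, ConjAct.smul_def, ConjAct.ofConjAct_toConjAct,
          mul_inv_eq_iff_eq_mul]
        exact Subtype.ext (Subgroup.mem_centralizer_singleton_iff.mp x.2.2)
      · refine ⟨(ConjAct.ofConjAct y.1).2, ?_⟩
        have := y.2
        rw [MulAction.mem_stabilizer_iff, ConjAct.smul_def, mul_inv_eq_iff_eq_mul] at this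
        exact Subgroup.mem_centralizer_singleton_iff.mpr (congrArg Subtype.val this)
  rw [eqEuler_succ, finsum_eq_sum_of_fintype, finsum_eq_sum_of_fintype, Finset.mul_sum,
    ← Finset.sum_fiberwise (s := Finset.univ) (g := fun g : H => ConjClasses.mk g)]
  refine Finset.sum_congr rfl fun c _ => ?_
  have hH : (Nat.card H : ℚ) ≠ 0 := Nat.cast_ne_zero.mpr Nat.card_pos.ne'
  rw [Finset.sum_congr rfl (g := fun _ => 1 / (Nat.card H : ℚ) * (N (rep c) * F (rep c))),
    Finset.sum_const, nsmul_eq_mul]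
  · have h1 : ((Finset.univ.filter fun g : H => ConjClasses.mk g = c).card : ℚ) * N (rep c) =
      Nat.card H := by exact_mod_cast hcard c
    calc _ = 1 / (Nat.card H : ℚ) *
          (((Finset.univ.filter fun g : H => ConjClasses.mk g = c).card : ℚ) * N (rep c)) *
            F (rep c) := by ring
      _ = F (rep c) := by rw [h1, one_div_mul_cancel hH, one_mul]
  · intro g hg
    obtain ⟨h1, h2⟩ := hmk g c (Finset.mem_filter.mp hg).2
    rw [← h1, ← h2]

end EqEuler

/-! ### Hermitian forms and the standard example. -/

/-- Hermitian forms with respect to the `q`-power map. -/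
structure IsHerm {K V : Type*} [Field K] [AddCommGroup V] [Module K V] (q : ℕ) (h : V → V → K) :
    Prop where
  add_left : ∀ u v w, h (u + v) w = h u w + h v w
  smul_left : ∀ (c : K) u v, h (c • u) v = c * h u v
  add_right : ∀ u v w, h u (v + w) = h u v + h u w
  smul_right : ∀ (c : K) u v, h u (c • v) = c ^ q * h u v
  symm : ∀ u v, h v u = h u v ^ q

namespace IsHerm

variable {K V : Type*} [Field K] [AddCommGroup V] [Module K V] {q : ℕ} {h : V → V → K}

theorem zero_left (hh : IsHerm q h) (v : V) : h 0 v = 0 := by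
  have := hh.add_left 0 0 v
  rwa [add_zero, left_eq_add] at this

theorem zero_right (hh : IsHerm q h) (v : V) : h v 0 = 0 := by
  have := hh.add_right v 0 0
  rwa [add_zero, left_eq_add] at this

theorem sub_left (hh : IsHerm q h) (u v w : V) : h (u - v) w = h u w - h v w := by
  rw [eq_sub_iff_add_eq, ← hh.add_left, sub_add_cancel]

theorem sub_right (hh : IsHerm q h) (u v w : V) : h u (v - w) = h u v - h u w := by
  rw [eq_sub_iff_add_eq, ← hh.add_right, sub_add_cancel]

theorem sum_left (hh : IsHerm q h) {ι : Type*} (s : Finset ι) (f : ι → V) (v : V) :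
    h (∑ i ∈ s, f i) v = ∑ i ∈ s, h (f i) v := by
  classical
  induction s using Finset.induction_on with
  | empty => simp [hh.zero_left]
  | insert a s ha ih => rw [Finset.sum_insert ha, Finset.sum_insert ha, hh.add_left, ih]

theorem sum_right (hh : IsHerm q h) {ι : Type*} (s : Finset ι) (f : ι → V) (v : V) :
    h v (∑ i ∈ s, f i) = ∑ i ∈ s, h v (f i) := by
  classical
  induction s using Finset.induction_on with
  | empty => simp [hh.zero_right]
  | insert a s ha ih => rw [Finset.sum_insert ha, Finset.sum_insert ha, hh.add_right, ih]

theorem eq_zero_comm (hh : IsHerm q h) (hq : q ≠ 0) {u v : V} (huv : h u v = 0) : h v u = 0 := by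
  rw [hh.symm u v, huv, zero_pow hq]

theorem restrict (hh : IsHerm q h) (U : Submodule K V) : IsHerm q (fun u v : U => h u v) :=
  ⟨fun _ _ _ => hh.add_left _ _ _, fun _ _ _ => hh.smul_left _ _ _, fun _ _ _ => hh.add_right _ _ _,
    fun _ _ _ => hh.smul_right _ _ _, fun _ _ => hh.symm _ _⟩

end IsHerm

section Standard

theorem pow_pow_eq_self {K : Type*} [Field K] [Finite K] {p k : ℕ} (hK : Nat.card K = (p ^ k) ^ 2) (x : K) : (x ^ p ^ k) ^ p ^ k = x := by
  have := Fintype.ofFinite K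
  rw [← pow_mul, ← pow_two, ← hK, Nat.card_eq_fintype_card, FiniteField.pow_card]

variable {K : Type*} [Field K] [Finite K] {p : ℕ} [Fact p.Prime] [CharP K p] {k : ℕ}

/-- Swapping the arguments reverses the indices and multiplies the signs by `(-1) ^ (n + 1)`; the
condition on the constant `c` says that `c ^ q` differs from `c` by the same sign. -/
theorem isHerm_hermForm (hk : 0 < k) (hK : Nat.card K = (p ^ k) ^ 2) (n : ℕ) :
    IsHerm (p ^ k) (hermForm K (p ^ k) n) := by
  obtain ⟨hc0, hc⟩ := hermConst_spec K (p ^ k) n (Fact.out : p.Prime) hk rfl hK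
  set c := hermConst K (p ^ k) n with hcdef
  have hp : 1 ≤ p ^ k := Nat.one_le_pow _ _ (Fact.out : p.Prime).pos
  have hcq : c ^ p ^ k = (-1) ^ (n + 1) * c := by
    rw [← hc, ← pow_succ, Nat.sub_add_cancel hp]
  have hneg : (-1 : K) ^ p ^ k = -1 := by
    have h1 := sub_pow_char_pow (p := p) (n := k) (0 : K) 1
    rw [zero_sub, zero_pow (by positivity), one_pow, zero_sub] at h1
    exact h1
  refine ⟨?_, ?_, ?_, ?_, ?_⟩
  · intro u v w
    simp only [hermForm, ← mul_add, ← Finset.sum_add_distrib]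
    congr 1
    refine Finset.sum_congr rfl fun i _ => ?_
    rw [Pi.add_apply]; ring
  · intro a u v
    simp only [hermForm]
    rw [mul_left_comm]
    congr 1
    rw [Finset.mul_sum]
    refine Finset.sum_congr rfl fun i _ => ?_
    rw [Pi.smul_apply, smul_eq_mul]; ring
  · intro u v w
    simp only [hermForm, ← mul_add, ← Finset.sum_add_distrib]
    congr 1
    refine Finset.sum_congr rfl fun i _ => ?_
    rw [Pi.add_apply, add_pow_char_pow, mul_add]
  · intro a u v
    simp only [hermForm]
    rw [mul_left_comm]
    congr 1
    rw [Finset.mul_sum]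
    refine Finset.sum_congr rfl fun i _ => ?_
    rw [Pi.smul_apply, smul_eq_mul, mul_pow]; ring
  · intro u v
    simp only [hermForm]
    rw [mul_pow, ← hcdef, hcq, sum_pow_char_pow, mul_comm _ c, mul_assoc]
    congr 1
    rw [← Equiv.sum_comp Fin.revPerm, Finset.mul_sum]
    refine Finset.sum_congr rfl fun i _ => ?_
    rw [Fin.revPerm_apply, Fin.rev_rev, mul_pow, mul_pow, pow_pow_eq_self hK, ← pow_mul,
      mul_comm (i : ℕ), pow_mul, hneg]
    have h2 : (-1 : K) ^ (i.rev : ℕ) = (-1) ^ (n + 1) * (-1) ^ (i : ℕ) := by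
      rw [← pow_add, Fin.val_rev]
      obtain ⟨m, hm⟩ : ∃ m, n = i + 1 + m := ⟨n - (i + 1), by omega⟩
      rw [show n - (i + 1) = m by omega, show n + 1 + i = m + 2 * (i + 1) by omega, pow_add,
        pow_mul]
      simp
    rw [h2]
    ring

theorem hermForm_nondegenerate (hk : 0 < k) (hK : Nat.card K = (p ^ k) ^ 2) (n : ℕ)
    (u : Fin n → K) (hu : ∀ v, hermForm K (p ^ k) n u v = 0) : u = 0 := by
  obtain ⟨hc0, -⟩ := hermConst_spec K (p ^ k) n (Fact.out : p.Prime) hk rfl hK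
  funext i
  have h1 := hu (Pi.single i.rev 1)
  rw [hermForm, Finset.sum_eq_single_of_mem i (Finset.mem_univ i)] at h1
  · simpa [hc0] using h1
  · intro j _ hj
    rw [Pi.single_eq_of_ne (fun h => hj (Fin.rev_injective h)),
      zero_pow (pow_pos (Fact.out : p.Prime).pos k).ne', mul_zero]

end Standard

/-! ### Contractibility in the presence of a central unipotent isometry. -/

section Vanishing

variable {K V : Type*} [Field K] [AddCommGroup V] [Module K V]

theorem smul_eq_map (φ : V ≃ₗ[K] V) (U : Submodule K V) : φ • U = U.map φ.toLinearMap := rfl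

instance finite_linearEquiv [Finite V] : Finite (V ≃ₗ[K] V) :=
  Finite.of_injective (fun φ => (φ : V → V)) DFunLike.coe_injective

theorem smul_eq_self_iff [FiniteDimensional K V] (φ : V ≃ₗ[K] V) (U : Submodule K V) :
    φ • U = U ↔ ∀ x ∈ U, φ x ∈ U := by
  rw [smul_eq_map]
  constructor
  · intro h x hx
    rw [← h]
    exact Submodule.mem_map_of_mem hx
  · intro h
    refine Submodule.eq_of_le_of_finrank_eq ?_ (LinearEquiv.finrank_map_eq φ U)
    rintro _ ⟨x, hx, rfl⟩
    exact h x hx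

/-- The last nonzero vector among the `N ^ j x`, for a nonzero `x` in `U`, would lie in the kernel.
-/
theorem eq_bot_of_inf_ker_eq_bot (N : V →ₗ[K] V) (hN : IsNilpotent N) (U : Submodule K V)
    (hU : ∀ x ∈ U, N x ∈ U) (h : U ⊓ LinearMap.ker N = ⊥) : U = ⊥ := by
  obtain ⟨m, hm⟩ := hN
  have key : ∀ j, ∀ x ∈ U, (N ^ j) x = 0 → x = 0 := by
    intro j
    induction j with
    | zero => intro x _ hx; simpa using hx
    | succ j ih =>
      intro x hx h0
      rw [pow_succ, Module.End.mul_apply] at h0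
      have h1 : x ∈ U ⊓ LinearMap.ker N := ⟨hx, ih _ (hU x hx) h0⟩
      rwa [h, Submodule.mem_bot] at h1
  rw [eq_bot_iff]
  intro x hx
  exact key m x hx (by rw [hm]; rfl)

variable {q : ℕ} {h : V → V → K}

/-- The invariant totally isotropic subspaces of a family of isometries that contains a nontrivial
central unipotent element form a contractible poset. -/
theorem redEuler_invariant_eq_zero [Finite V] [FiniteDimensional K V] (hq : q ≠ 0)
    (hh : IsHerm q h) (u : V ≃ₗ[K] V) (hu : ∀ x y, h (u x) (u y) = h x y) (hu1 : u ≠ 1)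
    (hnil : IsNilpotent (u.toLinearMap - LinearMap.id)) (Φ : Set (V ≃ₗ[K] V)) (huΦ : u ∈ Φ)
    (hΦ : ∀ φ ∈ Φ, ∀ x, φ (u x) = u (φ x)) {P : Set (Submodule K V)}
    (hP : ∀ U, U ∈ P ↔ U ≠ ⊥ ∧ (∀ x ∈ U, ∀ y ∈ U, h x y = 0) ∧ ∀ φ ∈ Φ, φ • U = U) :
    redEuler P = 0 := by
  classical
  set N := u.toLinearMap - LinearMap.id with hN
  have hNx : ∀ x, N x = u x - x := fun _ => rfl
  set W := LinearMap.ker N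
  set R := W ⊓ LinearMap.range N
  have hW : ∀ x, x ∈ W ↔ u x = x := fun x => by
    rw [LinearMap.mem_ker, hNx, sub_eq_zero]
  let C : Submodule K V → Prop := fun U =>
    (∀ x ∈ U, ∀ y ∈ U, h x y = 0) ∧ ∀ φ ∈ Φ, ∀ x ∈ U, φ x ∈ U
  -- If `u x = x`, then `h x (u z - z) = h (u x) (u z) - h x z = 0`. So `R` is totally isotropic and
  -- orthogonal to `W`.
  have horth : ∀ x ∈ W, ∀ y ∈ LinearMap.range N, h x y = 0 := by
    rintro x hx _ ⟨z, rfl⟩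
    rw [hNx, hh.sub_right]
    nth_rewrite 1 [← (hW x).mp hx]
    rw [hu, sub_self]
  have hfin : Finite (Submodule K V) := Finite.of_injective _ SetLike.coe_injective
  let S : Finset (Submodule K V) := (Set.toFinite {U | C U}).toFinset
  have hS : ∀ U, U ∈ S ↔ C U := fun U => by simp [S]
  have hWΦ : ∀ φ ∈ Φ, ∀ x ∈ W, φ x ∈ W := by
    intro φ hφ x hx
    rw [hW] at hx ⊢
    rw [← hΦ φ hφ, hx]
  have hRΦ : ∀ φ ∈ Φ, ∀ x ∈ LinearMap.range N, φ x ∈ LinearMap.range N := by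
    rintro φ hφ _ ⟨z, rfl⟩
    exact ⟨φ z, by rw [hNx, hNx, map_sub, hΦ φ hφ]⟩
  have hR : C R := ⟨fun x hx y hy => horth x hx.1 y hy.2,
    fun φ hφ x hx => ⟨hWΦ φ hφ x hx.1, hRΦ φ hφ x hx.2⟩⟩
  have hbot : C ⊥ := by
    refine ⟨?_, ?_⟩
    · intro x hx y _
      rw [Submodule.mem_bot] at hx
      rw [hx, hh.zero_left]
    · intro φ _ x hx
      rw [Submodule.mem_bot] at hx ⊢
      rw [hx, map_zero]
  -- The contraction is `U ≥ U ⊓ W ≤ (U ⊓ W) ⊔ R ≥ R`. Nilpotency of `N` ensures that `R` and all `U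
  -- ⊓ W` with `U ≠ ⊥` are nonzero.
  refine redEuler_eq_zero (S := S) (a := ⊥) (c := R) ((hS _).mpr hbot) (fun _ _ => bot_le)
    (fun U => U ≤ W) (fun U => U ⊓ W) (fun U => U ⊔ R) ((hS _).mpr hR) ?_ bot_le ?_ ?_ ?_ ?_ ?_ ?_
  · intro h0
    have h1 : LinearMap.range N = ⊥ := by
      refine eq_bot_of_inf_ker_eq_bot N hnil _ ?_ (by rw [inf_comm]; exact h0)
      intro x _
      exact LinearMap.mem_range_self N x
    apply hu1
    ext x
    have h2 : N x ∈ LinearMap.range N := LinearMap.mem_range_self N x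
    rw [h1, Submodule.mem_bot, hNx, sub_eq_zero] at h2
    exact h2
  · intro U hU
    rw [hS] at hU
    exact ⟨(hS _).mpr ⟨fun x hx y hy => hU.1 x hx.1 y hy.1,
      fun φ hφ x hx => ⟨hU.2 φ hφ x hx.1, hWΦ φ hφ x hx.2⟩⟩, inf_le_right, inf_le_left⟩
  · intro x _ y _ h1 h2
    exact le_inf h2 h1
  · intro U hU h0
    rw [hS] at hU
    refine eq_bot_of_inf_ker_eq_bot N hnil U ?_ h0
    intro x hx
    rw [hNx]
    exact U.sub_mem (hU.2 u huΦ x hx) hx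
  · intro U hU hUW
    rw [hS] at hU
    refine ⟨(hS _).mpr ⟨?_, ?_⟩, sup_le hUW inf_le_left, le_sup_left, le_sup_right⟩
    · intro x hx y hy
      obtain ⟨a, ha, b, hb, rfl⟩ := Submodule.mem_sup.mp hx
      obtain ⟨a', ha', b', hb', rfl⟩ := Submodule.mem_sup.mp hy
      rw [hh.add_left, hh.add_right, hh.add_right, hU.1 a ha a' ha', horth a (hUW ha) b' hb'.2,
        hh.eq_zero_comm hq (horth a' (hUW ha') b hb.2), horth b hb.1 b' hb'.2]
      simp
    · intro φ hφ x hx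
      obtain ⟨a, ha, b, hb, rfl⟩ := Submodule.mem_sup.mp hx
      rw [map_add]
      exact Submodule.add_mem_sup (hU.2 φ hφ a ha) (hR.2 φ hφ b hb)
  · intro x _ _ y _ _ h1 h2
    exact sup_le h1 h2
  · intro U
    rw [hP, hS, and_comm]
    simp only [smul_eq_self_iff, C]

end Vanishing

/-! ### The sum over the classes of elements of order prime to `p`. -/

section Galois

variable (p : ℕ) [Fact p.Prime] (k : ℕ)

theorem card_galoisField (hk : 0 < k) : Nat.card (GaloisField p (2 * k)) = (p ^ k) ^ 2 := by
  rw [GaloisField.card p _ (by omega), ← pow_mul, mul_comm]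

/-- A power `u` of `g` has order `p`; it is unipotent in characteristic `p` and commutes with
everything that commutes with `g`. Each term of the sum defining the Euler characteristic then
vanishes. -/
theorem chiCentralizer_eq_zero (hk : 0 < k) (n r : ℕ) (g : GU p k n)
    (hg : ¬ Nat.Coprime (p ^ k) (orderOf g)) : chiCentralizer p k n r g = 0 := by
  have hp : p.Prime := Fact.out
  have hdvd : p ∣ orderOf g := by
    rw [Nat.coprime_pow_left_iff hk, hp.coprime_iff_not_dvd, not_not] at hg
    exact hg
  have hpos : 0 < orderOf g := orderOf_pos g
  set u := g ^ (orderOf g / p) with hu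
  have hup : u ^ p = 1 := by
    rw [hu, ← pow_mul, Nat.div_mul_cancel hdvd, pow_orderOf_eq_one]
  have hu1 : u ≠ 1 := by
    intro h1
    have h2 := orderOf_dvd_of_pow_eq_one h1
    have h3 : orderOf g / p < orderOf g := Nat.div_lt_self hpos hp.one_lt
    exact absurd (Nat.le_of_dvd (Nat.div_pos (Nat.le_of_dvd hpos hdvd) hp.pos) h2) (by omega)
  unfold chiCentralizer eqEuler
  rw [finsum_eq_zero_of_forall_eq_zero, mul_zero]
  intro X
  rw [Int.cast_eq_zero]
  have hcomm : ∀ φ : (Fin n → GaloisField p (2 * k)) ≃ₗ[GaloisField p (2 * k)]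
      (Fin n → GaloisField p (2 * k)), φ * g.1 = g.1 * φ → ∀ x, φ (u.1 x) = u.1 (φ x) := by
    intro φ hφ x
    have : Commute φ u.1 := by
      rw [hu, Subgroup.coe_pow]
      exact Commute.pow_right hφ _
    exact DFunLike.congr_fun this.eq x
  refine redEuler_invariant_eq_zero (pow_pos hp.pos k).ne'
    (isHerm_hermForm hk (card_galoisField p k hk) n) u.1 u.2 ?_ ?_
    ({u.1, g.1} ∪ Set.range fun z => (X z).1) (by simp) ?_ ?_
  · exact fun h1 => hu1 (Subtype.ext h1)
  · refine ⟨p, ?_⟩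
    have h1 : u.1.toLinearMap ^ p = 1 := by
      have h2 : u.1 ^ p = 1 := by rw [← Subgroup.coe_pow, hup]; rfl
      have h3 := congrArg (LinearEquiv.automorphismGroup.toLinearMapMonoidHom) h2
      rwa [map_pow, map_one] at h3
    -- `(X - 1) ^ p = X ^ p - 1` holds in the commutative ring of polynomials and is then evaluated
    -- at `u`.
    have h2 := congrArg (aeval u.1.toLinearMap)
      (sub_pow_char (p := p) (Polynomial.X : (GaloisField p (2 * k))[X]) 1)
    simp only [map_pow, map_sub, aeval_X, map_one, one_pow, h1, sub_self] at h2
    exact h2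
  · rintro φ ((rfl | rfl) | ⟨z, rfl⟩)
    · exact fun x => rfl
    · exact hcomm _ rfl
    · exact hcomm _ (Subgroup.mem_centralizer_singleton_iff.mp (X z).2.2)
  · intro U
    constructor
    · rintro ⟨⟨⟨h1, h2⟩, h3⟩, h4⟩
      refine ⟨h1, h2, ?_⟩
      rintro φ ((rfl | rfl) | ⟨z, rfl⟩)
      · have : g.1 ∈ MulAction.stabilizer _ U := h3
        rw [hu, Subgroup.coe_pow]
        exact Subgroup.pow_mem _ this _
      · exact h3
      · exact h4 _ ⟨z, rfl⟩
    · rintro ⟨h1, h2, h3⟩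
      refine ⟨⟨⟨h1, h2⟩, h3 _ (by simp)⟩, ?_⟩
      rintro _ ⟨z, rfl⟩
      exact h3 _ (Or.inr ⟨z, rfl⟩)

/-- The recursion for `chiGU` as a sum over the classes of elements of order prime to `p`. -/
theorem chiGU_succ (hk : 0 < k) (n r : ℕ) (rep : ConjClasses (GU p k n) → GU p k n)
    (hrep : ∀ c, ConjClasses.mk (rep c) = c) :
    chiGU p k n (r + 1) =
      ∑ᶠ (c : ConjClasses (GU p k n)) (_ : Nat.Coprime (p ^ k) (orderOf (rep c))),
        chiCentralizer p k n r (rep c) := by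
  have hmono : ∀ h ∈ GU p k n, ∀ x y : Submodule (GaloisField p (2 * k))
      (Fin n → GaloisField p (2 * k)), h • x ≤ h • y ↔ x ≤ y := by
    intro h _ x y
    exact Submodule.map_le_map_iff_of_injective h.injective x y
  have hP : ∀ h ∈ GU p k n, ∀ U ∈ isotropicPoset (GaloisField p (2 * k)) (p ^ k) n,
      h • U ∈ isotropicPoset (GaloisField p (2 * k)) (p ^ k) n := by
    rintro h hh U ⟨h1, h2⟩
    refine ⟨fun h0 => h1 ?_, ?_⟩
    · rw [smul_eq_map, Submodule.map_eq_bot_iff] at h0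
      exact h0
    · rintro _ ⟨x, hx, rfl⟩ _ ⟨y, hy, rfl⟩
      exact (hh x y).trans (h2 x hx y hy)
  rw [chiGU, eqEuler_succ_eq_finsum_conjClasses r _ _ hP hmono rep hrep]
  refine finsum_congr fun c => ?_
  by_cases hc : Nat.Coprime (p ^ k) (orderOf (rep c))
  · rw [finsum_eq_if, if_pos hc]; rfl
  · rw [finsum_eq_if, if_neg hc]
    exact chiCentralizer_eq_zero p k hk n r (rep c) hc

end Galois

/-! ### Classification of nondegenerate Hermitian forms over finite fields. -/

section Classification

variable {F : Type*} [Field F] [Finite F] {q : ℕ}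

/-- The polynomial `X ^ q + X` has at most `q < q ^ 2` roots. -/
theorem exists_add_pow_ne_zero (hq : 1 < q) (hF : Nat.card F = q ^ 2) : ∃ t : F, t + t ^ q ≠ 0 := by
  have := Fintype.ofFinite F
  by_contra! hall
  have hd : (X ^ q + X : F[X]).natDegree = q := by
    rw [natDegree_add_eq_left_of_natDegree_lt] <;> simp [hq]
  have hne : (X ^ q + X : F[X]) ≠ 0 := by
    intro h0
    rw [h0, natDegree_zero] at hd
    omega
  have h1 : Fintype.card F ≤ (X ^ q + X : F[X]).natDegree :=
    Polynomial.card_le_degree_of_subset_roots (p := X ^ q + X) (Z := Finset.univ) (by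
      intro x _
      rw [Polynomial.mem_roots hne]
      simp [add_comm _ x, hall x])
  rw [hd, ← Nat.card_eq_fintype_card, hF] at h1
  nlinarith

/-- Surjectivity of the norm onto the subfield of order `q`. For a generator `ζ` of the cyclic group
of units and `a = ζ ^ m`, the order `(q - 1) * (q + 1)` divides `m * (q - 1)`, so `q + 1` divides
`m`. -/
theorem exists_pow_succ_eq (hq : 1 < q) (hF : Nat.card F = q ^ 2) (a : F) (ha : a ≠ 0)
    (haq : a ^ q = a) : ∃ c : F, c ^ (q + 1) = a := by
  obtain ⟨ζ, hζ⟩ := IsCyclic.exists_generator (α := Fˣ)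
  obtain ⟨m, hm⟩ := (mem_powers_iff_mem_zpowers.mpr (hζ (Units.mk0 a ha)))
  have hord : orderOf ζ = (q - 1) * (q + 1) := by
    rw [orderOf_eq_card_of_forall_mem_zpowers hζ, Nat.card_units, hF]
    obtain ⟨s, rfl⟩ : ∃ s, q = s + 1 := ⟨q - 1, by omega⟩
    rw [Nat.add_sub_cancel, pow_two]
    rw [Nat.sub_eq_iff_eq_add (by nlinarith)]
    ring
  have h1 : ζ ^ (m * (q - 1)) = 1 := by
    have hm' : ζ ^ m = Units.mk0 a ha := hm
    rw [pow_mul, hm']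
    refine Units.ext ?_
    rw [Units.val_pow_eq_pow_val, Units.val_mk0, Units.val_one]
    refine mul_right_cancel₀ ha ?_
    rw [← pow_succ, Nat.sub_add_cancel hq.le, haq, one_mul]
  have h2 := orderOf_dvd_of_pow_eq_one h1
  rw [hord, mul_comm m] at h2
  obtain ⟨s, rfl⟩ := Nat.dvd_of_mul_dvd_mul_left (by omega) h2
  refine ⟨(ζ : F) ^ s, ?_⟩
  have hm' := congrArg Units.val hm
  rw [← pow_mul, mul_comm]
  simpa using hm'

variable {V : Type*} [AddCommGroup V] [Module F V] {H : V → V → F}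

/-- If every vector were isotropic, rescaling `u` so that `H u v = t` and expanding at the sum would
give `t + t ^ q = 0` for every `t`. -/
theorem IsHerm.exists_self_ne_zero (hq : 1 < q) (hF : Nat.card F = q ^ 2) (hH : IsHerm q H)
    (hnd : ∀ u, (∀ v, H u v = 0) → u = 0) [Nontrivial V] : ∃ v, H v v ≠ 0 := by
  by_contra! hall
  obtain ⟨u, hu⟩ := exists_ne (0 : V)
  obtain ⟨v, hv⟩ : ∃ v, H u v ≠ 0 := by
    by_contra! h0
    exact hu (hnd u h0)
  obtain ⟨t, ht⟩ := exists_add_pow_ne_zero hq hF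
  apply ht
  have h1 := hall ((t / H u v) • u + v)
  rw [hH.add_left, hH.add_right, hH.add_right, hall, hall, zero_add, add_zero,
    hH.symm ((t / H u v) • u) v, hH.smul_left, div_mul_cancel₀ _ hv] at h1
  exact h1

theorem IsHerm.exists_self_eq_one (hq : 1 < q) (hF : Nat.card F = q ^ 2) (hH : IsHerm q H)
    (hnd : ∀ u, (∀ v, H u v = 0) → u = 0) [Nontrivial V] : ∃ v, H v v = 1 := by
  obtain ⟨v, hv⟩ := hH.exists_self_ne_zero hq hF hnd
  obtain ⟨c, hc⟩ := exists_pow_succ_eq hq hF (H v v)⁻¹ (inv_ne_zero hv) (by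
    rw [inv_pow, ← hH.symm])
  refine ⟨c • v, ?_⟩
  rw [hH.smul_left, hH.smul_right, ← mul_assoc, ← pow_succ', hc, inv_mul_cancel₀ hv]

/-- Gram-Schmidt: split off a vector of norm one and continue in its orthogonal complement `ker ℓ`,
which stays nondegenerate because it spans `V` together with `v`. -/
theorem IsHerm.exists_orthonormal [FiniteDimensional F V] (hq : 1 < q) (hF : Nat.card F = q ^ 2)
    (hH : IsHerm q H) (hnd : ∀ u, (∀ v, H u v = 0) → u = 0) :
    ∃ e : Fin (Module.finrank F V) → V, ∀ i j, H (e i) (e j) = if i = j then 1 else 0 := by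
  generalize hn : Module.finrank F V = n
  induction n generalizing V with
  | zero => exact ⟨Fin.elim0, fun i => i.elim0⟩
  | succ n ih =>
    have : Nontrivial V := Module.nontrivial_of_finrank_pos (R := F) (by omega)
    obtain ⟨v, hv⟩ := hH.exists_self_eq_one hq hF hnd
    let ℓ : V →ₗ[F] F :=
      { toFun := fun u => H u v
        map_add' := fun x y => hH.add_left x y v
        map_smul' := fun c x => hH.smul_left c x v }
    have hℓ : LinearMap.range ℓ = ⊤ := by
      rw [LinearMap.range_eq_top]
      intro c
      exact ⟨c • v, by simp [ℓ, hv]⟩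
    have hdim := LinearMap.finrank_range_add_finrank_ker ℓ
    rw [hℓ, finrank_top, Module.finrank_self, hn] at hdim
    have hker : ∀ w : LinearMap.ker ℓ, H w v = 0 := fun w => w.2
    obtain ⟨e, he⟩ := ih (hH.restrict (LinearMap.ker ℓ)) (by
      rintro w hw
      refine Subtype.ext (hnd w fun x => ?_)
      have hx : x - H x v • v ∈ LinearMap.ker ℓ := by
        rw [LinearMap.mem_ker]
        change H (x - H x v • v) v = 0
        rw [hH.sub_left, hH.smul_left, hv, mul_one, sub_self]
      have h1 := hw ⟨_, hx⟩
      simp only [hH.sub_right, hH.smul_right, hker w, mul_zero, sub_zero] at h1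
      exact h1) (by omega)
    refine ⟨Fin.cons v fun i => (e i : V), ?_⟩
    have hq0 : q ≠ 0 := by omega
    intro i j
    refine Fin.cases ?_ (fun i => ?_) i <;> refine Fin.cases ?_ (fun j => ?_) j
    · simp [hv]
    · simpa [(Fin.succ_ne_zero j).symm] using hH.eq_zero_comm hq0 (hker (e j))
    · simpa using hker (e i)
    · simpa using he i j

theorem IsHerm.linearIndependent_of_orthonormal {F V : Type*} [Field F] [AddCommGroup V]
    [Module F V] {H : V → V → F} (hH : IsHerm q H) {n : ℕ} (e : Fin n → V)
    (he : ∀ i j, H (e i) (e j) = if i = j then 1 else 0) : LinearIndependent F e := by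
  rw [Fintype.linearIndependent_iff]
  intro c hc i
  have h1 : H (∑ j, c j • e j) (e i) = 0 := by rw [hc, hH.zero_left]
  simpa [hH.sum_left, hH.smul_left, he] using h1

/-- Nondegenerate Hermitian forms of the same dimension over a finite field are isometric. -/
theorem IsHerm.exists_isometry {V' : Type*} [AddCommGroup V'] [Module F V'] {H' : V' → V' → F}
    [FiniteDimensional F V] [FiniteDimensional F V'] (hq : 1 < q) (hF : Nat.card F = q ^ 2)
    (hH : IsHerm q H) (hnd : ∀ u, (∀ v, H u v = 0) → u = 0)
    (hH' : IsHerm q H') (hnd' : ∀ u, (∀ v, H' u v = 0) → u = 0)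
    (hdim : Module.finrank F V = Module.finrank F V') :
    ∃ T : V ≃ₗ[F] V', ∀ u v, H' (T u) (T v) = H u v := by
  obtain ⟨e, he⟩ := hH.exists_orthonormal hq hF hnd
  obtain ⟨e', he'⟩ := hH'.exists_orthonormal hq hF hnd'
  have hli := hH.linearIndependent_of_orthonormal e he
  have hli' := hH'.linearIndependent_of_orthonormal e' he'
  let b := basisOfLinearIndependentOfCardEqFinrank' e hli (by simp)
  let b' := basisOfLinearIndependentOfCardEqFinrank' e' hli' (by simp)
  have hb : ∀ i, b i = e i := fun i => by simp [b]
  have hb' : ∀ i, b' i = e' i := fun i => by simp [b']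
  let T := b.equiv b' (finCongr hdim)
  refine ⟨T, fun u v => ?_⟩
  have hT : ∀ i, T (e i) = e' (finCongr hdim i) := fun i => by
    rw [← hb, ← hb', Module.Basis.equiv_apply]
  rw [← b.sum_repr u, ← b.sum_repr v]
  simp only [map_sum, map_smul, hb, hT, hH.sum_left, hH.sum_right, hH.smul_left, hH.smul_right,
    hH'.sum_left, hH'.sum_right, hH'.smul_left, hH'.smul_right, he, he',
    EmbeddingLike.apply_eq_iff_eq]

end Classification

/-! ### Orthogonal decompositions and multiplicativity. -/

section Decomposition

variable {K V : Type*} [Field K] [AddCommGroup V] [Module K V]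

/-- The isometries of the form `h` that commute with `g`. -/
def isoGrp (h : V → V → K) (g : V →ₗ[K] V) : Subgroup (V ≃ₗ[K] V) where
  carrier := {φ | (∀ u v, h (φ u) (φ v) = h u v) ∧ ∀ v, φ (g v) = g (φ v)}
  mul_mem' {φ ψ} hφ hψ := ⟨fun u v => by
    rw [LinearEquiv.mul_apply, LinearEquiv.mul_apply, hφ.1, hψ.1], fun v => by
    rw [LinearEquiv.mul_apply, LinearEquiv.mul_apply, hψ.2, hφ.2]⟩
  one_mem' := ⟨fun _ _ => rfl, fun _ => rfl⟩
  inv_mem' {φ} hφ := ⟨fun u v => by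
    rw [← hφ.1]
    exact congrArg₂ _ (φ.apply_symm_apply u) (φ.apply_symm_apply v), fun v => by
    apply φ.injective
    rw [hφ.2]
    exact (φ.apply_symm_apply (g v)).trans (congrArg g (φ.apply_symm_apply v).symm)⟩

theorem mem_isoGrp {h : V → V → K} {g : V →ₗ[K] V} {φ : V ≃ₗ[K] V} :
    φ ∈ isoGrp h g ↔ (∀ u v, h (φ u) (φ v) = h u v) ∧ ∀ v, φ (g v) = g (φ v) := Iff.rfl

/-- The `g`-invariant totally isotropic subspaces. -/
def isoSub (h : V → V → K) (g : V →ₗ[K] V) : Set (Submodule K V) :=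
  {U | (∀ u ∈ U, ∀ v ∈ U, h u v = 0) ∧ ∀ u ∈ U, g u ∈ U}

/-- The equivariant reduced Euler characteristic, with the sign changed, of the group of the
isometries that commute with `g` acting on the nonzero `g`-invariant totally isotropic subspaces. -/
def isoEuler (r : ℕ) (h : V → V → K) (g : V →ₗ[K] V) : ℚ :=
  -eqEuler r (isoGrp h g) {U | U ∈ isoSub h g ∧ U ≠ ⊥}

theorem commute_aeval {φ g : V →ₗ[K] V} (hφ : ∀ v, φ (g v) = g (φ v)) (P : K[X]) (v : V) :
    φ (aeval g P v) = aeval g P (φ v) := by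
  have h1 : Commute φ g := LinearMap.ext hφ
  have h2 : Commute φ (aeval g P) := by
    induction P using Polynomial.induction_on with
    | C a =>
      rw [aeval_C]
      exact (Algebra.commutes a φ).symm
    | add p q hp hq => rw [map_add]; exact hp.add_right hq
    | monomial n a _ =>
      rw [map_mul, aeval_C, map_pow, aeval_X]
      exact Commute.mul_right (Algebra.commutes a φ).symm (h1.pow_right _)
  exact LinearMap.congr_fun h2.eq v

theorem aeval_mem {g : V →ₗ[K] V} {U : Submodule K V} (hU : ∀ u ∈ U, g u ∈ U) (P : K[X]) {u : V}
    (hu : u ∈ U) : aeval g P u ∈ U := by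
  induction P using Polynomial.induction_on generalizing u with
  | C a =>
    rw [aeval_C]
    exact U.smul_mem a hu
  | add p q hp hq => rw [map_add]; exact U.add_mem (hp hu) (hq hu)
  | monomial n a ih =>
    rw [pow_succ, ← mul_assoc, map_mul, aeval_X]
    exact ih (hU u hu)

theorem coe_aeval_restrict {g : V →ₗ[K] V} {U : Submodule K V} (hU : ∀ u ∈ U, g u ∈ U) (P : K[X])
    (u : U) : (aeval (g.restrict hU) P u : V) = aeval g P u := by
  induction P using Polynomial.induction_on generalizing u with
  | C a => simp [aeval_C]
  | add p q hp hq => simp [hp, hq]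
  | monomial n a ih =>
    rw [pow_succ, ← mul_assoc, map_mul, aeval_X, map_mul (aeval g), aeval_X]
    exact ih _

variable [Finite V] [FiniteDimensional K V]

/-- Multiplicativity for orthogonal decompositions into images of idempotent polynomials
in `g`. -/
theorem isoEuler_eq_prod {q : ℕ} {h : V → V → K} (hh : IsHerm q h) (g : V →ₗ[K] V) (r : ℕ)
    {ι : Type*} [Fintype ι] (E : ι → K[X]) (hsum : ∑ i, aeval g (E i) = 1)
    (hmul : ∀ i j, i ≠ j → aeval g (E i) * aeval g (E j) = 0)
    (horth : ∀ i j, i ≠ j → ∀ u v, h (aeval g (E i) u) (aeval g (E j) v) = 0)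
    (W : ι → Submodule K V) (hW : ∀ i x, x ∈ W i ↔ aeval g (E i) x = x)
    (hgW : ∀ i, ∀ x ∈ W i, g x ∈ W i) :
    isoEuler r h g = ∏ i, isoEuler r (fun u v : W i => h u v) (g.restrict (hgW i)) := by
  classical
  let e : ι → V →ₗ[K] V := fun i => aeval g (E i)
  have hsum' : ∀ x, ∑ i, e i x = x := fun x => by
    rw [← LinearMap.sum_apply, hsum]; rfl
  have hmul' : ∀ i j, i ≠ j → ∀ x, e i (e j x) = 0 := fun i j hij x =>
    LinearMap.congr_fun (hmul i j hij) x
  have hidem : ∀ i x, e i x ∈ W i := fun i x => by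
    rw [hW]
    change e i (e i x) = e i x
    conv_rhs => rw [← hsum' x, map_sum]
    rw [Finset.sum_eq_single_of_mem i (Finset.mem_univ i)]
    exact fun j _ hj => hmul' i j hj.symm x
  have hself : ∀ i, ∀ x ∈ W i, e i x = x := fun i x hx => (hW i x).mp hx
  have hne : ∀ i j, j ≠ i → ∀ x ∈ W i, e j x = 0 := fun i j hij x hx => by
    rw [← hself i x hx, hmul' j i hij]
  -- The `E i (g)` are orthogonal idempotents with sum one, so `V` is the direct sum of their images
  -- `W i`.
  let T : V ≃ₗ[K] ∀ i, W i :=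
    { toFun := fun x i => ⟨e i x, hidem i x⟩
      map_add' := fun x y => by ext i; simp
      map_smul' := fun c x => by ext i; simp
      invFun := fun y => ∑ i, (y i : V)
      left_inv := fun x => hsum' x
      right_inv := fun y => by
        ext i
        simp only [map_sum]
        rw [Finset.sum_eq_single_of_mem i (Finset.mem_univ i)]
        · exact hself i _ (y i).2
        · exact fun j _ hj => hne j i hj.symm _ (y j).2 }
  have hT : ∀ x i, (T x i : V) = e i x := fun _ _ => rfl
  have hTs : ∀ y, T.symm y = ∑ i, (y i : V) := fun _ => rfl
  have hTW : ∀ i, ∀ x : W i, T (x : V) i = x := fun i x => Subtype.ext (hself i x x.2)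
  have hTW' : ∀ i j, j ≠ i → ∀ x : W i, T (x : V) j = 0 := fun i j hij x =>
    Subtype.ext (hne i j hij x x.2)
  have hform : ∀ x y, h x y = ∑ i, h (T x i) (T y i) := by
    intro x y
    conv_lhs => rw [← hsum' x, ← hsum' y]
    rw [hh.sum_left]
    refine Finset.sum_congr rfl fun i _ => ?_
    rw [hh.sum_right, Finset.sum_eq_single_of_mem i (Finset.mem_univ i)]
    · rfl
    · exact fun j _ hj => horth i j hj.symm x y
  have hTg : ∀ x i, T (g x) i = g.restrict (hgW i) (T x i) := fun x i => Subtype.ext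
    (commute_aeval (φ := g) (fun _ => rfl) (E i) x).symm
  let hi : ∀ i, W i → W i → K := fun i u v => h u v
  let gi : ∀ i, W i →ₗ[K] W i := fun i => g.restrict (hgW i)
  let mapF : (∀ i, W i ≃ₗ[K] W i) → (V ≃ₗ[K] V) := fun ψ =>
    (T.trans (LinearEquiv.piCongrRight ψ)).trans T.symm
  have hmapF : ∀ ψ x i, T (mapF ψ x) i = ψ i (T x i) := fun ψ x i => by
    simp only [mapF, LinearEquiv.trans_apply, LinearEquiv.apply_symm_apply]
    rfl
  let B : (∀ i, isoGrp (hi i) (gi i)) →* isoGrp h g :=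
    MonoidHom.mk' (fun ψ => ⟨mapF fun i => (ψ i).1, by
      refine ⟨fun u v => ?_, fun v => ?_⟩
      · rw [hform, hform u v]
        refine Finset.sum_congr rfl fun i _ => ?_
        rw [hmapF, hmapF]
        exact (ψ i).2.1 _ _
      · apply T.injective
        funext i
        rw [hmapF, hTg, hTg, hmapF]
        exact (ψ i).2.2 _⟩) (fun ψ ψ' => by
      refine Subtype.ext (LinearEquiv.ext fun x => T.injective (funext fun i => ?_))
      rw [Subgroup.coe_mul, LinearEquiv.mul_apply, hmapF, hmapF, hmapF]
      rfl)
  have hB : ∀ ψ x i, T ((B ψ : V ≃ₗ[K] V) x) i = (ψ i).1 (T x i) := fun ψ x i => hmapF _ x i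
  have hBbij : Function.Bijective B := by
    constructor
    · intro ψ ψ' hψ
      funext i
      refine Subtype.ext (LinearEquiv.ext fun x => ?_)
      have h1 := hB ψ (x : V) i
      rw [hψ, hB, hTW] at h1
      exact h1.symm
    -- An isometry that commutes with `g` commutes with the projections `E i (g)`, hence preserves
    -- every `W i` and is the product of its restrictions.
    · rintro ⟨φ, hφ⟩
      have hφW : ∀ i, ∀ x, x ∈ W i → φ x ∈ W i := by
        intro i x hx
        rw [hW] at hx ⊢
        have h1 := commute_aeval (φ := φ.toLinearMap) hφ.2 (E i) x
        rw [hx] at h1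
        exact h1.symm
      have hφW' : ∀ i, (W i).map (φ : V →ₗ[K] V) = W i := fun i =>
        (smul_eq_self_iff φ (W i)).mpr (hφW i)
      refine ⟨fun i => ⟨LinearEquiv.ofSubmodules φ (W i) (W i) (hφW' i), ?_, ?_⟩, ?_⟩
      · exact fun u v => hφ.1 u v
      · exact fun v => Subtype.ext (hφ.2 v)
      · refine Subtype.ext (LinearEquiv.ext fun x => T.injective (funext fun i => ?_))
        rw [hB]
        refine Subtype.ext ?_
        exact commute_aeval (φ := φ.toLinearMap) hφ.2 (E i) x
  have hbotmem : ∀ i, (⊥ : Submodule K (W i)) ∈ isoSub (hi i) (gi i) := fun i => by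
    refine ⟨fun u hu v _ => ?_, fun u hu => ?_⟩
    · rw [(Submodule.mem_bot K).mp hu]
      exact hh.zero_left _
    · rw [(Submodule.mem_bot K).mp hu, map_zero]
      exact Submodule.zero_mem _
  have hbotmem' : (⊥ : Submodule K V) ∈ isoSub h g := by
    refine ⟨fun u hu v _ => ?_, fun u hu => ?_⟩
    · rw [(Submodule.mem_bot K).mp hu]
      exact hh.zero_left _
    · rw [(Submodule.mem_bot K).mp hu, map_zero]
      exact Submodule.zero_mem _
  let _ : ∀ i, OrderBot (isoSub (hi i) (gi i)) := fun i =>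
    { bot := ⟨⊥, hbotmem i⟩, bot_le := fun U => (bot_le : ⊥ ≤ U.1) }
  let _ : OrderBot (isoSub h g) := { bot := ⟨⊥, hbotmem'⟩, bot_le := fun U => (bot_le : ⊥ ≤ U.1) }
  have hfin : Finite (Submodule K V) := Finite.of_injective _ SetLike.coe_injective
  have hfini : ∀ i, Finite (Submodule K (W i)) := fun i =>
    Finite.of_injective _ SetLike.coe_injective
  -- The direct sum of the `U i`. Every `g`-invariant subspace has this form because the projections
  -- are polynomials in `g`.
  let glue : (∀ i, Submodule K (W i)) → Submodule K V := fun U =>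
    (Submodule.pi Set.univ U).comap T.toLinearMap
  have hglue : ∀ U x, x ∈ glue U ↔ ∀ i, T x i ∈ U i := fun U x => by
    simp [glue, Submodule.mem_pi]
  have hglueW : ∀ U i, ∀ x : W i, (x : V) ∈ glue U ↔ x ∈ U i := fun U i x => by
    rw [hglue]
    refine ⟨fun h1 => hTW i x ▸ h1 i, fun h1 j => ?_⟩
    by_cases hj : j = i
    · subst hj; rwa [hTW]
    · rw [hTW' i j hj]; exact Submodule.zero_mem _
  let f : (∀ i, isoSub (hi i) (gi i)) → isoSub h g := fun U => ⟨glue fun i => (U i).1, by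
    refine ⟨fun u hu v hv => ?_, fun u hu => ?_⟩
    · rw [hglue] at hu hv
      rw [hform]
      exact Finset.sum_eq_zero fun i _ => (U i).2.1 _ (hu i) _ (hv i)
    · rw [hglue] at hu ⊢
      intro i
      rw [hTg]
      exact (U i).2.2 _ (hu i)⟩
  have hfle : ∀ U U', f U ≤ f U' ↔ U ≤ U' := by
    intro U U'
    constructor
    · intro h1 i x hx
      exact (hglueW _ i x).mp (h1 ((hglueW _ i x).mpr hx))
    · intro h1 x hx
      have hx' := (hglue _ x).mp hx
      exact (hglue _ x).mpr fun i => h1 i (hx' i)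
  have hfsurj : Function.Surjective f := by
    rintro ⟨U, hU⟩
    refine ⟨fun i => ⟨U.comap (W i).subtype, ?_, ?_⟩, ?_⟩
    · exact fun u hu v hv => hU.1 _ hu _ hv
    · exact fun u hu => hU.2 _ hu
    · refine Subtype.ext (Submodule.ext fun x => ?_)
      refine (hglue _ x).trans ⟨fun h1 => ?_, fun h1 i => ?_⟩
      · rw [← hsum' x]
        exact Submodule.sum_mem _ fun i _ => h1 i
      · exact aeval_mem hU.2 (E i) h1
  let fiso : (∀ i, isoSub (hi i) (gi i)) ≃o isoSub h g :=
    RelIso.ofSurjective (OrderEmbedding.ofMapLEIff f hfle) hfsurj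
  have hfix : ∀ (ψ : ∀ i, isoGrp (hi i) (gi i)) (U : ∀ i, isoSub (hi i) (gi i)),
      (∀ i, (ψ i).1 • (U i).1 = (U i).1) ↔ (B ψ).1 • (f U).1 = (f U).1 := by
    intro ψ U
    simp only [smul_eq_self_iff]
    constructor
    · intro h1 x hx
      have hx' := (hglue _ x).mp hx
      refine (hglue _ _).mpr fun i => ?_
      rw [hB]
      exact h1 i _ (hx' i)
    · intro h1 i x hx
      have h2 := (hglue _ _).mp (h1 x ((hglueW _ i x).mpr hx)) i
      rwa [hB, hTW] at h2
  have key : ∀ {V' : Type _} [AddCommGroup V'] [Module K V'] (h' : V' → V' → K)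
      (g' : V' →ₗ[K] V') [OrderBot (isoSub h' g')]
      (_ : ((⊥ : isoSub h' g') : Submodule K V') = ⊥),
      isoEuler r h' g' = botEuler r (isoGrp h' g') (isoSub h' g') (fun φ U => φ.1 • U.1 = U.1) := by
    intro V' _ _ h' g' _ hbot
    refine neg_eqEuler_eq_botEuler r _ _ _ fun U => ?_
    constructor
    · rintro ⟨h1, h2⟩
      exact ⟨h1, fun h3 => h2 ((congrArg Subtype.val h3).trans hbot)⟩
    · rintro ⟨h1, h2⟩
      exact ⟨h1, fun h3 => h2 (Subtype.ext (h3.trans hbot.symm))⟩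
  rw [key h g rfl, Finset.prod_congr rfl fun i _ => key (hi i) (gi i) rfl, ← botEuler_pi]
  · exact (botEuler_congr r (MulEquiv.ofBijective B hBbij) fiso hfix).symm
  · intro i φ
    rw [smul_eq_self_iff]
    intro x hx
    rw [(Submodule.mem_bot K).mp hx, map_zero]
    exact Submodule.zero_mem _

end Decomposition

/-! ### Kernels of irreducible polynomials and multiplicities in the characteristic polynomial. -/

section Charpoly

variable {K V : Type*} [Field K] [AddCommGroup V] [Module K V]

/-- With a second variable `Y`, the polynomial `Y - X` divides `P(Y) - P(X)`. Substituting `M` for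
`Y` exhibits the scalar matrix `P(X)` as a multiple of the characteristic matrix; then take
determinants. -/
theorem matrix_charpoly_dvd_pow {ι : Type*} [Fintype ι] [DecidableEq ι] (M : Matrix ι ι K)
    (P : K[X]) (hP : aeval M P = 0) : M.charpoly ∣ P ^ Fintype.card ι := by
  let Φ : K[X][X] →ₐ[K[X]] Matrix ι ι K[X] := aeval (M.map C)
  have h1 : (X - C X : K[X][X]) ∣ P.map C - C P := by
    have := X_sub_C_dvd_sub_C_eval (p := P.map C) (a := (X : K[X]))
    rwa [eval_map, eval₂_C_X] at this
  obtain ⟨D, hD⟩ := h1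
  have h2 := congrArg Φ hD
  have hM : Φ (P.map C) = 0 := by
    have h3 : Φ (P.map C) = (C : K →+* K[X]).mapMatrix (aeval M P) := by
      simp only [Φ]
      rw [aeval_def, eval₂_map, aeval_def, hom_eval₂]
      congr 1
      ext a i j
      simp [Matrix.algebraMap_matrix_apply, Matrix.map_apply]
      split_ifs <;> simp
    rw [h3, hP, map_zero]
  have hX : Φ (X - C X) = -M.charmatrix := by
    simp only [Φ, map_sub, aeval_X, aeval_C, Matrix.charmatrix, neg_sub]
    rfl
  rw [map_sub, hM, map_mul, hX, zero_sub, neg_mul, neg_inj] at h2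
  have h4 := congrArg Matrix.det h2
  rw [Matrix.det_mul] at h4
  have h5 : Φ (C P) = Matrix.scalar ι P := by
    simp only [Φ, aeval_C]
    rfl
  rw [h5, Matrix.scalar_apply, Matrix.det_diagonal, Finset.prod_const, Finset.card_univ] at h4
  exact ⟨_, h4⟩

theorem charpoly_dvd_pow [FiniteDimensional K V] (g : V →ₗ[K] V) (P : K[X]) (hP : aeval g P = 0) :
    g.charpoly ∣ P ^ Module.finrank K V := by
  let b := Module.finBasis K V
  rw [← LinearMap.charpoly_toMatrix g b]
  have := matrix_charpoly_dvd_pow (LinearMap.toMatrix b b g) P (by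
    have h1 : LinearMap.toMatrix b b g = LinearMap.toMatrixAlgEquiv b g := rfl
    rw [h1, aeval_algHom_apply (LinearMap.toMatrixAlgEquiv b), hP, map_zero])
  rwa [Fintype.card_fin] at this

theorem isCompl_ker_aeval (g : V →ₗ[K] V) (t Q : K[X]) (htQ : IsCoprime t Q)
    (h0 : aeval g (t * Q) = 0) :
    IsCompl (LinearMap.ker (aeval g t)) (LinearMap.ker (aeval g Q)) := by
  refine ⟨disjoint_ker_aeval_of_isCoprime g htQ, ?_⟩
  rw [codisjoint_iff, sup_ker_aeval_eq_ker_aeval_mul_of_coprime g htQ, h0, LinearMap.ker_zero]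

theorem apply_mem_ker_aeval (g : V →ₗ[K] V) (t : K[X]) :
    ∀ x ∈ LinearMap.ker (aeval g t), g x ∈ LinearMap.ker (aeval g t) := by
  intro x hx
  rw [LinearMap.mem_ker] at hx ⊢
  rw [← commute_aeval (φ := g) (fun _ => rfl), hx, map_zero]

theorem aeval_restrict_ker (g : V →ₗ[K] V) (t : K[X]) :
    aeval (g.restrict (apply_mem_ker_aeval g t)) t = 0 := by
  ext x
  rw [coe_aeval_restrict]
  exact x.2

/-- For semisimple `g` the dimension of the kernel of `t(g)` is given by the multiplicity of the
irreducible polynomial `t` in the characteristic polynomial. -/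
theorem finrank_ker_aeval [FiniteDimensional K V] (g : V →ₗ[K] V) (μ : K[X]) (hμ : Squarefree μ) (hμg : aeval g μ = 0)
    (t : K[X]) (ht : Irreducible t) (htm : t.Monic) (a : ℕ) (c : K[X])
    (hg : g.charpoly = t ^ a * c) (htc : IsCoprime t c) :
    Module.finrank K (LinearMap.ker (aeval g t)) = a * t.natDegree := by
  -- If `t` divides the squarefree `μ`, the cofactor is prime to `t`; otherwise `μ` itself serves.
  -- The second case also covers multiplicity `a = 0`.
  obtain ⟨Q, htQ, h0⟩ : ∃ Q, IsCoprime t Q ∧ aeval g (t * Q) = 0 := by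
    by_cases htμ : t ∣ μ
    · obtain ⟨Q, rfl⟩ := htμ
      refine ⟨Q, ?_, hμg⟩
      rw [ht.coprime_iff_not_dvd]
      rintro ⟨R, rfl⟩
      exact ht.not_isUnit (hμ t ⟨R, by ring⟩)
    · exact ⟨μ, ht.coprime_iff_not_dvd.mpr htμ, by rw [map_mul, hμg, mul_zero]⟩
  set W := LinearMap.ker (aeval g t) with hW
  set W' := LinearMap.ker (aeval g Q) with hW'
  have hc := isCompl_ker_aeval g t Q htQ h0
  let g₁ := g.restrict (apply_mem_ker_aeval g t)
  let g₂ := g.restrict (apply_mem_ker_aeval g Q)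
  let T := Submodule.prodEquivOfIsCompl W W' hc
  have hchar : g.charpoly = g₁.charpoly * g₂.charpoly := by
    rw [← LinearMap.charpoly_prodMap, ← LinearEquiv.charpoly_conj T]
    congr 1
    ext x
    obtain ⟨y, rfl⟩ := T.surjective x
    simp [LinearEquiv.conj_apply, T, g₁, g₂]
  -- The first factor of the characteristic polynomial is a power of `t` and the second is prime to
  -- `t`, so the first is exactly `t ^ a`.
  have h1 : g₁.charpoly ∣ t ^ Module.finrank K W := charpoly_dvd_pow g₁ t (aeval_restrict_ker g t)
  have h2 : g₂.charpoly ∣ Q ^ Module.finrank K W' := charpoly_dvd_pow g₂ Q (aeval_restrict_ker g Q)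
  obtain ⟨b, -, hb⟩ := (dvd_prime_pow ht.prime _).mp h1
  have hb' : g₁.charpoly = t ^ b :=
    eq_of_monic_of_associated (LinearMap.charpoly_monic g₁) (htm.pow b) hb
  have hcop : IsCoprime t g₂.charpoly := (htQ.pow_right).of_isCoprime_of_dvd_right h2
  rw [hg, hb'] at hchar
  have e1 : t ^ a ∣ t ^ b :=
    (hcop.pow_left).dvd_of_dvd_mul_right (Dvd.intro c hchar)
  have e2 : t ^ b ∣ t ^ a :=
    (htc.pow_left).dvd_of_dvd_mul_right (Dvd.intro _ hchar.symm)
  have e3 : t ^ b = t ^ a :=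
    eq_of_monic_of_associated (htm.pow b) (htm.pow a) (associated_of_dvd_dvd e2 e1)
  rw [← LinearMap.charpoly_natDegree g₁, hb', e3, natDegree_pow]

end Charpoly

/-! ### The dual polynomial in terms of coefficients. -/

section Dual

variable {K : Type*} [Field K]

/-- The monic polynomial whose roots are the inverses of the images under `σ` of the roots
of `f`. -/
def dualPoly (σ : K →+* K) (f : K[X]) : K[X] := C (σ (f.coeff 0))⁻¹ * (f.map σ).reverse

variable (σ : K →+* K)

theorem dualPoly_mul (f g : K[X]) : dualPoly σ (f * g) = dualPoly σ f * dualPoly σ g := by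
  unfold dualPoly
  rw [Polynomial.map_mul, reverse_mul_of_domain, mul_coeff_zero, map_mul, mul_inv, C_mul]
  ring

theorem dualPoly_one : dualPoly σ 1 = 1 := by
  unfold dualPoly
  rw [Polynomial.map_one, ← C_1, reverse_C, coeff_C_zero, map_one, inv_one, C_1, one_mul]

theorem reverse_map_ringHom {L : Type*} [Field L] (i : K →+* L) (f : K[X]) :
    (f.map i).reverse = f.reverse.map i := by
  rw [reverse, natDegree_map, reflect_map, reverse]

theorem dualPoly_map {L : Type*} [Field L] (i : K →+* L) (τ : L →+* L)
    (hi : ∀ x, i (σ x) = τ (i x)) (f : K[X]) : (dualPoly σ f).map i = dualPoly τ (f.map i) := by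
  have h1 : i.comp σ = τ.comp i := RingHom.ext hi
  unfold dualPoly
  rw [Polynomial.map_mul, map_C, map_inv₀, hi, coeff_map, ← reverse_map_ringHom, map_map, map_map,
    h1]

theorem dualPoly_X_sub_C (a : K) (ha : a ≠ 0) : dualPoly σ (X - C a) = X - C (σ a)⁻¹ := by
  have h0 : σ a ≠ 0 := by rwa [_root_.map_ne_zero]
  have h1 : (X - C (σ a)).reverse = 1 - C (σ a) * X := by
    rw [reverse, natDegree_X_sub_C, reflect_sub, reflect_one_X, reflect_C, pow_one]
  unfold dualPoly
  rw [Polynomial.map_sub, map_X, map_C, h1, coeff_sub, coeff_X_zero, coeff_C_zero, zero_sub,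
    map_neg, inv_neg, C_neg, mul_sub, ← mul_assoc, neg_mul, neg_mul, neg_mul, ← C_mul,
    inv_mul_cancel₀ h0]
  simp only [mul_one, C_1, one_mul]
  ring

variable {σ} {f : K[X]}

theorem natTrailingDegree_map_eq_zero (hf : f.coeff 0 ≠ 0) : (f.map σ).natTrailingDegree = 0 := by
  rw [natTrailingDegree_eq_zero]
  right
  rwa [coeff_map, _root_.map_ne_zero]

theorem natDegree_dualPoly (hf : f.coeff 0 ≠ 0) : (dualPoly σ f).natDegree = f.natDegree := by
  unfold dualPoly
  rw [natDegree_C_mul (inv_ne_zero (by rwa [_root_.map_ne_zero])), reverse_natDegree,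
    natTrailingDegree_map_eq_zero hf, natDegree_map, Nat.sub_zero]

theorem dualPoly_monic (hf : f.coeff 0 ≠ 0) : (dualPoly σ f).Monic := by
  have h0 : σ (f.coeff 0) ≠ 0 := by rwa [_root_.map_ne_zero]
  unfold dualPoly
  rw [Monic, leadingCoeff_mul, leadingCoeff_C, reverse_leadingCoeff, trailingCoeff,
    natTrailingDegree_map_eq_zero hf, coeff_map, inv_mul_cancel₀ h0]

theorem coeff_zero_dualPoly (hm : f.Monic) :
    (dualPoly σ f).coeff 0 = (σ (f.coeff 0))⁻¹ := by
  unfold dualPoly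
  rw [mul_coeff_zero, coeff_C_zero, coeff_zero_reverse, (hm.map σ).leadingCoeff, mul_one]

theorem dualPoly_coeff_ne_zero (hm : f.Monic) (hf : f.coeff 0 ≠ 0) :
    (dualPoly σ f).coeff 0 ≠ 0 := by
  rw [coeff_zero_dualPoly hm]
  exact inv_ne_zero (by rwa [_root_.map_ne_zero])

theorem reverse_reverse (hf : f.coeff 0 ≠ 0) : f.reverse.reverse = f := by
  have h1 : f.natTrailingDegree = 0 := natTrailingDegree_eq_zero.mpr (Or.inr hf)
  have h2 : f.reverse.natDegree = f.natDegree := by rw [reverse_natDegree, h1, Nat.sub_zero]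
  rw [reverse, h2, reverse, reflect_reflect]

theorem dualPoly_dualPoly (hσ : ∀ x, σ (σ x) = x) (hm : f.Monic) (hf : f.coeff 0 ≠ 0) :
    dualPoly σ (dualPoly σ f) = f := by
  have h1 : σ.comp σ = RingHom.id K := RingHom.ext hσ
  conv_lhs => unfold dualPoly
  rw [show C (σ (f.coeff 0))⁻¹ * (f.map σ).reverse = dualPoly σ f from rfl,
    coeff_zero_dualPoly hm, map_inv₀ σ, hσ, inv_inv]
  unfold dualPoly
  rw [Polynomial.map_mul, map_C, map_inv₀ σ, hσ, ← reverse_map_ringHom, map_map, h1, map_id,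
    reverse_mul_of_domain, reverse_C, reverse_reverse hf, ← mul_assoc, ← C_mul,
    mul_inv_cancel₀ hf, C_1, one_mul]

/-- Duality is multiplicative, involutive on these polynomials and preserves degrees, so a
factorization of the dual dualizes to one of `f`. -/
theorem dualPoly_irreducible (hσ : ∀ x, σ (σ x) = x) (hm : f.Monic) (hf : f.coeff 0 ≠ 0)
    (hirr : Irreducible f) : Irreducible (dualPoly σ f) := by
  have hd := natDegree_dualPoly (σ := σ) hf
  have h0 : dualPoly σ f ≠ 0 := (dualPoly_monic hf).ne_zero
  refine ⟨fun hu => ?_, fun a b hab => ?_⟩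
  · have := natDegree_eq_zero_of_isUnit hu
    rw [hd] at this
    exact hirr.natDegree_pos.ne' this
  · have hc := dualPoly_coeff_ne_zero (σ := σ) hm hf
    rw [hab, mul_coeff_zero] at hc
    have h1 := dualPoly_dualPoly hσ hm hf
    rw [hab, dualPoly_mul] at h1
    have hunit : ∀ c : K[X], c.coeff 0 ≠ 0 → IsUnit (dualPoly σ c) → IsUnit c := by
      intro c hc0 hu
      have h2 := natDegree_eq_zero_of_isUnit hu
      rw [natDegree_dualPoly hc0] at h2
      rw [eq_C_of_natDegree_eq_zero h2]
      exact isUnit_C.mpr (isUnit_iff_ne_zero.mpr hc0)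
    rcases hirr.isUnit_or_isUnit h1.symm with h | h
    · exact Or.inl (hunit a (left_ne_zero_of_mul hc) h)
    · exact Or.inr (hunit b (right_ne_zero_of_mul hc) h)

/-- Connects the definition by roots with the one by coefficients. `dualPoly` is multiplicative and
compatible with field extension, so over the splitting field it suffices to treat linear factors. -/
theorem isDual_iff {p k : ℕ} [Fact p.Prime] [CharP K p] (hm : f.Monic) (hf : f.coeff 0 ≠ 0)
    (f' : K[X]) : IsDual (p ^ k) f f' ↔ f' = dualPoly (iterateFrobenius K p k) f := by
  set S := f.SplittingField
  have : CharP S p := charP_of_injective_algebraMap (algebraMap K S).injective p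
  have hmap : (dualPoly (iterateFrobenius K p k) f).map (algebraMap K S) =
      C (algebraMap K S f.leadingCoeff) *
        ((f.aroots S).map fun α => X - C (α⁻¹ ^ p ^ k)).prod := by
    rw [dualPoly_map _ (algebraMap K S) (iterateFrobenius S p k) (fun x => by
      simp [iterateFrobenius_def]), hm.leadingCoeff, map_one, C_1, one_mul]
    have hsplit : (f.map (algebraMap K S)).Splits := SplittingField.splits f
    have hprod : f.map (algebraMap K S) = ((f.aroots S).map fun α => X - C α).prod :=
      hsplit.eq_prod_roots_of_monic (hm.map _)
    have hne : ∀ α ∈ f.aroots S, α ≠ 0 := by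
      rintro α hα rfl
      rw [mem_aroots] at hα
      apply hf
      have h1 := hα.2
      rw [← coeff_zero_eq_aeval_zero'] at h1
      exact (algebraMap K S).injective (by rw [h1, map_zero])
    rw [hprod]
    generalize f.aroots S = s at hne
    induction s using Multiset.induction_on with
    | empty => simp [dualPoly_one]
    | cons a s ih =>
      rw [Multiset.map_cons, Multiset.prod_cons, dualPoly_mul,
        dualPoly_X_sub_C _ a (hne a (Multiset.mem_cons_self a s)),
        ih fun α hα => hne α (Multiset.mem_cons_of_mem hα), Multiset.map_cons, Multiset.prod_cons,
        iterateFrobenius_def, inv_pow]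
  unfold IsDual
  rw [← hmap]
  exact (Polynomial.map_injective _ (algebraMap K S).injective).eq_iff

end Dual

/-! ### Adjoints of polynomials in an isometry. -/

section Adjoint

variable {K V : Type*} [Field K] [AddCommGroup V] [Module K V] {q : ℕ} {h : V → V → K}
  {σ : K →+* K} {g : V →ₗ[K] V}

theorem isometry_pow (hg : ∀ u v, h (g u) (g v) = h u v) (n : ℕ) (u v : V) :
    h ((g ^ n) u) ((g ^ n) v) = h u v := by
  induction n with
  | zero => rfl
  | succ n ih => rw [pow_succ', Module.End.mul_apply, Module.End.mul_apply, hg, ih]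

/-- For a monomial `c * X ^ n` the isometry cancels `g ^ n` on both sides, leaving `g ^ (N - n)`,
and `c` moves to the right as `σ c`. -/
theorem IsHerm.aeval_reflect (hh : IsHerm q h) (hσq : ∀ x, σ x = x ^ q) (hσ : ∀ x, σ (σ x) = x)
    (hg : ∀ u v, h (g u) (g v) = h u v) (N : ℕ) (f : K[X]) (hN : f.natDegree ≤ N) :
    ∀ u v, h (aeval g f u) ((g ^ N) v) = h u (aeval g (reflect N (f.map σ)) v) := by
  refine Polynomial.induction_with_natDegree_le
    (motive := fun f => ∀ u v, h (aeval g f u) ((g ^ N) v) = h u (aeval g (reflect N (f.map σ)) v))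
    N ?_ ?_ ?_ f hN
  · intro u v
    simp [hh.zero_left, hh.zero_right]
  · intro n c _ hn u v
    rw [Polynomial.map_mul, map_C, Polynomial.map_pow, map_X, reflect_C_mul_X_pow, revAt_le hn]
    simp only [map_mul, aeval_C, map_pow, aeval_X, Module.End.mul_apply,
      Module.algebraMap_end_apply]
    rw [hh.smul_left, hh.smul_right, ← hσq, hσ]
    obtain ⟨m, rfl⟩ := Nat.exists_eq_add_of_le hn
    rw [pow_add, Module.End.mul_apply, isometry_pow hg, Nat.add_sub_cancel_left]
  · intro f₁ f₂ _ _ h1 h2 u v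
    rw [map_add, LinearMap.add_apply, hh.add_left, h1, h2, Polynomial.map_add, reflect_add,
      map_add, LinearMap.add_apply, hh.add_right]

theorem IsHerm.aeval_dualPoly (hh : IsHerm q h) (hσq : ∀ x, σ x = x ^ q) (hσ : ∀ x, σ (σ x) = x)
    (hg : ∀ u v, h (g u) (g v) = h u v) (f : K[X]) (hf : f.coeff 0 ≠ 0) (u v : V) :
    h (aeval g f u) ((g ^ f.natDegree) v) = f.coeff 0 * h u (aeval g (dualPoly σ f) v) := by
  have h0 : σ (f.coeff 0) ≠ 0 := by rwa [_root_.map_ne_zero]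
  have h1 : reflect f.natDegree (f.map σ) = C (σ (f.coeff 0)) * dualPoly σ f := by
    unfold dualPoly
    rw [← mul_assoc, ← C_mul, mul_inv_cancel₀ h0, C_1, one_mul, reverse, natDegree_map]
  rw [hh.aeval_reflect hσq hσ hg _ f le_rfl, h1, map_mul, aeval_C, Module.End.mul_apply,
    Module.algebraMap_end_apply, hh.smul_right, ← hσq, hσ]

/-- By Bézout the dual of `f`, evaluated at `g`, is invertible on the kernel of `t(g)`. So `y` is in
its image, and taking adjoints moves `f(g)` onto `x`, which it kills. -/
theorem IsHerm.orthogonal_ker (hh : IsHerm q h) (hσq : ∀ x, σ x = x ^ q) (hσ : ∀ x, σ (σ x) = x)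
    (hg : ∀ u v, h (g u) (g v) = h u v) (f t : K[X]) (hf : f.coeff 0 ≠ 0)
    (hft : IsCoprime (dualPoly σ f) t) (x y : V) (hx : aeval g f x = 0) (hy : aeval g t y = 0) :
    h x y = 0 := by
  obtain ⟨a, b, hab⟩ := hft
  have h1 : y = aeval g (dualPoly σ f) (aeval g a y) := by
    have h2 := LinearMap.congr_fun (congrArg (aeval g) hab) y
    rw [map_add, map_mul, map_mul, map_one, LinearMap.add_apply, Module.End.mul_apply,
      Module.End.mul_apply, hy, map_zero, add_zero] at h2
    rw [← Module.End.mul_apply, ← map_mul, mul_comm, map_mul, Module.End.mul_apply, h2]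
    rfl
  have h3 := hh.aeval_dualPoly hσq hσ hg f hf x (aeval g a y)
  rw [← h1, hx, hh.zero_left] at h3
  exact (mul_eq_zero.mp h3.symm).resolve_left hf

variable [Finite K] [FiniteDimensional K V]

/-- Every linear functional is represented by a vector. -/
theorem IsHerm.exists_eq_dual (hh : IsHerm q h) (hq : q ≠ 0) (hnd : ∀ u, (∀ v, h u v = 0) → u = 0)
    (ℓ : Module.Dual K V) : ∃ v, ∀ u, ℓ u = h u v := by
  let D : V → Module.Dual K V := fun v =>
    { toFun := fun u => h u v
      map_add' := fun x y => hh.add_left x y v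
      map_smul' := fun c x => hh.smul_left c x v }
  have hinj : Function.Injective D := by
    intro v w hvw
    rw [← sub_eq_zero]
    refine hnd _ fun u => hh.eq_zero_comm hq ?_
    rw [hh.sub_right, sub_eq_zero]
    exact LinearMap.congr_fun hvw u
  have hcard : Nat.card (Module.Dual K V) ≤ Nat.card V := by
    have : Finite (Module.Dual K V) := Module.finite_of_finite K
    rw [Module.natCard_eq_pow_finrank (K := K) (V := Module.Dual K V), Subspace.dual_finrank_eq,
      ← Module.natCard_eq_pow_finrank (K := K)]
  have : Finite (Module.Dual K V) := Module.finite_of_finite K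
  -- The map `v ↦ h · v` is only semilinear, so its bijectivity is obtained by counting elements.
  have hbij := hinj.bijective_of_nat_card_le hcard
  obtain ⟨v, hv⟩ := hbij.2 ℓ
  exact ⟨v, fun u => (LinearMap.congr_fun hv u).symm⟩

/-- Nondegenerate Hermitian forms separate vectors from subspaces. -/
theorem IsHerm.exists_separating (hh : IsHerm q h) (hq : q ≠ 0)
    (hnd : ∀ u, (∀ v, h u v = 0) → u = 0) (U : Submodule K V) (x : V) (hx : x ∉ U) :
    ∃ v, (∀ u ∈ U, h v u = 0) ∧ h v x ≠ 0 := by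
  obtain ⟨ℓ, hℓx, hℓU⟩ := Submodule.exists_le_ker_of_notMem hx
  obtain ⟨v, hv⟩ := hh.exists_eq_dual hq hnd ℓ
  refine ⟨v, fun u hu => hh.eq_zero_comm hq ?_, fun h0 => hℓx ?_⟩
  · rw [← hv]
    exact hℓU hu
  · rw [hv]
    exact hh.eq_zero_comm hq h0

/-- With `d = deg f`, the map `v ↦ h · (g ^ d v)` identifies the kernel of the dual with the
annihilator of the image of `f(g)`, whose dimension is that of the kernel of `f(g)`. This forces
dual factors to occur with equal multiplicity. -/
theorem IsHerm.finrank_ker_dualPoly (hh : IsHerm q h) (hq : q ≠ 0)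
    (hnd : ∀ u, (∀ v, h u v = 0) → u = 0) (hσq : ∀ x, σ x = x ^ q) (hσ : ∀ x, σ (σ x) = x)
    (hg : ∀ u v, h (g u) (g v) = h u v) (f : K[X]) (hf : f.coeff 0 ≠ 0) :
    Module.finrank K (LinearMap.ker (aeval g (dualPoly σ f))) =
      Module.finrank K (LinearMap.ker (aeval g f)) := by
  have hginj : Function.Injective g := by
    rw [injective_iff_map_eq_zero]
    intro u hu
    refine hnd u fun v => ?_
    rw [← hg, hu, hh.zero_left]
  have hgsurj : Function.Surjective (g ^ f.natDegree) := by
    rw [Module.End.coe_pow]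
    exact (LinearMap.surjective_of_injective hginj).iterate _
  have hD : ∀ v, v ∈ LinearMap.ker (aeval g (dualPoly σ f)) ↔
      ∀ u ∈ LinearMap.range (aeval g f), h u ((g ^ f.natDegree) v) = 0 := by
    intro v
    constructor
    · rintro hv _ ⟨u, rfl⟩
      rw [hh.aeval_dualPoly hσq hσ hg f hf, LinearMap.mem_ker.mp hv, hh.zero_right, mul_zero]
    · intro hv
      refine hnd _ fun u => hh.eq_zero_comm hq ?_
      have h1 := hv _ (LinearMap.mem_range_self (aeval g f) u)
      rw [hh.aeval_dualPoly hσq hσ hg f hf] at h1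
      exact (mul_eq_zero.mp h1).resolve_left hf
  have hcard : Nat.card (LinearMap.ker (aeval g (dualPoly σ f))) =
      Nat.card (LinearMap.range (aeval g f)).dualAnnihilator := by
    refine Nat.card_eq_of_bijective (fun v => ⟨
      { toFun := fun u => h u ((g ^ f.natDegree) v)
        map_add' := fun x y => hh.add_left x y _
        map_smul' := fun c x => hh.smul_left c x _ }, ?_⟩) ⟨?_, ?_⟩
    · rw [Submodule.mem_dualAnnihilator]
      exact (hD v).mp v.2
    · intro v w hvw
      refine Subtype.ext ?_
      have h1 : Function.Injective (g ^ f.natDegree) := by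
        rw [Module.End.coe_pow]
        exact hginj.iterate _
      apply h1
      rw [← sub_eq_zero]
      refine hnd _ fun u => hh.eq_zero_comm hq ?_
      rw [hh.sub_right, sub_eq_zero]
      exact LinearMap.congr_fun (congrArg Subtype.val hvw) u
    · rintro ⟨ℓ, hℓ⟩
      obtain ⟨w, hw⟩ := hh.exists_eq_dual hq hnd ℓ
      obtain ⟨v, rfl⟩ := hgsurj w
      rw [Submodule.mem_dualAnnihilator] at hℓ
      refine ⟨⟨v, (hD v).mpr fun u hu => ?_⟩, Subtype.ext (LinearMap.ext fun u => (hw u).symm)⟩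
      rw [← hw]
      exact hℓ u hu
  have h1 := Subspace.finrank_add_finrank_dualAnnihilator_eq (LinearMap.range (aeval g f))
  have h2 := LinearMap.finrank_range_add_finrank_ker (aeval g f)
  rw [Module.natCard_eq_pow_finrank (K := K) (V := LinearMap.ker _),
    Module.natCard_eq_pow_finrank (K := K) (V := Submodule.dualAnnihilator _)] at hcard
  have h3 := Nat.pow_right_injective (Finite.one_lt_card (α := K)) hcard
  omega

end Adjoint

/-! ### Change of base field. -/

/-- Invariance under additive bijections that match groups and subspaces; the base fields may
be different. -/
theorem eqEuler_congr_addEquiv {K V K' V' : Type*} [Field K] [AddCommGroup V] [Module K V]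
    [FiniteDimensional K V] [Field K'] [AddCommGroup V'] [Module K' V'] [FiniteDimensional K' V']
    (r : ℕ) (T : V ≃+ V') {H : Subgroup (V ≃ₗ[K] V)} {H' : Subgroup (V' ≃ₗ[K'] V')}
    {P : Set (Submodule K V)} {P' : Set (Submodule K' V')}
    (h₁ : ∀ φ ∈ H, ∃ φ' ∈ H', ∀ v, φ' (T v) = T (φ v))
    (h₂ : ∀ φ' ∈ H', ∃ φ ∈ H, ∀ v, φ' (T v) = T (φ v))
    (h₃ : ∀ U ∈ P, ∃ U' ∈ P', ∀ v, T v ∈ U' ↔ v ∈ U)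
    (h₄ : ∀ U' ∈ P', ∃ U ∈ P, ∀ v, T v ∈ U' ↔ v ∈ U) :
    eqEuler r H P = eqEuler r H' P' := by
  choose e he using fun φ : H => h₁ φ φ.2
  have hext : ∀ φ ψ : V' ≃ₗ[K'] V', (∀ v, φ (T v) = ψ (T v)) → φ = ψ := fun φ ψ h => by
    ext x
    obtain ⟨v, rfl⟩ := T.surjective x
    exact h v
  let e' : H →* H' := MonoidHom.mk' (fun φ => ⟨e φ, (he φ).1⟩) (fun φ ψ => by
    refine Subtype.ext (hext _ _ fun v => ?_)
    simp only [Subgroup.coe_mul, LinearEquiv.mul_apply, (he _).2])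
  have he' : ∀ (φ : H) v, (e' φ : V' ≃ₗ[K'] V') (T v) = T (φ.1 v) := fun φ => (he φ).2
  have hbij : Function.Bijective e' := by
    constructor
    · intro φ ψ h
      refine Subtype.ext (LinearEquiv.ext fun v => T.injective ?_)
      rw [← he', ← he', h]
    · rintro ⟨φ', hφ'⟩
      obtain ⟨φ, hφ, h⟩ := h₂ φ' hφ'
      exact ⟨⟨φ, hφ⟩, Subtype.ext (hext _ _ fun v => by rw [he', h])⟩
  -- The span only makes `f` total: for `U` in `P` the image is already a `K'`-subspace.
  let f : Submodule K V → Submodule K' V' := fun U => Submodule.span K' (T '' U)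
  have hf : ∀ U ∈ P, f U ∈ P' ∧ ∀ v, T v ∈ f U ↔ v ∈ U := by
    intro U hU
    obtain ⟨U', hU', h⟩ := h₃ U hU
    have h1 : T '' U = U' := by
      ext x
      obtain ⟨v, rfl⟩ := T.surjective x
      rw [T.injective.mem_set_image, SetLike.mem_coe, SetLike.mem_coe, h]
    have h2 : f U = U' := by
      simp only [f]
      rw [h1, Submodule.span_eq]
    rw [h2]
    exact ⟨hU', h⟩
  refine eqEuler_congr r (MulEquiv.ofBijective e' hbij) f ?_ ?_ ?_
  · intro U hU U' hU'
    constructor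
    · intro h v hv
      rw [← (hf U' hU').2]
      exact h (((hf U hU).2 v).mpr hv)
    · intro h x hx
      obtain ⟨v, rfl⟩ := T.surjective x
      rw [(hf U hU).2] at hx
      rw [(hf U' hU').2]
      exact h hx
  · ext U'
    constructor
    · rintro ⟨U, hU, rfl⟩
      exact (hf U hU).1
    · intro hU'
      obtain ⟨U, hU, h⟩ := h₄ U' hU'
      refine ⟨U, hU, Submodule.ext fun x => ?_⟩
      obtain ⟨v, rfl⟩ := T.surjective x
      rw [(hf U hU).2, h]
  · intro φ U hU
    rw [smul_eq_self_iff, smul_eq_self_iff]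
    constructor
    · intro h x hx
      obtain ⟨v, rfl⟩ := T.surjective x
      rw [(hf U hU).2] at hx
      change (e' φ : V' ≃ₗ[K'] V') (T v) ∈ f U
      rw [he', (hf U hU).2]
      exact h v hx
    · intro h v hv
      have h1 : (e' φ : V' ≃ₗ[K'] V') (T v) ∈ f U := h _ (((hf U hU).2 v).mpr hv)
      rwa [he', (hf U hU).2] at h1

section Extension

variable {K : Type*} [Field K] [Finite K] {p : ℕ} [Fact p.Prime] [CharP K p]

/-- The extension of a finite field by a root of an irreducible polynomial as a Galois field. -/
theorem exists_galoisField_root {e : ℕ} (hK : Nat.card K = p ^ e) (he : 0 < e) {ρ : K[X]}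
    (hρ : Irreducible ρ) {N : ℕ} (hN : N = e * ρ.natDegree) :
    ∃ (i : K →+* GaloisField p N) (α : GaloisField p N), eval₂ i α ρ = 0 ∧
      Function.Surjective (eval₂ i α) ∧ ∀ P, eval₂ i α P = 0 → ρ ∣ P := by
  have : Fact (Irreducible ρ) := ⟨hρ⟩
  let F := AdjoinRoot ρ
  let pb := AdjoinRoot.powerBasis hρ.ne_zero
  have hfd : FiniteDimensional K F := pb.finite
  have hfin : Finite F := Module.finite_of_finite K
  have hd : Module.finrank K F = ρ.natDegree := by
    rw [pb.finrank, AdjoinRoot.powerBasis_dim]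
  have hcard : Nat.card F = Nat.card (GaloisField p N) := by
    rw [Module.natCard_eq_pow_finrank (K := K), hd, hK, GaloisField.card p N, hN, pow_mul]
    rw [hN]
    exact (Nat.mul_pos he hρ.natDegree_pos).ne'
  have := Fintype.ofFinite F
  have := Fintype.ofFinite (GaloisField p N)
  have : CharP F p := charP_of_injective_algebraMap (algebraMap K F).injective p
  let E : F ≃+* GaloisField p N := FiniteField.ringEquivOfCardEq (by
    rw [← Nat.card_eq_fintype_card, ← Nat.card_eq_fintype_card, hcard])
  have key : ∀ P : K[X], eval₂ ((E : F →+* GaloisField p N).comp (AdjoinRoot.of ρ))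
      (E (AdjoinRoot.root ρ)) P = E (AdjoinRoot.mk ρ P) := by
    intro P
    have h1 := hom_eval₂ P (AdjoinRoot.of ρ) (E : F →+* GaloisField p N) (AdjoinRoot.root ρ)
    refine h1.symm.trans (congrArg E ?_)
    rw [← AdjoinRoot.aeval_eq, aeval_def]
    rfl
  refine ⟨(E : F →+* GaloisField p N).comp (AdjoinRoot.of ρ), E (AdjoinRoot.root ρ), ?_, ?_, ?_⟩
  · rw [key, AdjoinRoot.mk_self, map_zero]
  · intro x
    obtain ⟨y, rfl⟩ := E.surjective x
    obtain ⟨P, rfl⟩ := AdjoinRoot.mk_surjective y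
    exact ⟨P, key P⟩
  · intro P hP
    rw [key, map_eq_zero_iff E E.injective, AdjoinRoot.mk_eq_zero] at hP
    exact hP

/-- The universal property of `F = K[X]/(ρ)`. The target `R` need not be commutative: it is `F`
itself when the involution is built, and `End V` when `F` is made to act on `V`. -/
theorem exists_ringHom_of_root {K F R : Type*} [Field K] [Field F] [Ring R]
    {i : K →+* F} {α : F} {ρ : K[X]}
    (hsurj : Function.Surjective (eval₂ i α)) (hker : ∀ P, eval₂ i α P = 0 → ρ ∣ P)
    (Ψ : K[X] →+* R) (hΨ : Ψ ρ = 0) : ∃ θ : F →+* R, ∀ P, θ (eval₂ i α P) = Ψ P := by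
  let θ := (eval₂RingHom i α).liftOfSurjective hsurj ⟨Ψ, fun P hP => by
    obtain ⟨Q, rfl⟩ := hker P hP
    rw [RingHom.mem_ker, map_mul, hΨ, zero_mul]⟩
  refine ⟨θ, fun P => ?_⟩
  exact RingHom.liftOfRightInverse_comp_apply (eval₂RingHom i α) _ _ ⟨Ψ, _⟩ P

variable {k : ℕ}

theorem exists_pow_ne_self {K : Type*} [Field K] [Finite K] {p k : ℕ} [Fact p.Prime] (hk : 0 < k)
    (hK : Nat.card K = (p ^ k) ^ 2) : ∃ a : K, a ^ p ^ k ≠ a := by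
  have := Fintype.ofFinite K
  have hq1 : 1 < p ^ k := Nat.one_lt_pow hk.ne' (Fact.out : p.Prime).one_lt
  by_contra! hall
  have hne : (X ^ p ^ k - X : K[X]) ≠ 0 := FiniteField.X_pow_card_sub_X_ne_zero K hq1
  have h1 : Fintype.card K ≤ (X ^ p ^ k - X : K[X]).natDegree :=
    Polynomial.card_le_degree_of_subset_roots (p := X ^ p ^ k - X) (Z := Finset.univ) (by
      intro x _
      rw [Polynomial.mem_roots hne]
      simp [hall x])
  rw [FiniteField.X_pow_card_sub_X_natDegree_eq K hq1, ← Nat.card_eq_fintype_card, hK] at h1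
  nlinarith

/-- For a self-dual irreducible polynomial the involution of the extension field which extends the
`q`-power map and inverts the root is a power map. -/
theorem eval₂_pow_eq (hk : 0 < k) (hK : Nat.card K = (p ^ k) ^ 2) {ρ : K[X]}
    (hρ : Irreducible ρ) (hρ0 : ρ.coeff 0 ≠ 0)
    (hdual : dualPoly (iterateFrobenius K p k) ρ = ρ)
    {i : K →+* GaloisField p (2 * (k * ρ.natDegree))} {α : GaloisField p (2 * (k * ρ.natDegree))}
    (hroot : eval₂ i α ρ = 0) (hsurj : Function.Surjective (eval₂ i α))
    (hker : ∀ P, eval₂ i α P = 0 → ρ ∣ P) :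
    α ≠ 0 ∧ ∀ P : K[X], eval₂ i α P ^ p ^ (k * ρ.natDegree) =
      eval₂ i α⁻¹ (P.map (iterateFrobenius K p k)) := by
  set σ := iterateFrobenius K p k with hσdef
  have hσ : ∀ x, σ (σ x) = x := fun x => by
    rw [hσdef, iterateFrobenius_def, iterateFrobenius_def, pow_pow_eq_self hK]
  have hα : α ≠ 0 := by
    rintro rfl
    rw [eval₂_at_zero] at hroot
    exact hρ0 (i.injective (by rw [hroot, map_zero]))
  refine ⟨hα, ?_⟩
  -- Since `ρ` is its own dual, `α` is a root of the reverse of `ρ.map σ`, so `α⁻¹` is a root of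
  -- `ρ.map σ`.
  have hroot' : eval₂ i α⁻¹ (ρ.map σ) = 0 := by
    let _ : Invertible α⁻¹ := invertibleOfNonzero (inv_ne_zero hα)
    have hc : i (σ (ρ.coeff 0))⁻¹ ≠ 0 := by
      simpa using hρ0
    rw [← eval₂_reverse_eq_zero_iff, invOf_eq_inv, inv_inv]
    have h1 := (congrArg (eval₂ i α) hdual).trans hroot
    rw [dualPoly, eval₂_mul, eval₂_C] at h1
    exact (mul_eq_zero.mp h1).resolve_left hc
  obtain ⟨τ, hτ⟩ := exists_ringHom_of_root (R := GaloisField p (2 * (k * ρ.natDegree))) hsurj hker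
    ((eval₂RingHom i α⁻¹).comp (mapRingHom σ)) hroot'
  simp only [RingHom.comp_apply, coe_mapRingHom, coe_eval₂RingHom] at hτ
  have hτα : τ α = α⁻¹ := by simpa using hτ X
  have hτi : ∀ c, τ (i c) = i (σ c) := fun c => by simpa using hτ (C c)
  have hτ2 : ∀ x, τ (τ x) = x := by
    intro x
    obtain ⟨P, rfl⟩ := hsurj x
    have h1 : (τ.comp i).comp σ = i := RingHom.ext fun c => by simp [hτi, hσ]
    rw [hτ, hom_eval₂, map_inv₀, hτα, inv_inv, eval₂_map, h1]
  have hτ1 : τ ≠ RingHom.id _ := by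
    intro h1
    obtain ⟨c, hc⟩ := exists_pow_ne_self hk hK
    apply hc
    apply i.injective
    have := hτi c
    rw [h1] at this
    exact this.symm
  have hN : 0 < k * ρ.natDegree := Nat.mul_pos hk hρ.natDegree_pos
  let τ' : GaloisField p (2 * (k * ρ.natDegree)) →ₐ[ZMod p] GaloisField p (2 * (k * ρ.natDegree)) :=
    { τ with commutes' := fun x =>
        RingHom.congr_fun (Subsingleton.elim (τ.comp (algebraMap (ZMod p) _)) (algebraMap _ _)) x }
  -- Here `τ` extends `σ` and inverts `α`, hence is an involution, and it is nontrivial because `σ`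
  -- is. The automorphisms form a cyclic group of order `2 * (k * deg ρ)` generated by Frobenius,
  -- whose only element of order two is the power with exponent `k * deg ρ`.
  obtain ⟨⟨j, hj⟩, hjτ⟩ := (FiniteField.bijective_frobeniusAlgHom_pow (ZMod p)
    (GaloisField p (2 * (k * ρ.natDegree)))).2 τ'
  have hfr := GaloisField.finrank p (n := 2 * (k * ρ.natDegree)) (by omega)
  have hord := FiniteField.orderOf_frobeniusAlgHom (ZMod p) (GaloisField p (2 * (k * ρ.natDegree)))
  have hττ : τ' * τ' = 1 := AlgHom.ext hτ2
  simp only at hjτ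
  rw [← hjτ, ← pow_add] at hττ
  have hdvd := orderOf_dvd_of_pow_eq_one hττ
  rw [hord, hfr] at hdvd
  rw [hfr] at hj
  have hj0 : j ≠ 0 := by
    rintro rfl
    apply hτ1
    ext x
    rw [pow_zero] at hjτ
    exact (AlgHom.congr_fun hjτ x).symm
  have hjeq : j = k * ρ.natDegree := by
    obtain ⟨c, hc⟩ := hdvd
    have h1 : j = k * ρ.natDegree * c := by
      have : 2 * j = 2 * (k * ρ.natDegree * c) := by rw [← mul_assoc, ← hc]; ring
      omega
    rcases c with _ | _ | c
    · omega
    · omega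
    · exfalso
      have : k * ρ.natDegree * (c + 1 + 1) = 2 * (k * ρ.natDegree) + k * ρ.natDegree * c := by ring
      omega
  intro P
  rw [← hτ]
  have h1 := AlgHom.congr_fun hjτ (eval₂ i α P)
  rw [AlgHom.coe_pow, FiniteField.coe_frobeniusAlgHom, pow_iterate, ZMod.card] at h1
  exact (congrArg (fun m => eval₂ i α P ^ p ^ m) hjeq.symm).trans h1

end Extension

/-! ### Hermitian forms as traces of Hermitian forms over an extension. -/

section Lift

variable {K F V : Type*} [Field K] [Field F] [Finite F] [Algebra K F] [AddCommGroup V] [Module K V]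
  [Module F V] [IsScalarTower K F V] {h : V → V → K} {q Q : ℕ}

theorem trace_mul_injective {x y : F}
    (hxy : ∀ c, Algebra.trace K F (c * x) = Algebra.trace K F (c * y)) : x = y := by
  have := Finite.of_injective _ (FaithfulSMul.algebraMap_injective K F)
  rw [← sub_eq_zero]
  refine (traceForm_nondegenerate K F).1 _ fun c => ?_
  rw [Algebra.traceForm_apply, mul_comm, mul_sub, map_sub, hxy, sub_self]

theorem exists_trace_mul_eq (ℓ : F →ₗ[K] K) : ∃ x, ∀ c, Algebra.trace K F (c * x) = ℓ c := by
  have := Finite.of_injective _ (FaithfulSMul.algebraMap_injective K F)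
  refine ⟨(LinearMap.BilinForm.toDual _ (traceForm_nondegenerate K F)).symm ℓ, fun c => ?_⟩
  rw [mul_comm, ← Algebra.traceForm_apply, LinearMap.BilinForm.apply_toDual_symm_apply]

/-- A Hermitian form over `K` for which the scalars from `F` are adjoint to their `Q`-powers
is the trace of a Hermitian form over `F`. -/
theorem IsHerm.exists_lift (hh : IsHerm q h) (hadj : ∀ (c : F) u v, h (c • u) v = h u (c ^ Q • v))
    (hQ : ∀ c : F, (c ^ Q) ^ Q = c)
    (htr : ∀ x, Algebra.trace K F (x ^ Q) = Algebra.trace K F x ^ q) :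
    ∃ H : V → V → F, IsHerm Q H ∧ ∀ (c : F) u v, Algebra.trace K F (c * H u v) = h (c • u) v := by
  -- By nondegeneracy of the trace form, `H u v` is the unique element that represents the
  -- functional `c ↦ h (c • u) v`; identities for `H` are tested against all `c`.
  choose H hH using fun u v : V => exists_trace_mul_eq (K := K) (F := F)
    { toFun := fun c => h (c • u) v
      map_add' := fun c d => by rw [add_smul, hh.add_left]
      map_smul' := fun a c => by rw [smul_assoc, hh.smul_left]; rfl }
  have hH' : ∀ (c : F) u v, Algebra.trace K F (c * H u v) = h (c • u) v := fun c u v => hH u v c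
  have hsymm : ∀ u v, H v u = H u v ^ Q := by
    intro u v
    refine trace_mul_injective (K := K) fun c => ?_
    have h1 : c * H u v ^ Q = (c ^ Q * H u v) ^ Q := by rw [mul_pow, hQ]
    rw [h1, htr, hH', hH', hadj, hh.symm]
  have hsmul : ∀ (c : F) u v, H (c • u) v = c * H u v := by
    intro c u v
    refine trace_mul_injective (K := K) fun d => ?_
    rw [hH', ← mul_assoc, hH', mul_smul]
  refine ⟨H, ⟨?_, hsmul, ?_, ?_, hsymm⟩, hH'⟩
  · intro u v w
    refine trace_mul_injective (K := K) fun c => ?_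
    rw [mul_add, map_add, hH', hH', hH', smul_add, hh.add_left]
  · intro u v w
    refine trace_mul_injective (K := K) fun c => ?_
    rw [mul_add, map_add, hH', hH', hH', hh.add_right]
  · intro c u v
    rw [hsymm (c • v) u, hsmul, mul_pow, ← hsymm]

end Lift

/-! ### Self-dual irreducible factors. -/

section SelfDual

variable {K V : Type*} [Field K] [Finite K] {p : ℕ} [Fact p.Prime] [CharP K p] {k : ℕ}
  [AddCommGroup V] [Module K V] [Finite V] [FiniteDimensional K V] {h : V → V → K}

/-- Isometries that commute with the action of an extension field `F` are isometries for a form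
over `F`. -/
theorem eqEuler_isoGrp_eq_unitaryGroup {F : Type*} [Field F] [Finite F] [CharP F p] {d : ℕ}
    (hk : 0 < k) (hd : 0 < d) (hK : Nat.card K = (p ^ k) ^ 2)
    (hFcard : Nat.card F = (p ^ (k * d)) ^ 2) (hh : IsHerm (p ^ k) h)
    (hnd : ∀ u, (∀ v, h u v = 0) → u = 0) (g : V →ₗ[K] V) (hg : ∀ u v, h (g u) (g v) = h u v)
    {i : K →+* F} {α : F} (hα : α ≠ 0) (hsurj : Function.Surjective (eval₂ i α))
    (hpow : ∀ P : K[X], eval₂ i α P ^ p ^ (k * d) = eval₂ i α⁻¹ (P.map (iterateFrobenius K p k)))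
    (θ : F →+* Module.End K V) (hθ : ∀ P, θ (eval₂ i α P) = aeval g P) (m : ℕ)
    (hm : Module.finrank K V = m * d) (r : ℕ) :
    eqEuler r (isoGrp h g) {U | U ∈ isoSub h g ∧ U ≠ ⊥} =
      eqEuler r (unitaryGroup F (p ^ (k * d)) m) (isotropicPoset F (p ^ (k * d)) m) := by
  have hp : p.Prime := Fact.out
  have hkd : 0 < k * d := Nat.mul_pos hk hd
  let _ : Algebra K F := i.toAlgebra
  let _ : Module F V := Module.compHom V θ
  have hsmul : ∀ P v, (eval₂ i α P) • v = aeval g P v := fun P v =>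
    LinearMap.congr_fun (hθ P) v
  have hsmulK : ∀ (c : K) (v : V), i c • v = c • v := fun c v => by
    have := hsmul (C c) v
    rwa [eval₂_C, aeval_C] at this
  have hsmulα : ∀ v : V, α • v = g v := fun v => by
    have := hsmul X v
    rwa [eval₂_X, aeval_X] at this
  have : IsScalarTower K F V := IsScalarTower.of_algebraMap_smul hsmulK
  have hfdF : FiniteDimensional F V := Module.Finite.of_finite
  have hfin : Module.finrank F V = m := by
    have h1 := Module.natCard_eq_pow_finrank (K := F) (V := V)
    rw [Module.natCard_eq_pow_finrank (K := K) (V := V), hm, hK, hFcard, ← pow_mul, ← pow_mul,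
      ← pow_mul, ← pow_mul] at h1
    have h2 := Nat.pow_right_injective hp.two_le h1
    have h3 : (k * d * 2) * m = (k * d * 2) * Module.finrank F V := by
      linarith
    exact (Nat.eq_of_mul_eq_mul_left (by omega) h3).symm
  have hQ : ∀ c : F, (c ^ p ^ (k * d)) ^ p ^ (k * d) = c := pow_pow_eq_self hFcard
  have hi : ∀ c, i c ^ p ^ (k * d) = i (c ^ p ^ k) := fun c => by
    have := hpow (C c)
    rwa [eval₂_C, map_C, eval₂_C, iterateFrobenius_def] at this
  -- For constants this is sesquilinearity. For `α`, which acts as `g`, it says that the adjoint of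
  -- the isometry `g` is its inverse, since `α ^ Q = α⁻¹` with `Q = p ^ (k * d)`.
  have hadj : ∀ (c : F) u v, h (c • u) v = h u (c ^ p ^ (k * d) • v) := by
    intro c
    obtain ⟨P, rfl⟩ := hsurj c
    induction P using Polynomial.induction_on with
    | C a =>
      intro u v
      rw [eval₂_C, hi, hsmulK, hsmulK, hh.smul_left, hh.smul_right, pow_pow_eq_self hK]
    | add P₁ P₂ h1 h2 =>
      intro u v
      rw [eval₂_add, add_smul, hh.add_left, h1, h2, add_pow_char_pow, add_smul, hh.add_right]
    | monomial n a ih =>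
      intro u v
      have hαpow : α ^ p ^ (k * d) = α⁻¹ := by
        have := hpow X
        rwa [eval₂_X, map_X, eval₂_X] at this
      rw [pow_succ X n, ← mul_assoc, eval₂_mul, eval₂_X, mul_smul, ih, mul_pow, hαpow, mul_comm _ α⁻¹,
        mul_smul, hsmulα]
      conv_rhs => rw [← hg, ← hsmulα (α⁻¹ • _), smul_inv_smul₀ hα]
  -- The trace is a sum of powers of `x` with exponents powers of `|K|`, so it commutes with the
  -- `Q`-power map, which restricts to the `q`-power map on `K`.
  have htr : ∀ x, Algebra.trace K F (x ^ p ^ (k * d)) = Algebra.trace K F x ^ p ^ k := by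
    intro x
    apply i.injective
    have h1 : ∀ y, i (Algebra.trace K F y) = _ := FiniteField.algebraMap_trace_eq_sum_pow K F
    rw [← hi, h1, h1, sum_pow_char_pow]
    refine Finset.sum_congr rfl fun j _ => ?_
    exact pow_right_comm _ _ _
  obtain ⟨H, hHerm, hH⟩ := hh.exists_lift hadj hQ htr
  have hHh : ∀ u v, Algebra.trace K F (H u v) = h u v := fun u v => by
    rw [← one_mul (H u v), hH, one_smul]
  have hHnd : ∀ u, (∀ v, H u v = 0) → u = 0 := fun u hu => hnd u fun v => by
    rw [← hHh, hu, map_zero]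
  obtain ⟨T, hT⟩ := hHerm.exists_isometry (H' := hermForm F (p ^ (k * d)) m)
    (Nat.one_lt_pow hkd.ne' hp.one_lt) hFcard hHnd (isHerm_hermForm hkd hFcard m)
    (hermForm_nondegenerate hkd hFcard m) (by rw [hfin, Module.finrank_fin_fun])
  refine eqEuler_congr_addEquiv r T.toAddEquiv ?_ ?_ ?_ ?_
  · intro φ hφ
    have hφF : ∀ (c : F) v, φ (c • v) = c • φ v := by
      intro c v
      obtain ⟨P, rfl⟩ := hsurj c
      rw [hsmul, hsmul]
      exact commute_aeval (φ := φ.toLinearMap) hφ.2 P v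
    let φF : V ≃ₗ[F] V := { φ with map_smul' := hφF }
    have hφFa : ∀ v, φF v = φ v := fun _ => rfl
    have hφH : ∀ u v, H (φ u) (φ v) = H u v := by
      intro u v
      refine trace_mul_injective (K := K) fun c => ?_
      rw [hH, hH, ← hφF, hφ.1]
    refine ⟨(T.symm.trans φF).trans T, ?_, ?_⟩
    · intro x y
      obtain ⟨u, rfl⟩ := T.surjective x
      obtain ⟨v, rfl⟩ := T.surjective y
      simp only [LinearEquiv.trans_apply, LinearEquiv.symm_apply_apply]
      rw [hT, hT, hφFa, hφFa, hφH]
    · intro v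
      change T (φF (T.symm (T v))) = T (φ v)
      rw [T.symm_apply_apply, hφFa]
  · intro φ' hφ'
    let φF : V ≃ₗ[F] V := (T.trans φ').trans T.symm
    have hφF : ∀ v, T (φF v) = φ' (T v) := fun v => T.apply_symm_apply _
    let φ : V ≃ₗ[K] V := { φF with
      map_smul' := fun c v => by
        have := φF.map_smul (i c) v
        rw [hsmulK, hsmulK] at this
        exact this }
    have hφ : ∀ v, φ v = φF v := fun _ => rfl
    refine ⟨φ, ⟨?_, ?_⟩, fun v => (hφF v).symm⟩
    · intro u v
      rw [hφ, hφ, ← hHh, ← hHh, ← hT, hφF, hφF]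
      exact congrArg _ ((hφ' _ _).trans (hT u v))
    · intro v
      rw [hφ, hφ, ← hsmulα, ← hsmulα, map_smul]
  · rintro U ⟨⟨h1, h2⟩, h3⟩
    let UF : Submodule F V :=
      { U with
        smul_mem' := fun c v hv => by
          obtain ⟨P, rfl⟩ := hsurj c
          rw [hsmul]
          exact aeval_mem h2 P hv }
    have hmem : ∀ v, T v ∈ UF.map T.toLinearMap ↔ v ∈ U := fun v =>
      ⟨fun ⟨_, hu, e⟩ => T.injective e ▸ hu, fun hv => ⟨v, hv, rfl⟩⟩
    refine ⟨UF.map T.toLinearMap, ⟨fun h0 => h3 ?_, ?_⟩, hmem⟩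
    · rw [eq_bot_iff]
      intro v hv
      rw [← hmem, h0, Submodule.mem_bot, map_eq_zero_iff T T.injective] at hv
      exact hv
    · rintro _ ⟨u, hu, rfl⟩ _ ⟨v, hv, rfl⟩
      -- On an `F`-subspace, isotropy for `h` implies isotropy for `H`, because `Tr (c * H u v) = h
      -- (c • u) v = 0` for every `c`.
      refine (hT u v).trans (trace_mul_injective (K := K) fun c => ?_)
      rw [hH, mul_zero, map_zero]
      exact h1 _ (UF.smul_mem c hu) _ hv
  · rintro U' ⟨h1, h2⟩
    let U : Submodule K V :=
      { U'.comap T.toLinearMap with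
        smul_mem' := fun c v hv => by
          rw [← hsmulK]
          exact (U'.comap T.toLinearMap).smul_mem (i c) hv }
    have hU : ∀ v, T v ∈ U' ↔ v ∈ U := fun _ => Iff.rfl
    refine ⟨U, ⟨⟨?_, ?_⟩, fun h0 => h1 ?_⟩, hU⟩
    · intro u hu v hv
      rw [← hHh, ← hT, h2 _ ((hU u).mpr hu) _ ((hU v).mpr hv), map_zero]
    · intro u hu
      rw [← hU, ← hsmulα, map_smul]
      exact U'.smul_mem _ ((hU u).mpr hu)
    · rw [eq_bot_iff]
      intro x hx
      obtain ⟨v, rfl⟩ := T.surjective x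
      rw [hU, h0, Submodule.mem_bot] at hx
      rw [hx, map_zero]
      exact Submodule.zero_mem _

/-- The contribution of the kernel of a self-dual irreducible polynomial. -/
theorem isoEuler_selfDual (hk : 0 < k) (hK : Nat.card K = (p ^ k) ^ 2) (hh : IsHerm (p ^ k) h)
    (hnd : ∀ u, (∀ v, h u v = 0) → u = 0) (g : V →ₗ[K] V) (hg : ∀ u v, h (g u) (g v) = h u v)
    (ρ : K[X]) (hρ : Irreducible ρ) (hρ0 : ρ.coeff 0 ≠ 0)
    (hdual : dualPoly (iterateFrobenius K p k) ρ = ρ) (hρg : aeval g ρ = 0) (m : ℕ)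
    (hm : Module.finrank K V = m * ρ.natDegree) (r : ℕ) :
    isoEuler r h g = -chiGU p (k * ρ.natDegree) m r := by
  have hd0 : 0 < ρ.natDegree := hρ.natDegree_pos
  obtain ⟨i, α, hroot, hsurj, hker⟩ := exists_galoisField_root (N := 2 * (k * ρ.natDegree))
    (e := k * 2) (by rw [hK, ← pow_mul]) (by omega) hρ (by ring)
  obtain ⟨hα, hpow⟩ := eval₂_pow_eq hk hK hρ hρ0 hdual hroot hsurj hker
  obtain ⟨θ, hθ⟩ := exists_ringHom_of_root hsurj hker (aeval g : K[X] →ₐ[K] _).toRingHom hρg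
  unfold isoEuler chiGU
  congr 1
  exact eqEuler_isoGrp_eq_unitaryGroup hk hd0 hK (card_galoisField p _ (Nat.mul_pos hk hd0)) hh hnd
    g hg hα hsurj hpow θ hθ m hm r

end SelfDual

/-! ### Sums of two totally isotropic subspaces in duality. -/

section Hyperbolic

variable {K V : Type*} [Field K] [AddCommGroup V] [Module K V] {h : V → V → K} {q : ℕ}

theorem IsHerm.eq_zero_of_forall_left (hh : IsHerm q h) (hq : q ≠ 0)
    (hnd : ∀ u, (∀ v, h u v = 0) → u = 0) {v : V} (hv : ∀ u, h u v = 0) : v = 0 :=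
  hnd v fun u => hh.eq_zero_comm hq (hv u)

theorem IsHerm.apply_eq_of_polarization (hh : IsHerm q h) {π : V →ₗ[K] V}
    (h₁ : ∀ x y, h (π x) (π y) = 0) (h₂ : ∀ x y, h (x - π x) (y - π y) = 0) (x y : V) :
    h x y = h (π x) y + h x (π y) := by
  have h3 := h₂ x y
  rw [hh.sub_left, hh.sub_right, hh.sub_right, h₁] at h3
  linear_combination h3

/-- The second summand is dual to the first: `φ v - v` is killed by `π` and orthogonal to the image
of `π`, hence is zero. -/
theorem IsHerm.eq_of_eqOn_summand (hh : IsHerm q h) (hq : q ≠ 0)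
    (hnd : ∀ u, (∀ v, h u v = 0) → u = 0) {π : V →ₗ[K] V}
    (h₁ : ∀ x y, h (π x) (π y) = 0) (h₂ : ∀ x y, h (x - π x) (y - π y) = 0)
    {φ : V ≃ₗ[K] V} (hφ : ∀ u v, h (φ u) (φ v) = h u v) (hφπ : ∀ v, φ (π v) = π v)
    (hcom : ∀ v, φ (π v) = π (φ v)) (v : V) : φ v = v := by
  have hpol := hh.apply_eq_of_polarization h₁ h₂
  rw [← sub_eq_zero]
  refine hh.eq_zero_of_forall_left hq hnd fun x => ?_
  have h3 : π (φ v - v) = 0 := by rw [map_sub, ← hcom, hφπ, sub_self]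
  have h4 : h (π x) (φ v) = h (π x) v := by rw [← hφ (π x) v, hφπ]
  rw [hpol, h3, hh.zero_right, hh.sub_right, h4, sub_self, add_zero]

/-- The subspace of the vectors that are orthogonal to a given subspace. -/
def perp (hh : IsHerm q h) (B : Submodule K V) : Submodule K V where
  carrier := {x | ∀ b ∈ B, h b x = 0}
  add_mem' {x y} hx hy b hb := by rw [hh.add_right, hx b hb, hy b hb, add_zero]
  zero_mem' b _ := hh.zero_right b
  smul_mem' c x hx b hb := by rw [hh.smul_right, hx b hb, mul_zero]

variable [Finite K] [Finite V] [FiniteDimensional K V]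

/-- The totally isotropic subspaces of a sum of two totally isotropic subspaces in duality that are
stable under a set of isometries, compared with the stable subspaces of the first summand. -/
theorem neg_redEuler_isotropic (hh : IsHerm q h) (hq : q ≠ 0)
    (hnd : ∀ u, (∀ v, h u v = 0) → u = 0) {π : V →ₗ[K] V} (hπ : ∀ x, π (π x) = π x) (hπ0 : π ≠ 0)
    (h₁ : ∀ x y, h (π x) (π y) = 0) (h₂ : ∀ x y, h (x - π x) (y - π y) = 0)
    (Φ : Set (V →ₗ[K] V)) (hΦ : ∀ φ ∈ Φ, ∀ u v, h (φ u) (φ v) = h u v)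
    (hΦπ : ∀ φ ∈ Φ, ∀ v, φ (π v) = π (φ v))
    (hstab : ∀ U : Submodule K V, (∀ φ ∈ Φ, ∀ u ∈ U, φ u ∈ U) → ∀ u ∈ U, π u ∈ U) :
    -redEuler {U : Submodule K V | (∀ u ∈ U, ∀ v ∈ U, h u v = 0) ∧ (∀ φ ∈ Φ, ∀ u ∈ U, φ u ∈ U) ∧
      U ≠ ⊥} = redEuler {A : Submodule K V | (A ≤ LinearMap.range π ∧ ∀ φ ∈ Φ, ∀ u ∈ A, φ u ∈ A) ∧
        A ≠ ⊥ ∧ A ≠ LinearMap.range π} := by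
  have hfinS : Finite (Submodule K V) := Finite.of_injective _ SetLike.coe_injective
  set W := LinearMap.range π with hWdef
  have hW : ∀ x ∈ W, π x = x := by
    rintro _ ⟨y, rfl⟩
    exact hπ y
  have hpol := hh.apply_eq_of_polarization h₁ h₂
  have hcomm : ∀ {x y}, h x y = 0 → h y x = 0 := fun e => hh.eq_zero_comm hq e
  have hΦinj : ∀ φ ∈ Φ, Function.Injective φ := by
    intro φ hφ
    rw [injective_iff_map_eq_zero]
    intro u hu
    refine hnd u fun v => ?_
    rw [← hΦ φ hφ, hu, hh.zero_left]
  let St : Submodule K V → Prop := fun U => ∀ φ ∈ Φ, ∀ u ∈ U, φ u ∈ U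
  -- An isometry that preserves `B` maps it onto itself by finite dimension, hence also preserves
  -- its orthogonal.
  have hperp : ∀ B, St B → St (perp hh B) := by
    intro B hB φ hφ x hx b hb
    have hsurj : Function.Surjective (φ.restrict (hB φ hφ)) :=
      LinearMap.injective_iff_surjective.mp fun a b hab =>
        Subtype.ext (hΦinj φ hφ (congrArg Subtype.val hab))
    obtain ⟨⟨b', hb'⟩, e⟩ := hsurj ⟨b, hb⟩
    have e' : φ b' = b := congrArg Subtype.val e
    rw [← e', hΦ φ hφ]
    exact hx b' hb'
  have hStW : St W := by
    rintro φ hφ _ ⟨y, rfl⟩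
    rw [hΦπ φ hφ]
    exact ⟨_, rfl⟩
  have hWne : (⊥ : Submodule K V) ≠ W := by
    intro e
    rw [hWdef, eq_comm, LinearMap.range_eq_bot] at e
    exact hπ0 e
  let S : Finset (Submodule K V) := (Set.toFinite {A | A ≤ W ∧ St A}).toFinset
  have hS : ∀ A, A ∈ S ↔ A ≤ W ∧ St A := fun A => by simp [S]
  have hbotS : (⊥ : Submodule K V) ∈ S := by
    rw [hS]
    refine ⟨bot_le, fun φ _ u hu => ?_⟩
    rw [(Submodule.mem_bot K).mp hu, map_zero]
    exact Submodule.zero_mem _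
  have hWS : W ∈ S := (hS W).mpr ⟨le_rfl, hStW⟩
  have main := neg_redEuler_intervals hbotS hWS (fun x _ => bot_le) (fun x hx => ((hS x).mp hx).1)
    hWne
  -- The interval `A ≤ B` goes to the sum of `A` and the part of `ker π` orthogonal to `B`. It is
  -- isotropic because `A ≤ B`, and the least interval `(⊥, W)` goes to `⊥`.
  let F : Submodule K V × (Submodule K V)ᵒᵈ → Submodule K V := fun z =>
    z.1.comap π ⊓ perp hh (OrderDual.ofDual z.2)
  have hF : ∀ z x, x ∈ F z ↔ π x ∈ z.1 ∧ ∀ b ∈ OrderDual.ofDual z.2, h b x = 0 :=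
    fun z x => Iff.rfl
  have hFle : ∀ z z' : Submodule K V × (Submodule K V)ᵒᵈ, z.1 ≤ OrderDual.ofDual z.2 →
      OrderDual.ofDual z.2 ≤ W → OrderDual.ofDual z'.2 ≤ W → (F z ≤ F z' ↔ z ≤ z') := by
    rintro ⟨A, B⟩ ⟨A', B'⟩ hAB hBW hBW'
    constructor
    · intro hle
      refine ⟨fun x hx => ?_, fun b' hb' => ?_⟩
      · have hxW := hW x (hBW (hAB hx))
        have h3 : x ∈ F (A, B) := ⟨by simpa [hxW] using hx, fun b hb => by
          rw [← hW b (hBW hb), ← hxW, h₁]⟩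
        have h4 := (hle h3).1
        rw [← hxW]
        exact h4
      · by_contra hb
        obtain ⟨v, hv, hv'⟩ := hh.exists_separating hq hnd _ b' hb
        have h5 : ∀ b ∈ W, h b (v - π v) = h b v := fun b hb => by
          rw [hh.sub_right, ← hW b hb, h₁, sub_zero]
        have h3 : v - π v ∈ F (A, B) := by
          rw [hF, map_sub, hπ, sub_self]
          refine ⟨Submodule.zero_mem _, fun b hb => ?_⟩
          rw [h5 b (hBW hb)]
          exact hcomm (hv b hb)
        have h4 := (hle h3).2 b' hb'
        rw [h5 b' (hBW' hb')] at h4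
        exact hv' (hcomm h4)
    · rintro ⟨h3, h4⟩ x hx
      exact ⟨h3 hx.1, fun b hb => hx.2 b (h4 hb)⟩
  have hbot : F (⊥, OrderDual.toDual W) = ⊥ := by
    rw [eq_bot_iff]
    intro x hx
    have h3 : π x = 0 := hx.1
    refine (Submodule.mem_bot K).mpr (hh.eq_zero_of_forall_left hq hnd fun y => ?_)
    rw [hpol, h3, hh.zero_right, add_zero]
    exact hx.2 _ ⟨y, rfl⟩
  rw [← redEuler_image F fun z hz z' hz' => hFle z z' hz.2.2.1 ((hS _).mp hz.2.1).1
    ((hS _).mp hz'.2.1).1] at main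
  convert main using 2
  · congr 1
    ext U
    constructor
    · rintro ⟨hiso, hst, hU⟩
      have hπU := hstab U hst
      -- The inverse construction. If `x` were in the left side but not in `U`, take `v` orthogonal
      -- to `U` but not to `x`. As `U` is `π`-stable, `π v` lies in `W ⊓ perp hh U`, so both terms
      -- of `h v x = h (π v) x + h v (π x)` vanish.
      have e : F (U ⊓ W, OrderDual.toDual (W ⊓ perp hh U)) = U := by
        ext x
        rw [hF]
        constructor
        · rintro ⟨hx1, hx2⟩
          by_contra hx
          obtain ⟨v, hv, hv'⟩ := hh.exists_separating hq hnd U x hx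
          apply hv'
          rw [hpol, hv _ hx1.1, add_zero]
          refine hx2 _ ⟨⟨v, rfl⟩, fun u hu => ?_⟩
          have h3 := hpol u v
          rw [hcomm (hv u hu), hcomm (hv _ (hπU u hu)), zero_add] at h3
          exact h3.symm
        · intro hx
          exact ⟨⟨hπU x hx, ⟨x, rfl⟩⟩, fun b hb => hcomm (hb.2 x hx)⟩
      refine ⟨(U ⊓ W, OrderDual.toDual (W ⊓ perp hh U)), ⟨?_, ?_, ?_, ?_⟩, e⟩
      · exact (hS _).mpr ⟨inf_le_right, fun φ hφ u hu => ⟨hst φ hφ u hu.1, hStW φ hφ u hu.2⟩⟩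
      · exact (hS _).mpr ⟨inf_le_left, fun φ hφ u hu =>
          ⟨hStW φ hφ u hu.1, hperp U hst φ hφ u hu.2⟩⟩
      · exact fun u hu => ⟨hu.2, fun v hv => hiso v hv u hu.1⟩
      · intro e'
        rw [e', hbot] at e
        exact hU e.symm
    · rintro ⟨⟨A, B⟩, ⟨hA, hB, hAB, hne⟩, rfl⟩
      refine ⟨fun x hx y hy => ?_, fun φ hφ x hx => ⟨?_, ?_⟩, fun h0 => hne ?_⟩
      · rw [hpol, hy.2 _ (hAB hx.1), hcomm (hx.2 _ (hAB hy.1)), add_zero]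
      · change π (φ x) ∈ A
        rw [← hΦπ φ hφ]
        exact ((hS A).mp hA).2 φ hφ _ hx.1
      · exact hperp _ ((hS _).mp hB).2 φ hφ x hx.2
      · have h3 := (hFle (A, B) (⊥, OrderDual.toDual W) hAB ((hS _).mp hB).1 le_rfl).mp
          (h0.le.trans bot_le)
        exact le_antisymm h3 ⟨bot_le, ((hS _).mp hB).1⟩
  · congr 1
    ext A
    simp only [hS]
    rfl

/-- An isomorphism of groups reduces the comparison of equivariant Euler characteristics
to Euler characteristics of fixed point posets. -/
theorem neg_eqEuler_eq_eqEuler {Γ Q Γ' Q' : Type*} [Group Γ] [PartialOrder Q] [MulAction Γ Q]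
    [Group Γ'] [PartialOrder Q'] [MulAction Γ' Q'] (r : ℕ) {H : Subgroup Γ} {P : Set Q}
    {H' : Subgroup Γ'} {P' : Set Q'} (e : H ≃* H')
    (hX : ∀ X : Multiplicative (Fin r → ℤ) →* H,
      -redEuler {x : Q | x ∈ P ∧ ∀ z, (X z : Γ) • x = x} =
        redEuler {x : Q' | x ∈ P' ∧ ∀ z, (e (X z) : Γ') • x = x}) :
    -eqEuler r H P = eqEuler r H' P' := by
  unfold eqEuler
  rw [← mul_neg, ← finsum_neg_distrib, Nat.card_congr e.toEquiv]
  congr 1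
  refine finsum_eq_of_bijective (fun X => e.toMonoidHom.comp X) ⟨?_, ?_⟩ ?_
  · intro X Y hXY
    ext z
    exact congrArg Subtype.val (e.injective (DFunLike.congr_fun hXY z))
  · intro Y
    refine ⟨e.symm.toMonoidHom.comp Y, ?_⟩
    ext z
    exact congrArg Subtype.val (e.apply_symm_apply (Y z))
  · intro X
    have h1 := hX X
    rw [← Int.cast_neg]
    congr 1
    convert h1 using 2
    · congr 1
      ext x
      simp
    · ext x
      simp

/-- An automorphism of a totally isotropic summand extends to an isometry. -/
theorem IsHerm.exists_isometry_extending (hh : IsHerm q h) (hq : q ≠ 0)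
    (hnd : ∀ u, (∀ v, h u v = 0) → u = 0) {g : V →ₗ[K] V} (hg : ∀ u v, h (g u) (g v) = h u v)
    {π : V →ₗ[K] V} (hgπ : ∀ x, π (g x) = g (π x))
    (h₁ : ∀ x y, h (π x) (π y) = 0) (h₂ : ∀ x y, h (x - π x) (y - π y) = 0)
    {W : Submodule K V} (hπW : ∀ x, π x ∈ W) (hW : ∀ x ∈ W, π x = x)
    (hgW : ∀ x ∈ W, g x ∈ W) (ψ : W ≃ₗ[K] W)
    (hψ : ∀ w, ψ (g.restrict hgW w) = g.restrict hgW (ψ w)) :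
    ∃ φ ∈ isoGrp h g, ∀ w : W, φ (w : V) = ψ w := by
  have hpol := hh.apply_eq_of_polarization h₁ h₂
  have hcomm : ∀ {x y}, h x y = 0 → h y x = 0 := fun e => hh.eq_zero_comm hq e
  have hext : ∀ {v w : V}, (∀ x, h x v = h x w) → v = w := fun {v w} e => by
    rw [← sub_eq_zero]
    refine hh.eq_zero_of_forall_left hq hnd fun u => ?_
    rw [hh.sub_right, e, sub_self]
  let πW : V →ₗ[K] W := π.codRestrict W hπW
  have hπWW : ∀ w : W, πW w = w := fun w => Subtype.ext (hW w w.2)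
  have hπWg : ∀ x, πW (g x) = g.restrict hgW (πW x) := fun x => Subtype.ext (hgπ x)
  have hWW : ∀ x y : W, h x y = 0 := fun x y => by
    rw [← hW x x.2, ← hW y y.2, h₁]
  -- `A` is the inverse adjoint of `ψ`, taken on the complementary summand: it kills `W` and has
  -- values in `ker π`. The extension is `ψ` on `W` plus `A`.
  choose A hA using fun v => hh.exists_eq_dual hq hnd
    { toFun := fun x => h (ψ.symm (πW x)) v
      map_add' := fun x y => by
        rw [map_add, map_add, Submodule.coe_add, hh.add_left]
      map_smul' := fun c x => by
        rw [map_smul, map_smul, Submodule.coe_smul, hh.smul_left]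
        rfl }
  replace hA : ∀ v x, h x (A v) = h (ψ.symm (πW x)) v := fun v x => (hA v x).symm
  have hAW : ∀ w : W, A w = 0 := fun w => hh.eq_zero_of_forall_left hq hnd fun x => by
    rw [hA, hWW]
  have hπA : ∀ v, π (A v) = 0 := fun v => hh.eq_zero_of_forall_left hq hnd fun x => by
    have h3 := hpol x (A v)
    have h4 : πW (π x) = πW x := hπWW (πW x)
    rw [hA, hA, h4] at h3
    linear_combination -h3
  have hAA : ∀ u v, h (A u) (A v) = 0 := fun u v => by
    rw [hpol, hπA, hπA, hh.zero_left, hh.zero_right, add_zero]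
  have hAg : ∀ v, A (g v) = g (A v) := by
    have hginj : Function.Injective g := by
      rw [injective_iff_map_eq_zero]
      intro u hu
      refine hnd u fun v => ?_
      rw [← hg, hu, hh.zero_left]
    intro v
    refine hext fun x => ?_
    obtain ⟨y, rfl⟩ := LinearMap.injective_iff_surjective.mp hginj x
    have h3 : ψ.symm (πW (g y)) = g.restrict hgW (ψ.symm (πW y)) := by
      apply ψ.injective
      rw [ψ.apply_symm_apply, hψ, ψ.apply_symm_apply, hπWg]
    rw [hA, hg, hA, h3]
    exact hg _ _
  let φ : V →ₗ[K] V :=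
    { toFun := fun v => ψ (πW v) + A v
      map_add' := fun x y => by
        have h3 : A (x + y) = A x + A y := hext fun u => by
          rw [hA, hh.add_right, hh.add_right, hA, hA]
        rw [map_add, map_add, Submodule.coe_add, h3]
        abel
      map_smul' := fun c x => by
        have h3 : A (c • x) = c • A x := hext fun u => by
          rw [hA, hh.smul_right, hh.smul_right, hA]
        rw [map_smul, map_smul, Submodule.coe_smul, h3, ← smul_add]
        rfl }
  have hφ : ∀ v, φ v = ψ (πW v) + A v := fun _ => rfl
  have hiso : ∀ u v, h (φ u) (φ v) = h u v := by
    have h3 : ∀ u v, h (ψ (πW u)) (A v) = h (π u) v := fun u v => by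
      rw [hA, hπWW, ψ.symm_apply_apply]
      rfl
    intro u v
    rw [hφ, hφ, hh.add_left, hh.add_right, hh.add_right, hWW, hAA, h3, hh.symm _ (A u), h3,
      ← hh.symm, zero_add, add_zero, ← hpol]
  have hinj : Function.Injective φ := by
    rw [injective_iff_map_eq_zero]
    intro u hu
    refine hnd u fun v => ?_
    rw [← hiso, hu, hh.zero_left]
  refine ⟨LinearEquiv.ofInjectiveEndo φ hinj, ⟨hiso, fun v => ?_⟩, fun w => ?_⟩
  · change φ (g v) = g (φ v)
    rw [hφ, hφ, map_add, hAg, hπWg, hψ]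
    rfl
  · change φ w = ψ w
    rw [hφ, hAW, hπWW, add_zero]

/-- If the space is the sum of two totally isotropic images of complementary idempotent polynomials
in `g`, then isotropic subspaces reduce to arbitrary subspaces of the first summand. -/
theorem isoEuler_hyperbolic (hh : IsHerm q h) (hq : q ≠ 0)
    (hnd : ∀ u, (∀ v, h u v = 0) → u = 0) {g : V →ₗ[K] V} (hg : ∀ u v, h (g u) (g v) = h u v)
    (E : K[X]) (hE : ∀ x, aeval g E (aeval g E x) = aeval g E x)
    (h₁ : ∀ x y, h (aeval g E x) (aeval g E y) = 0)
    (h₂ : ∀ x y, h (x - aeval g E x) (y - aeval g E y) = 0)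
    (W : Submodule K V) (hW : ∀ x, x ∈ W ↔ aeval g E x = x) (hW0 : W ≠ ⊥)
    (hgW : ∀ x ∈ W, g x ∈ W) (r : ℕ) :
    isoEuler r h g = eqEuler r (isoGrp (fun _ _ => (0 : K)) (g.restrict hgW))
      {U | U ∈ isoSub (fun _ _ => (0 : K)) (g.restrict hgW) ∧ U ≠ ⊥ ∧ U ≠ ⊤} := by
  set π := aeval g E with hπdef
  have hrange : LinearMap.range π = W := by
    ext x
    rw [hW]
    exact ⟨by rintro ⟨y, rfl⟩; exact hE y, fun hx => ⟨x, hx⟩⟩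
  have hπW : ∀ x, π x ∈ W := fun x => (hW _).mpr (hE x)
  have hcom : ∀ φ ∈ isoGrp h g, ∀ v, φ (π v) = π (φ v) := fun φ hφ v =>
    commute_aeval (φ := φ.toLinearMap) hφ.2 E v
  have hφW : ∀ φ ∈ isoGrp h g, ∀ x ∈ W, φ x ∈ W := by
    intro φ hφ x hx
    rw [hW] at hx ⊢
    rw [← hcom φ hφ, hx]
  have hφW' : ∀ φ ∈ isoGrp h g, W.map (φ : V →ₗ[K] V) = W := fun φ hφ =>
    (smul_eq_self_iff φ W).mpr (hφW φ hφ)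
  -- For the zero form, `isoGrp` is the full centralizer of `g` on `W`. Restriction is injective as
  -- the complement is dual to `W`, and surjective by `IsHerm.exists_isometry_extending`.
  let R : isoGrp h g →* isoGrp (fun _ _ => (0 : K)) (g.restrict hgW) :=
    MonoidHom.mk' (fun φ => ⟨LinearEquiv.ofSubmodules φ.1 W W (hφW' φ.1 φ.2),
      fun _ _ => rfl, fun v => Subtype.ext (φ.2.2 v)⟩) (fun _ _ => rfl)
  have hR : ∀ φ (w : W), ((R φ).1 w : V) = φ.1 w := fun _ _ => rfl
  have hRbij : Function.Bijective R := by
    constructor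
    · rw [injective_iff_map_eq_one]
      intro φ hφ
      refine Subtype.ext (LinearEquiv.ext fun v => ?_)
      refine hh.eq_of_eqOn_summand hq hnd h₁ h₂ φ.2.1 (fun v => ?_) (hcom _ φ.2) v
      have h3 := hR φ ⟨π v, hπW v⟩
      rw [hφ] at h3
      exact h3.symm
    · rintro ⟨ψ, hψ⟩
      obtain ⟨φ, hφ, h3⟩ := hh.exists_isometry_extending hq hnd hg
        (fun x => (commute_aeval (φ := g) (fun _ => rfl) E x).symm) h₁ h₂ hπW
        (fun x hx => (hW x).mp hx) hgW ψ hψ.2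
      exact ⟨⟨φ, hφ⟩, Subtype.ext (LinearEquiv.ext fun w => Subtype.ext (h3 w))⟩
  unfold isoEuler
  refine neg_eqEuler_eq_eqEuler r (MulEquiv.ofBijective R hRbij) fun X => ?_
  have main := neg_redEuler_isotropic hh hq hnd hE (fun h0 => hW0 (by
      rw [← hrange, LinearMap.range_eq_bot]
      exact h0)) h₁ h₂
    -- Including `g` among the isometries makes every stable subspace stable under `π`, a polynomial
    -- in `g`.
    (insert g (Set.range fun z => ((X z).1 : V →ₗ[K] V)))
    (by
      rintro φ (rfl | ⟨z, rfl⟩)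
      · exact hg
      · exact (X z).2.1)
    (by
      rintro φ (rfl | ⟨z, rfl⟩) v
      · exact commute_aeval (fun _ => rfl) E v
      · exact hcom _ (X z).2 v)
    (fun U hU u hu => aeval_mem (hU g (Set.mem_insert _ _)) E hu)
  simp only [Set.forall_mem_insert, Set.forall_mem_range, hrange] at main
  convert main using 2
  · congr 1
    ext U
    simp only [Set.mem_ofPred_eq, smul_eq_self_iff]
    exact ⟨fun ⟨⟨⟨a, b⟩, c⟩, d⟩ => ⟨a, ⟨b, d⟩, c⟩, fun ⟨a, ⟨b, d⟩, c⟩ => ⟨⟨⟨a, b⟩, c⟩, d⟩⟩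
  · rw [← redEuler_image (Submodule.map W.subtype) fun A _ B _ =>
      Submodule.map_le_map_iff_of_injective W.subtype_injective A B]
    congr 1
    have hmem : ∀ (A : Submodule K W) (w : W), (w : V) ∈ A.map W.subtype ↔ w ∈ A := fun A w =>
      ⟨fun ⟨_, hu, e⟩ => W.subtype_injective e ▸ hu, fun hw => ⟨w, hw, rfl⟩⟩
    have hbot : ∀ A : Submodule K W, A.map W.subtype = ⊥ ↔ A = ⊥ := fun A => by
      rw [← Submodule.map_bot W.subtype]
      exact (Submodule.map_injective_of_injective W.subtype_injective).eq_iff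
    have htop : ∀ A : Submodule K W, A.map W.subtype = W ↔ A = ⊤ := fun A => by
      constructor
      · intro e
        rw [eq_top_iff]
        intro w _
        rw [← hmem, e]
        exact w.2
      · rintro rfl
        exact Submodule.map_subtype_top W
    ext U
    constructor
    · rintro ⟨A, ⟨⟨⟨-, hA⟩, hA0, hA1⟩, hAX⟩, rfl⟩
      refine ⟨⟨Submodule.map_subtype_le W A, ?_, fun z => ?_⟩, by rwa [Ne, hbot], by rwa [Ne, htop]⟩
      · rintro _ ⟨u, hu, rfl⟩
        exact (hmem A _).mpr (hA u hu)
      · rintro _ ⟨u, hu, rfl⟩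
        exact (hmem A _).mpr ((smul_eq_self_iff _ _).mp (hAX z) u hu)
    · rintro ⟨⟨hU, hUg, hUX⟩, hU0, hU1⟩
      have e : (U.comap W.subtype).map W.subtype = U := by
        rw [Submodule.map_comap_subtype, inf_eq_right.mpr hU]
      refine ⟨U.comap W.subtype, ⟨⟨⟨fun _ _ _ _ => rfl, fun u hu => hUg _ hu⟩, ?_, ?_⟩, fun z => ?_⟩,
        e⟩
      · rwa [Ne, ← hbot, e]
      · rwa [Ne, ← htop, e]
      · rw [smul_eq_self_iff]
        exact fun u hu => hUX z _ hu

end Hyperbolic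

/-! ### Centralizers as general linear groups over an extension field. -/

section Linear

variable {K V : Type*} [Field K] [Finite K] {p : ℕ} [Fact p.Prime] [CharP K p]
  [AddCommGroup V] [Module K V] [Finite V] [FiniteDimensional K V]

/-- Automorphisms that commute with the action of an extension field `F` are automorphisms
over `F`. -/
theorem eqEuler_isoGrp_zero {F : Type*} [Field F] [Finite F] {d : ℕ} (hd : 0 < d)
    (hF : Nat.card F = Nat.card K ^ d) (g : V →ₗ[K] V) {i : K →+* F} {α : F}
    (hsurj : Function.Surjective (eval₂ i α))
    (θ : F →+* Module.End K V) (hθ : ∀ P, θ (eval₂ i α P) = aeval g P) (m : ℕ)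
    (hm : Module.finrank K V = m * d) (r : ℕ) :
    eqEuler r (isoGrp (fun _ _ => (0 : K)) g)
      {U | U ∈ isoSub (fun _ _ => (0 : K)) g ∧ U ≠ ⊥ ∧ U ≠ ⊤} =
      eqEuler r (⊤ : Subgroup ((Fin m → F) ≃ₗ[F] (Fin m → F))) (properPoset F m) := by
  let _ : Module F V := Module.compHom V θ
  have hsmul : ∀ P v, (eval₂ i α P) • v = aeval g P v := fun P v =>
    LinearMap.congr_fun (hθ P) v
  have hsmulK : ∀ (c : K) (v : V), i c • v = c • v := fun c v => by
    have := hsmul (C c) v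
    rwa [eval₂_C, aeval_C] at this
  have hsmulα : ∀ v : V, α • v = g v := fun v => by
    have := hsmul X v
    rwa [eval₂_X, aeval_X] at this
  have hfdF : FiniteDimensional F V := Module.Finite.of_finite
  have hfin : Module.finrank F V = m := by
    have h1 := Module.natCard_eq_pow_finrank (K := F) (V := V)
    rw [Module.natCard_eq_pow_finrank (K := K) (V := V), hm, hF, ← pow_mul] at h1
    have h2 := Nat.pow_right_injective (Finite.one_lt_card : 1 < Nat.card K) h1
    rw [mul_comm] at h2
    exact (Nat.eq_of_mul_eq_mul_left hd h2).symm
  let T : V ≃ₗ[F] (Fin m → F) := LinearEquiv.ofFinrankEq _ _ (by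
    rw [hfin, Module.finrank_fin_fun])
  refine eqEuler_congr_addEquiv r T.toAddEquiv ?_ ?_ ?_ ?_
  · intro φ hφ
    let φF : V ≃ₗ[F] V := { φ with
      map_smul' := fun c v => by
        obtain ⟨P, rfl⟩ := hsurj c
        rw [hsmul]
        exact (commute_aeval (φ := φ.toLinearMap) hφ.2 P v).trans (hsmul _ _).symm }
    refine ⟨(T.symm.trans φF).trans T, trivial, fun v => ?_⟩
    change T (φF (T.symm (T v))) = T (φ v)
    rw [T.symm_apply_apply]
    rfl
  · intro φ' _
    let φF : V ≃ₗ[F] V := (T.trans φ').trans T.symm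
    let φ : V ≃ₗ[K] V := { φF with
      map_smul' := fun c v => by
        have := φF.map_smul (i c) v
        rw [hsmulK, hsmulK] at this
        exact this }
    have hφ : ∀ v, φ v = φF v := fun _ => rfl
    refine ⟨φ, ⟨fun _ _ => rfl, fun v => ?_⟩, fun v => (T.apply_symm_apply _).symm⟩
    rw [hφ, hφ, ← hsmulα, ← hsmulα, map_smul]
  · rintro U ⟨⟨-, h2⟩, h3, h4⟩
    let UF : Submodule F V :=
      { U with
        smul_mem' := fun c v hv => by
          obtain ⟨P, rfl⟩ := hsurj c
          rw [hsmul]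
          exact aeval_mem h2 P hv }
    have hmem : ∀ v, T v ∈ UF.map T.toLinearMap ↔ v ∈ U := fun v =>
      ⟨fun ⟨_, hu, e⟩ => T.injective e ▸ hu, fun hv => ⟨v, hv, rfl⟩⟩
    refine ⟨UF.map T.toLinearMap, ⟨fun h0 => h3 ?_, fun h0 => h4 ?_⟩, hmem⟩
    · rw [eq_bot_iff]
      intro v hv
      rw [← hmem, h0, Submodule.mem_bot, map_eq_zero_iff T T.injective] at hv
      exact hv
    · rw [eq_top_iff]
      intro v _
      rw [← hmem, h0]
      trivial
  · rintro U' ⟨h1, h2⟩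
    let U : Submodule K V :=
      { U'.comap T.toLinearMap with
        smul_mem' := fun c v hv => by
          rw [← hsmulK]
          exact (U'.comap T.toLinearMap).smul_mem (i c) hv }
    have hU : ∀ v, T v ∈ U' ↔ v ∈ U := fun _ => Iff.rfl
    refine ⟨U, ⟨⟨fun _ _ _ _ => rfl, ?_⟩, fun h0 => h1 ?_, fun h0 => h2 ?_⟩, hU⟩
    · intro u hu
      rw [← hU, ← hsmulα, map_smul]
      exact U'.smul_mem _ ((hU u).mpr hu)
    · rw [eq_bot_iff]
      intro x hx
      obtain ⟨v, rfl⟩ := T.surjective x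
      rw [hU, h0, Submodule.mem_bot] at hx
      rw [hx, map_zero]
      exact Submodule.zero_mem _
    · rw [eq_top_iff]
      intro x _
      obtain ⟨v, rfl⟩ := T.surjective x
      rw [hU, h0]
      trivial

/-- The automorphisms that commute with a map killed by an irreducible polynomial. -/
theorem eqEuler_isoGrp_zero_eq_chiGL {e : ℕ} (hK : Nat.card K = p ^ e) (he : 0 < e)
    (g : V →ₗ[K] V) (s : K[X]) (hs : Irreducible s) (hsg : aeval g s = 0) (m : ℕ)
    (hm : Module.finrank K V = m * s.natDegree) {N : ℕ} (hN : N = e * s.natDegree) (r : ℕ) :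
    eqEuler r (isoGrp (fun _ _ => (0 : K)) g)
      {U | U ∈ isoSub (fun _ _ => (0 : K)) g ∧ U ≠ ⊥ ∧ U ≠ ⊤} = chiGL p N m r := by
  obtain ⟨i, α, -, hsurj, hker⟩ := exists_galoisField_root hK he hs hN
  obtain ⟨θ, hθ⟩ := exists_ringHom_of_root hsurj hker (aeval g : K[X] →ₐ[K] _).toRingHom hsg
  refine eqEuler_isoGrp_zero hs.natDegree_pos ?_ g hsurj θ hθ m hm r
  rw [hK, ← pow_mul, ← hN]
  exact GaloisField.card p N (hN ▸ (Nat.mul_pos he hs.natDegree_pos).ne')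

end Linear

/-! ### Pairs of an irreducible polynomial and its dual. -/

section Pair

variable {K V : Type*} [Field K] {p : ℕ} [Fact p.Prime] [CharP K p] {k : ℕ}
  [AddCommGroup V] [Module K V] {h : V → V → K}

theorem isCoprime_of_irreducible_of_ne {s t : K[X]} (hs : Irreducible s) (ht : Irreducible t)
    (hsm : s.Monic) (htm : t.Monic) (hst : s ≠ t) : IsCoprime s t := by
  rw [hs.coprime_iff_not_dvd]
  exact fun hd => hst (eq_of_monic_of_associated hsm htm (hs.associated_of_dvd ht hd))

variable [Finite K]

theorem iterateFrobenius_involutive (hK : Nat.card K = (p ^ k) ^ 2) (x : K) :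
    iterateFrobenius K p k (iterateFrobenius K p k x) = x := by
  rw [iterateFrobenius_def, iterateFrobenius_def, pow_pow_eq_self hK]

variable [Finite V] [FiniteDimensional K V]

/-- The contribution of the kernel of the product of an irreducible polynomial that is not
self-dual and its dual. -/
theorem isoEuler_pair (hk : 0 < k) (hK : Nat.card K = (p ^ k) ^ 2) (hh : IsHerm (p ^ k) h)
    (hnd : ∀ u, (∀ v, h u v = 0) → u = 0) (g : V →ₗ[K] V) (hg : ∀ u v, h (g u) (g v) = h u v)
    (s s' : K[X]) (hs : Irreducible s) (hsm : s.Monic) (hs0 : s.coeff 0 ≠ 0)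
    (hs' : s' = dualPoly (iterateFrobenius K p k) s) (hne : s ≠ s')
    (hsg : aeval g (s * s') = 0) (m : ℕ) (hm0 : 0 < m)
    (hm : Module.finrank K (LinearMap.ker (aeval g s)) = m * s.natDegree) (r : ℕ) :
    isoEuler r h g = chiGL p (2 * (k * s.natDegree)) m r := by
  have hσ := iterateFrobenius_involutive (p := p) (k := k) hK
  have hs'm : s'.Monic := hs' ▸ dualPoly_monic hs0
  have hs'0 : s'.coeff 0 ≠ 0 := hs' ▸ dualPoly_coeff_ne_zero hsm hs0
  have hs'i : Irreducible s' := hs' ▸ dualPoly_irreducible hσ hsm hs0 hs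
  have hs'd : dualPoly (iterateFrobenius K p k) s' = s := hs' ▸ dualPoly_dualPoly hσ hsm hs0
  have hcop := isCoprime_of_irreducible_of_ne hs hs'i hsm hs'm hne
  -- From `u * s + v * s' = 1` and `(s * s')(g) = 0`, the polynomial `v * s'` evaluates at `g` to
  -- the projection onto `ker s(g)` along `ker s'(g)`.
  obtain ⟨u, v, huv⟩ := id hcop
  have hzero : ∀ P : K[X], s * s' ∣ P → ∀ x, aeval g P x = 0 := by
    rintro _ ⟨P, rfl⟩ x
    rw [map_mul, hsg, zero_mul, LinearMap.zero_apply]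
  have h1 : ∀ x, aeval g s (aeval g (v * s') x) = 0 := fun x => by
    rw [← Module.End.mul_apply, ← map_mul]
    exact hzero _ ⟨v, by ring⟩ x
  have hsub : ∀ x, x - aeval g (v * s') x = aeval g (u * s) x := fun x => by
    have h2 := LinearMap.congr_fun (congrArg (aeval g) huv) x
    rw [map_add, map_one, LinearMap.add_apply, Module.End.one_apply] at h2
    exact sub_eq_iff_eq_add.mpr h2.symm
  have h2 : ∀ x, aeval g s' (x - aeval g (v * s') x) = 0 := fun x => by
    rw [hsub, ← Module.End.mul_apply, ← map_mul]
    exact hzero _ ⟨u, by ring⟩ x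
  have hW : ∀ x, x ∈ LinearMap.ker (aeval g s) ↔ aeval g (v * s') x = x := by
    intro x
    rw [LinearMap.mem_ker]
    constructor
    · intro hx
      have h3 := hsub x
      rw [map_mul _ u, Module.End.mul_apply, hx, map_zero, sub_eq_zero] at h3
      exact h3.symm
    · intro hx
      rw [← hx, h1]
  have hdim : 0 < Module.finrank K (LinearMap.ker (aeval g s)) := by
    rw [hm]
    exact Nat.mul_pos hm0 hs.natDegree_pos
  -- Both kernels are totally isotropic by `IsHerm.orthogonal_ker`, because each of `s`, `s'` is
  -- prime to its own dual.
  rw [isoEuler_hyperbolic hh (pow_ne_zero _ (Fact.out : p.Prime).ne_zero) hnd hg (v * s')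
    (fun x => (hW _).mp (h1 x))
    (fun x y => hh.orthogonal_ker (iterateFrobenius_def p k) hσ hg s s hs0
      (hs' ▸ hcop.symm) _ _ (h1 x) (h1 y))
    (fun x y => hh.orthogonal_ker (iterateFrobenius_def p k) hσ hg s' s' hs'0
      (by rw [hs'd]; exact hcop) _ _ (h2 x) (h2 y))
    (LinearMap.ker (aeval g s)) hW (fun e => by rw [e, finrank_bot] at hdim; exact hdim.ne rfl)
    (apply_mem_ker_aeval g s) r]
  exact eqEuler_isoGrp_zero_eq_chiGL (e := k * 2) (by rw [hK, ← pow_mul]) (by omega) _ s hs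
    (aeval_restrict_ker g s) m hm (by ring) r

end Pair

/-! ### Assembling the contributions of the factors. -/

section Factorization

variable {K V : Type*} [Field K] {p : ℕ} [Fact p.Prime] [CharP K p] {k : ℕ}
  [AddCommGroup V] [Module K V] {h : V → V → K}

/-- The factors that belong to the orthogonal summands. -/
def factorPoly {I J : ℕ} (ρ : Fin I → K[X]) (s s' : Fin J → K[X]) : Fin I ⊕ Fin J → K[X] :=
  Sum.elim ρ fun j => s j * s' j

variable {f : K[X]} {I J : ℕ} {ρ : Fin I → K[X]} {a : Fin I → ℕ} {s s' : Fin J → K[X]}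
  {b : Fin J → ℕ}

theorem IsDualFactorization.dualPoly_self (hf : IsDualFactorization (p ^ k) f ρ a s s' b)
    (i : Fin I) : dualPoly (iterateFrobenius K p k) (ρ i) = ρ i :=
  ((isDual_iff (hf.monic_self i) (hf.coeff_zero_self i) _).mp (hf.dual_self i)).symm

theorem IsDualFactorization.eq_dualPoly (hf : IsDualFactorization (p ^ k) f ρ a s s' b)
    (j : Fin J) : s' j = dualPoly (iterateFrobenius K p k) (s j) :=
  (isDual_iff (hf.monic_pair j) (hf.coeff_zero_pair j) _).mp (hf.dual_pair j)

theorem IsDualFactorization.eq_prod_factorPoly {q : ℕ}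
    (hf : IsDualFactorization q f ρ a s s' b) : f = ∏ i, factorPoly ρ s s' i ^ Sum.elim a b i := by
  rw [Fintype.prod_sum_type]
  exact hf.eq_prod

theorem IsDualFactorization.natDegree_eq (hf : IsDualFactorization (p ^ k) f ρ a s s' b) :
    f.natDegree = (∑ i, a i * (ρ i).natDegree) + ∑ j, 2 * (b j * (s j).natDegree) := by
  have hs'm : ∀ j, (s' j).Monic := fun j => by
    rw [hf.eq_dualPoly]
    exact dualPoly_monic (hf.coeff_zero_pair j)
  have h1 : (∏ i, ρ i ^ a i).Monic := monic_prod_of_monic _ _ fun i _ => (hf.monic_self i).pow _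
  have h2 : ∀ j, ((s j * s' j) ^ b j).Monic := fun j => ((hf.monic_pair j).mul (hs'm j)).pow _
  rw [hf.eq_prod, h1.natDegree_mul (monic_prod_of_monic _ _ fun j _ => h2 j),
    natDegree_prod_of_monic _ _ fun i _ => (hf.monic_self i).pow _,
    natDegree_prod_of_monic _ _ fun j _ => h2 j]
  congr 1
  · exact Finset.sum_congr rfl fun i _ => (hf.monic_self i).natDegree_pow _
  · refine Finset.sum_congr rfl fun j _ => ?_
    rw [((hf.monic_pair j).mul (hs'm j)).natDegree_pow, (hf.monic_pair j).natDegree_mul (hs'm j),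
      hf.eq_dualPoly, natDegree_dualPoly (hf.coeff_zero_pair j)]
    ring

/-- The minimal polynomial divides a power of `∏ i, t i`; being squarefree, it divides the product
itself. -/
theorem aeval_prod_eq_zero [FiniteDimensional K V] {ι : Type*} [Fintype ι] {g : V →ₗ[K] V}
    {μ : K[X]} (hμ : Squarefree μ) (hμg : aeval g μ = 0) {t : ι → K[X]} {e : ι → ℕ}
    (ht : g.charpoly = ∏ i, t i ^ e i) : aeval g (∏ i, t i) = 0 := by
  have h1 : minpoly K g ∣ (∏ i, t i) ^ ∑ i, e i := by
    refine (LinearMap.minpoly_dvd_charpoly g).trans ?_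
    rw [ht, ← Finset.prod_pow]
    exact Finset.prod_dvd_prod_of_dvd _ _ fun i _ => pow_dvd_pow _
      (Finset.single_le_sum (fun _ _ => Nat.zero_le _) (Finset.mem_univ i))
  have h2 : Squarefree (minpoly K g) := hμ.squarefree_of_dvd (minpoly.dvd K g hμg)
  exact (minpoly.dvd_iff).mp (h2.isRadical _ _ h1)

variable [Finite K]

theorem IsDualFactorization.pairwise_isCoprime (hK : Nat.card K = (p ^ k) ^ 2)
    (hf : IsDualFactorization (p ^ k) f ρ a s s' b) :
    Pairwise (Function.onFun IsCoprime (factorPoly ρ s s')) := by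
  have hσ := iterateFrobenius_involutive (p := p) (k := k) hK
  have hs'm : ∀ j, (s' j).Monic := fun j => by
    rw [hf.eq_dualPoly]
    exact dualPoly_monic (hf.coeff_zero_pair j)
  have hs'i : ∀ j, Irreducible (s' j) := fun j => by
    rw [hf.eq_dualPoly]
    exact dualPoly_irreducible hσ (hf.monic_pair j) (hf.coeff_zero_pair j) (hf.irreducible_pair j)
  have hs'd : ∀ j, dualPoly (iterateFrobenius K p k) (s' j) = s j := fun j => by
    rw [hf.eq_dualPoly]
    exact dualPoly_dualPoly hσ (hf.monic_pair j) (hf.coeff_zero_pair j)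
  have hρs : ∀ i j, ρ i ≠ s j := fun i j e => hf.ne_pair j (by
    rw [hf.eq_dualPoly, ← e, hf.dualPoly_self])
  have hρs' : ∀ i j, ρ i ≠ s' j := fun i j e => hρs i j (by
    rw [← hs'd, ← e, hf.dualPoly_self])
  have c1 : ∀ i j, IsCoprime (ρ i) (s j * s' j) := fun i j =>
    (isCoprime_of_irreducible_of_ne (hf.irreducible_self i) (hf.irreducible_pair j)
      (hf.monic_self i) (hf.monic_pair j) (hρs i j)).mul_right
    (isCoprime_of_irreducible_of_ne (hf.irreducible_self i) (hs'i j) (hf.monic_self i) (hs'm j)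
      (hρs' i j))
  rintro (i | j) (i' | j') hne
  · exact isCoprime_of_irreducible_of_ne (hf.irreducible_self i) (hf.irreducible_self i')
      (hf.monic_self i) (hf.monic_self i') fun e => hne (congrArg _ (hf.injective_self e))
  · exact c1 i j'
  · exact (c1 i' j).symm
  · have hjj : j ≠ j' := fun e => hne (congrArg _ e)
    have d := hf.distinct_pair j j' hjj
    have d' := hf.distinct_pair j' j hjj.symm
    refine IsCoprime.mul_left (IsCoprime.mul_right ?_ ?_) (IsCoprime.mul_right ?_ ?_)
    · exact isCoprime_of_irreducible_of_ne (hf.irreducible_pair j) (hf.irreducible_pair j')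
        (hf.monic_pair j) (hf.monic_pair j') d.1
    · exact isCoprime_of_irreducible_of_ne (hf.irreducible_pair j) (hs'i j')
        (hf.monic_pair j) (hs'm j') d.2
    · exact isCoprime_of_irreducible_of_ne (hs'i j) (hf.irreducible_pair j')
        (hs'm j) (hf.monic_pair j') d'.2.symm
    · exact isCoprime_of_irreducible_of_ne (hs'i j) (hs'i j') (hs'm j) (hs'm j') fun e =>
        d.1 (by rw [← hs'd, e, hs'd])

theorem IsDualFactorization.dualPoly_factorPoly (hK : Nat.card K = (p ^ k) ^ 2)
    (hf : IsDualFactorization (p ^ k) f ρ a s s' b) (i : Fin I ⊕ Fin J) :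
    dualPoly (iterateFrobenius K p k) (factorPoly ρ s s' i) = factorPoly ρ s s' i := by
  rcases i with i | j
  · exact hf.dualPoly_self i
  · change dualPoly _ (s j * s' j) = s j * s' j
    rw [dualPoly_mul, ← hf.eq_dualPoly, hf.eq_dualPoly, dualPoly_dualPoly
      (iterateFrobenius_involutive hK) (hf.monic_pair j) (hf.coeff_zero_pair j), mul_comm]

theorem IsDualFactorization.coeff_zero_factorPoly
    (hf : IsDualFactorization (p ^ k) f ρ a s s' b) (i : Fin I ⊕ Fin J) :
    (factorPoly ρ s s' i).coeff 0 ≠ 0 := by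
  rcases i with i | j
  · exact hf.coeff_zero_self i
  · change (s j * s' j).coeff 0 ≠ 0
    rw [mul_coeff_zero, hf.eq_dualPoly]
    exact mul_ne_zero (hf.coeff_zero_pair j)
      (dualPoly_coeff_ne_zero (hf.monic_pair j) (hf.coeff_zero_pair j))

/-- The equivariant Euler characteristic of a semisimple isometry as a product over the self-dual
factors of the characteristic polynomial and the pairs of dual factors. -/
theorem isoEuler_eq_of_isDualFactorization [Finite V] [FiniteDimensional K V]
    (hV : 0 < Module.finrank K V) (hk : 0 < k)
    (hK : Nat.card K = (p ^ k) ^ 2) (hh : IsHerm (p ^ k) h)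
    (hnd : ∀ u, (∀ v, h u v = 0) → u = 0) {g : V →ₗ[K] V} (hg : ∀ u v, h (g u) (g v) = h u v)
    {μ : K[X]} (hμ : Squarefree μ) (hμg : aeval g μ = 0)
    (hf : IsDualFactorization (p ^ k) g.charpoly ρ a s s' b) (r : ℕ) :
    isoEuler r h g = (∏ i, -chiGU p (k * (ρ i).natDegree) (a i) r) *
      ∏ j, chiGL p (2 * (k * (s j).natDegree)) (b j) r := by
  classical
  have hσ := iterateFrobenius_involutive (p := p) (k := k) hK
  set t := factorPoly ρ s s' with ht
  have hprod := hf.eq_prod_factorPoly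
  have hcop := hf.pairwise_isCoprime hK
  have h0 := aeval_prod_eq_zero hμ hμg hprod
  rw [← ht] at hprod h0 hcop
  have hne : Nonempty (Fin I ⊕ Fin J) := by
    by_contra hemp
    rw [not_nonempty_iff] at hemp
    rw [← LinearMap.charpoly_natDegree g, hprod, Finset.univ_eq_empty, Finset.prod_empty,
      natDegree_one] at hV
    exact hV.ne rfl
  -- The partition of unity of the Chinese remainder theorem: the `E i` evaluate at `g` to the
  -- projections onto the kernels of the `t i (g)`.
  obtain ⟨c, hc⟩ := exists_sum_eq_one_iff_pairwise_coprime'.mpr hcop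
  let E : Fin I ⊕ Fin J → K[X] := fun i => c i * ∏ j ∈ {i}ᶜ, t j
  have hzero : ∀ P : K[X], (∏ i, t i) ∣ P → aeval g P = 0 := by
    rintro _ ⟨P, rfl⟩
    rw [map_mul, h0, zero_mul]
  have htE : ∀ i, t i * E i = c i * ∏ j, t j := fun i => by
    rw [Fintype.prod_eq_mul_prod_compl i]
    simp only [E]
    ring
  have hdvd : ∀ i j, i ≠ j → t i ∣ E j := fun i j hij =>
    (Finset.dvd_prod_of_mem t (by simpa using hij)).mul_left _
  have hsum : ∑ i, aeval g (E i) = 1 := by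
    rw [← map_sum, hc, map_one]
  have hmul : ∀ i j, i ≠ j → aeval g (E i) * aeval g (E j) = 0 := by
    intro i j hij
    rw [← map_mul]
    refine hzero _ ?_
    have h1 : (∏ l, t l) ∣ E i * t i := ⟨c i, by rw [mul_comm, htE, mul_comm]⟩
    exact h1.trans (mul_dvd_mul_left _ (hdvd i j hij))
  have hker : ∀ i x, aeval g (t i) (aeval g (E i) x) = 0 := by
    intro i x
    rw [← Module.End.mul_apply, ← map_mul, hzero _ ⟨c i, by rw [htE, mul_comm]⟩,
      LinearMap.zero_apply]
  have hsum' : ∀ x, ∑ i, aeval g (E i) x = x := fun x => by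
    rw [← LinearMap.sum_apply, hsum, Module.End.one_apply]
  -- Each `t i` is its own dual (the product of a pair included) and prime to `t j`, so the kernels
  -- are orthogonal.
  have hort : ∀ i j, i ≠ j → ∀ x y, aeval g (t i) x = 0 → aeval g (t j) y = 0 → h x y = 0 :=
    fun i j hij x y => hh.orthogonal_ker (iterateFrobenius_def p k) hσ hg (t i) (t j)
      (hf.coeff_zero_factorPoly i) (by
        rw [ht, hf.dualPoly_factorPoly hK]
        exact hcop hij) x y
  have hW : ∀ i x, x ∈ LinearMap.ker (aeval g (t i)) ↔ aeval g (E i) x = x := by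
    intro i x
    rw [LinearMap.mem_ker]
    constructor
    · intro hx
      conv_rhs => rw [← hsum' x]
      rw [Finset.sum_eq_single_of_mem i (Finset.mem_univ i)]
      intro j _ hj
      obtain ⟨P, hP⟩ := hdvd i j hj.symm
      rw [hP, mul_comm, map_mul, Module.End.mul_apply, hx, map_zero]
    · intro hx
      rw [← hx, hker]
  have hndW : ∀ i, ∀ u : LinearMap.ker (aeval g (t i)),
      (∀ v : LinearMap.ker (aeval g (t i)), h u v = 0) → u = 0 := by
    intro i u hu
    refine Subtype.ext (hnd _ fun v => ?_)
    rw [← hsum' v, hh.sum_right]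
    refine Finset.sum_eq_zero fun j _ => ?_
    by_cases hij : i = j
    · subst hij
      exact hu ⟨_, hker i v⟩
    · exact hort i j hij _ _ u.2 (hker j v)
  have hrest : ∀ i, g.charpoly = t i ^ Sum.elim a b i *
      ∏ j ∈ Finset.univ.erase i, t j ^ Sum.elim a b j := fun i => by
    rw [Finset.mul_prod_erase _ (fun j => t j ^ Sum.elim a b j) (Finset.mem_univ i), ← hprod]
  have hrestc : ∀ i, IsCoprime (t i) (∏ j ∈ Finset.univ.erase i, t j ^ Sum.elim a b j) := fun i =>
    IsCoprime.prod_right fun j hj => (hcop (Finset.ne_of_mem_erase hj).symm).pow_right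
  rw [isoEuler_eq_prod hh g r E hsum hmul (fun i j hij u v => hort i j hij _ _ (hker i u)
    (hker j v)) (fun i => LinearMap.ker (aeval g (t i))) hW (fun i => apply_mem_ker_aeval g (t i)),
    Fintype.prod_sum_type]
  congr 1
  · refine Finset.prod_congr rfl fun i _ => ?_
    exact isoEuler_selfDual hk hK (hh.restrict _) (hndW (Sum.inl i)) _ (fun u v => hg u v) (ρ i)
      (hf.irreducible_self i) (hf.coeff_zero_self i) (hf.dualPoly_self i) (aeval_restrict_ker g _)
      (a i) (finrank_ker_aeval g μ hμ hμg (ρ i) (hf.irreducible_self i) (hf.monic_self i) (a i) _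
        (hrest (Sum.inl i)) (hrestc (Sum.inl i))) r
  · refine Finset.prod_congr rfl fun j _ => ?_
    refine isoEuler_pair hk hK (hh.restrict _) (hndW (Sum.inr j)) _ (fun u v => hg u v) (s j) (s' j)
      (hf.irreducible_pair j) (hf.monic_pair j) (hf.coeff_zero_pair j) (hf.eq_dualPoly j)
      (hf.ne_pair j) (aeval_restrict_ker g _) (b j) (hf.pos_pair j) ?_ r
    have hs'i : Irreducible (s' j) := by
      rw [hf.eq_dualPoly]
      exact dualPoly_irreducible hσ (hf.monic_pair j) (hf.coeff_zero_pair j) (hf.irreducible_pair j)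
    have hs'm : (s' j).Monic := by
      rw [hf.eq_dualPoly]
      exact dualPoly_monic (hf.coeff_zero_pair j)
    have h1 := finrank_ker_aeval g μ hμ hμg (s j) (hf.irreducible_pair j) (hf.monic_pair j) (b j)
      (s' j ^ b j * ∏ i ∈ Finset.univ.erase (Sum.inr j), t i ^ Sum.elim a b i)
      (by
        rw [← mul_assoc, ← mul_pow]
        exact hrest (Sum.inr j))
      ((isCoprime_of_irreducible_of_ne (hf.irreducible_pair j) hs'i (hf.monic_pair j) hs'm
        (hf.ne_pair j)).pow_right.mul_right (hrestc (Sum.inr j)).of_mul_left_left)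
    -- The kernel of `s j` on the summand is its kernel on all of `V`, since the latter lies in the
    -- kernel of `s j * s' j`.
    rw [← h1, ← Submodule.finrank_map_subtype_eq]
    refine congrArg (fun U : Submodule K V => Module.finrank K U) (Submodule.ext fun x => ?_)
    constructor
    · rintro ⟨y, hy, rfl⟩
      rw [SetLike.mem_coe, LinearMap.mem_ker] at hy
      rw [LinearMap.mem_ker, Submodule.subtype_apply, ← coe_aeval_restrict
        (apply_mem_ker_aeval g (t (Sum.inr j)))]
      exact congrArg Subtype.val hy
    · intro hx
      have hx' : x ∈ LinearMap.ker (aeval g (t (Sum.inr j))) := by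
        change aeval g (s j * s' j) x = 0
        rw [mul_comm, map_mul, Module.End.mul_apply, LinearMap.mem_ker.mp hx, map_zero]
      refine ⟨⟨x, hx'⟩, ?_, rfl⟩
      rw [SetLike.mem_coe, LinearMap.mem_ker]
      refine Subtype.ext ?_
      rw [coe_aeval_restrict]
      exact hx

end Factorization

/-! ### Existence of the dual factorization. -/

section Existence

variable {K V : Type*} [Field K] {p : ℕ} [Fact p.Prime] [CharP K p] {k : ℕ}
  [AddCommGroup V] [Module K V] [FiniteDimensional K V] {h : V → V → K}

theorem charpoly_coeff_zero_ne_zero {g : V →ₗ[K] V} (hg : Function.Injective g) :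
    g.charpoly.coeff 0 ≠ 0 := by
  intro h0
  have h1 := LinearMap.det_eq_sign_charpoly_coeff g
  rw [h0, mul_zero] at h1
  exact (LinearMap.bot_lt_ker_of_det_eq_zero h1).ne' (LinearMap.ker_eq_bot.mpr hg)

variable [Finite K]

/-- The characteristic polynomial of a semisimple isometry factors into self-dual irreducible
polynomials and pairs of dual irreducible polynomials. -/
theorem exists_isDualFactorization (hK : Nat.card K = (p ^ k) ^ 2) (hh : IsHerm (p ^ k) h)
    (hnd : ∀ u, (∀ v, h u v = 0) → u = 0) {g : V →ₗ[K] V} (hg : ∀ u v, h (g u) (g v) = h u v)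
    {μ : K[X]} (hμ : Squarefree μ) (hμg : aeval g μ = 0) :
    ∃ (I J : ℕ) (ρ : Fin I → K[X]) (a : Fin I → ℕ) (s s' : Fin J → K[X]) (b : Fin J → ℕ),
      IsDualFactorization (p ^ k) g.charpoly ρ a s s' b := by
  classical
  have hσ := iterateFrobenius_involutive (p := p) (k := k) hK
  have hq : p ^ k ≠ 0 := pow_ne_zero _ (Fact.out : p.Prime).ne_zero
  set f := g.charpoly with hf
  have hfm : f.Monic := g.charpoly_monic
  have hf0 : f.coeff 0 ≠ 0 := charpoly_coeff_zero_ne_zero (by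
    rw [injective_iff_map_eq_zero]
    intro u hu
    refine hnd u fun v => ?_
    rw [← hg, hu, hh.zero_left])
  let M := UniqueFactorizationMonoid.normalizedFactors f
  let N : K[X] → ℕ := fun t => M.count t
  let S := M.toFinset
  have hSi : ∀ t ∈ S, Irreducible t := fun t ht =>
    UniqueFactorizationMonoid.irreducible_of_normalized_factor t (Multiset.mem_toFinset.mp ht)
  have hSm : ∀ t ∈ S, t.Monic := fun t ht => by
    rw [← UniqueFactorizationMonoid.normalize_normalized_factor t (Multiset.mem_toFinset.mp ht)]
    exact monic_normalize (hSi t ht).ne_zero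
  have hS0 : ∀ t ∈ S, t.coeff 0 ≠ 0 := fun t ht h0 => by
    obtain ⟨c, hc⟩ := UniqueFactorizationMonoid.dvd_of_mem_normalizedFactors
      (Multiset.mem_toFinset.mp ht)
    apply hf0
    rw [hc, mul_coeff_zero, h0, zero_mul]
  have hprod : f = ∏ t ∈ S, t ^ N t := by
    rw [← Finset.prod_multiset_count, UniqueFactorizationMonoid.prod_normalizedFactors_eq
      hfm.ne_zero, hfm.normalize_eq_self]
  have hN : ∀ t, t ∈ S ↔ 0 < N t := fun t => by
    rw [Multiset.mem_toFinset, ← Multiset.count_pos]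
  have hrest : ∀ t, f = t ^ N t * ∏ x ∈ S.erase t, x ^ N x := by
    intro t
    by_cases ht : t ∈ S
    · rw [Finset.mul_prod_erase _ (fun x => x ^ N x) ht, ← hprod]
    · have h1 : N t = 0 := by
        rw [hN] at ht
        omega
      rw [h1, pow_zero, one_mul, Finset.erase_eq_of_notMem ht, ← hprod]
  -- Stated for every monic irreducible `t`, divisor or not, so that it applies to `D t` before `D
  -- t` is known to divide `f`.
  have hdim : ∀ t, Irreducible t → t.Monic →
      Module.finrank K (LinearMap.ker (aeval g t)) = N t * t.natDegree := fun t hti htm =>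
    finrank_ker_aeval g μ hμ hμg t hti htm (N t) _ (hrest t) (IsCoprime.prod_right fun x hx =>
      (isCoprime_of_irreducible_of_ne hti (hSi x (Finset.mem_of_mem_erase hx)) htm
        (hSm x (Finset.mem_of_mem_erase hx)) (Finset.ne_of_mem_erase hx).symm).pow_right)
  let D : K[X] → K[X] := dualPoly (iterateFrobenius K p k)
  have hND : ∀ t ∈ S, N (D t) = N t := by
    intro t ht
    have h1 := hh.finrank_ker_dualPoly hq hnd (iterateFrobenius_def p k) hσ hg t (hS0 t ht)
    rw [hdim _ (dualPoly_irreducible hσ (hSm t ht) (hS0 t ht) (hSi t ht))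
      (dualPoly_monic (hS0 t ht)), hdim t (hSi t ht) (hSm t ht),
      natDegree_dualPoly (hS0 t ht)] at h1
    exact Nat.eq_of_mul_eq_mul_right (hSi t ht).natDegree_pos h1
  have hDS : ∀ t ∈ S, D t ∈ S := fun t ht => by
    rw [hN, hND t ht, ← hN]
    exact ht
  have hDD : ∀ t ∈ S, D (D t) = t := fun t ht => dualPoly_dualPoly hσ (hSm t ht) (hS0 t ht)
  -- An arbitrary linear order serves to choose the smaller member of each pair `{t, D t}`.
  obtain ⟨hord, -⟩ := exists_wellFoundedLT K[X]
  let S₀ := S.filter fun t => D t = t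
  let S₁ := S.filter fun t => t < D t
  have hS₀ : ∀ t, t ∈ S₀ ↔ t ∈ S ∧ D t = t := fun t => Finset.mem_filter
  have hS₁ : ∀ t, t ∈ S₁ ↔ t ∈ S ∧ t < D t := fun t => Finset.mem_filter
  have hdual : ∏ t ∈ S.filter (fun t => D t < t), t ^ N t = ∏ t ∈ S₁, D t ^ N t := by
    refine Finset.prod_nbij' D D ?_ ?_ ?_ ?_ ?_
    · intro t ht
      rw [Finset.mem_filter] at ht
      rw [hS₁, hDD t ht.1]
      exact ⟨hDS t ht.1, ht.2⟩
    · intro t ht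
      rw [hS₁] at ht
      rw [Finset.mem_filter, hDD t ht.1]
      exact ⟨hDS t ht.1, ht.2⟩
    · exact fun t ht => hDD t (Finset.mem_filter.mp ht).1
    · exact fun t ht => hDD t ((hS₁ t).mp ht).1
    · intro t ht
      rw [hDD t (Finset.mem_filter.mp ht).1, hND t (Finset.mem_filter.mp ht).1]
  have hsplit : f = (∏ t ∈ S₀, t ^ N t) * ∏ t ∈ S₁, (t * D t) ^ N t := by
    simp only [mul_pow]
    rw [Finset.prod_mul_distrib, ← hdual, hprod,
      ← Finset.prod_filter_mul_prod_filter_not S fun t => D t = t]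
    congr 1
    rw [← Finset.prod_filter_mul_prod_filter_not (S.filter fun t => ¬D t = t) fun t => t < D t,
      Finset.filter_filter, Finset.filter_filter]
    congr 1
    · refine Finset.prod_congr (Finset.filter_congr fun t _ => ?_) fun _ _ => rfl
      exact ⟨fun h1 => h1.2, fun h1 => ⟨h1.ne', h1⟩⟩
    · refine Finset.prod_congr (Finset.filter_congr fun t _ => ?_) fun _ _ => rfl
      exact ⟨fun h1 => lt_of_le_of_ne (not_lt.mp h1.2) h1.1, fun h1 => ⟨h1.ne, h1.not_gt⟩⟩
  let e₀ := S₀.equivFin.symm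
  let e₁ := S₁.equivFin.symm
  have m₀ := fun i => (hS₀ (e₀ i).1).mp (e₀ i).2
  have m₁ := fun j => (hS₁ (e₁ j).1).mp (e₁ j).2
  refine ⟨S₀.card, S₁.card, fun i => e₀ i, fun i => N (e₀ i), fun j => e₁ j, fun j => D (e₁ j),
    fun j => N (e₁ j), ?_⟩
  refine
    { monic_self := fun i => hSm _ (m₀ i).1
      irreducible_self := fun i => hSi _ (m₀ i).1
      coeff_zero_self := fun i => hS0 _ (m₀ i).1
      dual_self := fun i => (isDual_iff (hSm _ (m₀ i).1) (hS0 _ (m₀ i).1) _).mpr (m₀ i).2.symm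
      injective_self := Subtype.val_injective.comp e₀.injective
      pos_self := fun i => (hN _).mp (m₀ i).1
      monic_pair := fun j => hSm _ (m₁ j).1
      irreducible_pair := fun j => hSi _ (m₁ j).1
      coeff_zero_pair := fun j => hS0 _ (m₁ j).1
      dual_pair := fun j => (isDual_iff (hSm _ (m₁ j).1) (hS0 _ (m₁ j).1) _).mpr rfl
      ne_pair := fun j => (m₁ j).2.ne
      distinct_pair := fun j j' hjj => ⟨fun e => hjj (e₁.injective (Subtype.ext e)), fun e => ?_⟩
      pos_pair := fun j => (hN _).mp (m₁ j).1
      eq_prod := ?_ }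
  · have h1 := (m₁ j).2
    rw [e, hDD _ (m₁ j').1] at h1
    exact lt_asymm h1 (m₁ j').2
  · rw [Fintype.prod_equiv e₀ _ (fun t : S₀ => t.1 ^ N t.1) fun _ => rfl,
      Fintype.prod_equiv e₁ _ (fun t : S₁ => (t.1 * D t.1) ^ N t.1) fun _ => rfl,
      Finset.prod_coe_sort S₀ fun t => t ^ N t,
      Finset.prod_coe_sort S₁ fun t => (t * D t) ^ N t]
    exact hsplit

end Existence

/-! ### Elements of order prime to `p`. -/

section Centralizer

variable {p : ℕ} [Fact p.Prime] {k n : ℕ}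

theorem neg_chiCentralizer_eq_isoEuler (r : ℕ) (g : GU p k n) :
    -chiCentralizer p k n r g =
      isoEuler r (hermForm (GaloisField p (2 * k)) (p ^ k) n) g.1.toLinearMap := by
  unfold chiCentralizer isoEuler
  have h1 : GU p k n ⊓ Subgroup.centralizer {g.1} =
      isoGrp (hermForm (GaloisField p (2 * k)) (p ^ k) n) g.1.toLinearMap := by
    ext φ
    rw [Subgroup.mem_inf, Subgroup.mem_centralizer_singleton_iff, mem_isoGrp]
    exact and_congr Iff.rfl ⟨fun e v => LinearEquiv.congr_fun e v,
      fun e => LinearEquiv.ext fun v => e v⟩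
  have h2 : {U | U ∈ isotropicPoset (GaloisField p (2 * k)) (p ^ k) n ∧ g.1 • U = U} =
      {U | U ∈ isoSub (hermForm (GaloisField p (2 * k)) (p ^ k) n) g.1.toLinearMap ∧ U ≠ ⊥} := by
    ext U
    rw [Set.mem_ofPred_eq, Set.mem_ofPred_eq, smul_eq_self_iff]
    exact ⟨fun ⟨⟨a, b⟩, c⟩ => ⟨⟨b, c⟩, a⟩, fun ⟨⟨b, c⟩, a⟩ => ⟨⟨a, b⟩, c⟩⟩
  rw [h1, h2]

/-- `X ^ m - 1` is separable when the order `m` of `g` is prime to the characteristic. -/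
theorem exists_squarefree_aeval_eq_zero (hk : 0 < k) (g : GU p k n)
    (hg : Nat.Coprime (p ^ k) (orderOf g)) :
    ∃ μ : (GaloisField p (2 * k))[X], Squarefree μ ∧ aeval g.1.toLinearMap μ = 0 := by
  refine ⟨X ^ orderOf g - 1, ?_, ?_⟩
  · refine (X_pow_sub_one_separable_iff.mpr ?_).squarefree
    rw [Ne, CharP.cast_eq_zero_iff (GaloisField p (2 * k)) p]
    exact (Nat.Prime.coprime_iff_not_dvd Fact.out).mp (hg.coprime_dvd_left (dvd_pow_self p hk.ne'))
  · have h1 : g.1 ^ orderOf g = 1 := by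
      rw [← Subgroup.coe_pow, pow_orderOf_eq_one, Subgroup.coe_one]
    have h2 : ∀ m : ℕ, (g.1.toLinearMap ^ m) = (g.1 ^ m).toLinearMap := by
      intro m
      induction m with
      | zero => rfl
      | succ m ih => rw [pow_succ, pow_succ, ih]; rfl
    rw [map_sub, map_pow, aeval_X, map_one, h2, h1, sub_eq_zero]
    rfl

end Centralizer

end UnitaryEuler

end

open UnitaryEuler in
theorem lemma4p3 (p : ℕ) [Fact p.Prime] (k : ℕ) (hk : 0 < k) (n : ℕ) (hn : 1 < n)
    (r : ℕ) (hr : 1 ≤ r) :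
    -- the sum over the `q`-regular classes, `q = p ^ k`, for any choice of representatives
    (∀ rep : ConjClasses (GU p k n) → GU p k n, (∀ c, ConjClasses.mk (rep c) = c) →
      chiGU p k n (r + 1) =
        ∑ᶠ (c : ConjClasses (GU p k n)) (_ : Nat.Coprime (p ^ k) (orderOf (rep c))),
          chiCentralizer p k n r (rep c)) ∧
    -- the contribution of a `q`-regular class
    ∀ g : GU p k n, Nat.Coprime (p ^ k) (orderOf g) →
      (∃ (I J : ℕ) (ρ : Fin I → Polynomial (GaloisField p (2 * k))) (a : Fin I → ℕ)
          (s s' : Fin J → Polynomial (GaloisField p (2 * k))) (b : Fin J → ℕ),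
        IsDualFactorization (p ^ k) (LinearMap.charpoly g.1.toLinearMap) ρ a s s' b) ∧
      ∀ (I J : ℕ) (ρ : Fin I → Polynomial (GaloisField p (2 * k))) (a : Fin I → ℕ)
          (s s' : Fin J → Polynomial (GaloisField p (2 * k))) (b : Fin J → ℕ),
        IsDualFactorization (p ^ k) (LinearMap.charpoly g.1.toLinearMap) ρ a s s' b →
          (∑ i, a i * (ρ i).natDegree) + (∑ j, 2 * (b j * (s j).natDegree)) = n ∧
          -chiCentralizer p k n r g =
            (∏ i, -chiGU p (k * (ρ i).natDegree) (a i) r) *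
              ∏ j, chiGL p (2 * (k * (s j).natDegree)) (b j) r := by
  refine ⟨fun rep hrep => chiGU_succ p k hk n r rep hrep, fun g hg => ?_⟩
  have hK := card_galoisField p k hk
  have hh := isHerm_hermForm hk hK n
  have hnd := hermForm_nondegenerate hk hK n
  obtain ⟨μ, hμ, hμg⟩ := exists_squarefree_aeval_eq_zero hk g hg
  refine ⟨exists_isDualFactorization hK hh hnd g.2 hμ hμg, fun I J ρ a s s' b hf => ⟨?_, ?_⟩⟩
  · rw [← hf.natDegree_eq, LinearMap.charpoly_natDegree, Module.finrank_fin_fun]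
  · rw [neg_chiCentralizer_eq_isoEuler]
    exact isoEuler_eq_of_isDualFactorization (by rw [Module.finrank_fin_fun]; omega) hk hK hh hnd
      g.2 hμ hμg hf r
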